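/- **Theorem 2.2.** For every $n\in\mathbb N=\{1,2,\dots\}$ let $a_n(p,q)$, $1\le p\le q\le n$, be real random variables, all defined on one common probability space $(\Omega,\mathcal F,\mathbb P)$, and let $X_n$ be the real symmetric random $n\times n$ matrix with $$X_n(p,q)=X_n(q,p)=\tfrac1{\sqrt n}\,a_n(p,q),\qquad 1\le p\le q\le n .$$ Assume: * (A1) $\mathbb E(a_n(p,q))=0$ and $\mathbb E(a_n(p,q)^2)=1$ for all $n$ and all $1\le p\le q\le n$. * (A2) For every $k\in\mathbb N$, $\ \sup_{n\in\mathbb N}\max_{1\le p\le q\le n}\mathbb E\big(|a_n(p,q)|^k\big)<\infty$. * (A3) For every $n$, the families $\{a_n(p,q): 1\le p\le q\le n,\ p+q=r\}$, $r=2,3,\dots,2n$, are independent. * (C1) For every $n$ there is a function $c_n:\{0,1,2,\dots\}\to[0,\infty)$ such that (i) for all $1\le p\le q\le n$ and $1\le r\le s\le n$ with $p+q=r+s$, $$|\mathrm{Cov}(a_n(p,q),a_n(r,s))|=c_n(|p-r|)=c_n(|q-s|);$$ (ii) $\displaystyle\sum_{\tau=0}^{n-1}c_n(\tau)=o(n)$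 as $n\to\infty$. Let $\lambda_1^{(n)}\le\dots\le\lambda_n^{(n)}$ be the eigenvalues of $X_n$, counted with multiplicity, and let $\mu_n=\frac1n\sum_{k=1}^n\delta_{\lambda_k^{(n)}}$ be the empirical eigenvalue distribution of $X_n$. Then, with probability one, $\mu_n$ converges weakly as $n\to\infty$ to the standard semicircle distribution $\mu$, the probability measure on $\mathbb R$ with Lebesgue density $$\frac{d\mu}{dx}(x)=\frac1{2\pi}\sqrt{4-x^2}\;\mathbf 1_{[-2,2]}(x).$$ -/

import Mathlib

open MeasureTheory ProbabilityTheory Filter Topology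

/-- The empirical eigenvalue distribution `(1/N) ∑ₖ δ_{λₖ}` of a real symmetric matrix, where the
`λₖ` are its `N` eigenvalues counted with multiplicity, as a measure on the real line. -/
noncomputable def empiricalEigenvalueMeasure {ι : Type*} [Fintype ι] [DecidableEq ι]
    {A : Matrix ι ι ℝ} (hA : A.IsHermitian) : Measure ℝ :=
  (Fintype.card ι : ENNReal)⁻¹ • ∑ k, Measure.dirac (hA.eigenvalues k)

theorem isProbabilityMeasure_empiricalEigenvalueMeasure {ι : Type*} [Fintype ι] [DecidableEq ι]
    [Nonempty ι] {A : Matrix ι ι ℝ} (hA : A.IsHermitian) :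
    IsProbabilityMeasure (empiricalEigenvalueMeasure hA) := by
  constructor
  simp [empiricalEigenvalueMeasure, ENNReal.inv_mul_cancel]

/-- The empirical eigenvalue distribution as a probability measure on the real line. -/
noncomputable def empiricalEigenvalueDistribution {ι : Type*} [Fintype ι] [DecidableEq ι]
    [Nonempty ι] {A : Matrix ι ι ℝ} (hA : A.IsHermitian) : ProbabilityMeasure ℝ :=
  ⟨empiricalEigenvalueMeasure hA, isProbabilityMeasure_empiricalEigenvalueMeasure hA⟩

/-- The measure on the real line with Lebesgue density `(1 / 2π) √(4 - x²) 1_{[-2,2]}(x)`. -/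
noncomputable def semicircleMeasure : Measure ℝ :=
  volume.withDensity fun x => ENNReal.ofReal
    ((Set.Icc (-2 : ℝ) 2).indicator (fun x => 1 / (2 * Real.pi) * √(4 - x ^ 2)) x)

theorem isProbabilityMeasure_semicircleMeasure : IsProbabilityMeasure semicircleMeasure := by
  have hc : Continuous fun x : ℝ => 1 / (2 * Real.pi) * √(4 - x ^ 2) := by fun_prop
  have hint : Integrable
      ((Set.Icc (-2 : ℝ) 2).indicator (fun x => 1 / (2 * Real.pi) * √(4 - x ^ 2))) := by
    rw [integrable_indicator_iff measurableSet_Icc]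
    exact hc.continuousOn.integrableOn_compact isCompact_Icc
  have hnn : ∀ x, 0 ≤
      (Set.Icc (-2 : ℝ) 2).indicator (fun x => 1 / (2 * Real.pi) * √(4 - x ^ 2)) x := by
    intro x
    exact Set.indicator_nonneg (fun y _ => by positivity) x
  have hval : ∫ x in (-2 : ℝ)..2, √(4 - x ^ 2) = 2 * Real.pi := by
    have h := intervalIntegral.mul_integral_comp_mul_left (a := -1) (b := 1)
      (f := fun x : ℝ => √(4 - x ^ 2)) (c := 2)
    have h2 : ∀ x : ℝ, √(4 - (2 * x) ^ 2) = 2 * √(1 - x ^ 2) := by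
      intro x
      rw [show (4 : ℝ) - (2 * x) ^ 2 = 2 ^ 2 * (1 - x ^ 2) by ring,
        Real.sqrt_mul (by norm_num), Real.sqrt_sq (by norm_num)]
    simp only [h2, intervalIntegral.integral_const_mul, integral_sqrt_one_sub_sq] at h
    norm_num at h
    rw [← h]
    ring
  constructor
  rw [semicircleMeasure, withDensity_apply _ MeasurableSet.univ, Measure.restrict_univ,
    ← ofReal_integral_eq_lintegral_ofReal hint (Eventually.of_forall hnn),
    integral_indicator measurableSet_Icc, integral_Icc_eq_integral_Ioc,
    ← intervalIntegral.integral_of_le (by norm_num), intervalIntegral.integral_const_mul, hval]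
  have := Real.pi_pos
  rw [one_div_mul_cancel (by positivity), ENNReal.ofReal_one]

/-- The standard semicircle distribution. -/
noncomputable def semicircleDistribution : ProbabilityMeasure ℝ :=
  ⟨semicircleMeasure, isProbabilityMeasure_semicircleMeasure⟩

/-- The symmetric `n × n` matrix with entries `n^{-1/2} a(p,q)` for `p ≤ q`; only the values of `a`
on and above the diagonal are used. -/
noncomputable def rescaledSymmetricMatrix {n : ℕ} (a : Fin n → Fin n → ℝ) :
    Matrix (Fin n) (Fin n) ℝ :=
  Matrix.of fun p q => 1 / √(n : ℝ) * a (min p q) (max p q)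

theorem isHermitian_rescaledSymmetricMatrix {n : ℕ} (a : Fin n → Fin n → ℝ) :
    (rescaledSymmetricMatrix a).IsHermitian := by
  ext p q
  simp [rescaledSymmetricMatrix, min_comm, max_comm]

/-- The positions on or above the diagonal of an `n × n` matrix that lie on the `r`-th
skew-diagonal `p + q = r`. Rows and columns are numbered `1, …, n` in this equation, while `Fin n`
starts at `0`. The set is empty unless `2 ≤ r ≤ 2 n`. -/
def SkewDiagonal (n r : ℕ) : Type :=
  {pq : Fin n × Fin n // pq.1 ≤ pq.2 ∧ ((pq.1 : ℕ) + 1) + ((pq.2 : ℕ) + 1) = r}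

/-! The proof works with resolvents. Put G = (X - iy)⁻¹ and m = i(√(y² + 4) - y)/2, the Stieltjes
transform of the semicircle law at iy, which solves 1 + iym + m² = 0. By `tendsto_of_tendsto_cauchy`
it is enough that n⁻¹ tr G → m almost surely for each rational y > 2. All matrix estimates use the
Frobenius norm.

The geometric fact behind everything is that a skew-diagonal meets each row and each column at most
once. Hence the part D of X on the skew-diagonal r acts by multiplication with norm at most its
largest entry, which is at most K/√n when K bounds all |a(p,q)| (`norm_skewPart_mul_le`). Deleting D
therefore changes G only slightly, and by (A3) the resolvent Gr of what remains is independent of D.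
The moment bounds give E K⁸ = O(n^(1/4)).

Fluctuations. The blocks on different skew-diagonals are independent, so Efron–Stein applies with
the function evaluated after deletion of a block as comparison. Its fourth moment form gives E|tr G
- E tr G|⁴ = O(n^(9/4)), which is summable after division by n⁴. Its variance form gives Var tr(SG)
= O(‖S‖²) for every fixed matrix S (`integral_norm_trace_sub_sq_le`).

Mean. Expanding G around Gr to second order in D and integrating D out yields the approximate
Schwinger–Dyson equation E[XG + Σ(G)G] ≈ 0, where Σ(A)(p,v) is the sum over q, u with p + q = u + v
of E(X(p,q)X(u,v)) A(q,u). The entries of Σ(G) are linear statistics tr(SG), so replacing G by its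
mean Q inside Σ costs a multiple of the square root of the sum of the squared covariances. By (C1)
that sum is at most 4 ∑ c_n(τ) = o(n); this is the only use of (C1). Since XG = 1 + iyG, it follows
that 1 + iyQ + Σ(Q)Q = R with ‖R‖ = o(√n) (`norm_meanGreen_equation_le`).

Although entries on one skew-diagonal may be correlated, Σ(1) = 1: for q = u the relation p + q = q
+ v forces p = v, so only variances enter (`contract_entryCov_one`). Thus m·1 solves the equation
exactly. As ‖Σ(A)‖ ≤ 2‖A‖ and |m| < 1/2, the equation is stable at m·1 (`norm_meanGreen_sub_le`), so
‖Q - m·1‖ = o(√n) and n⁻¹ tr Q → m by Cauchy–Schwarz. -/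

/-! ### Weak convergence from Stieltjes transforms on the imaginary axis -/

section WeakConvergence

open BoundedContinuousFunction

theorem ofReal_sub_mul_I_ne_zero {y : ℝ} (hy : y ≠ 0) (x : ℝ) : (x : ℂ) - y * Complex.I ≠ 0 := by
  intro h
  apply hy
  simpa using congrArg Complex.im h

theorem abs_le_norm_ofReal_sub_mul_I (x y : ℝ) : |y| ≤ ‖(x : ℂ) - y * Complex.I‖ := by
  simpa using Complex.abs_im_le_norm ((x : ℂ) - y * Complex.I)

theorem norm_inv_ofReal_sub_mul_I_le {y : ℝ} (hy : y ≠ 0) (x : ℝ) :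
    ‖((x : ℂ) - y * Complex.I)⁻¹‖ ≤ |y|⁻¹ := by
  rw [norm_inv]
  exact inv_anti₀ (abs_pos.2 hy) (abs_le_norm_ofReal_sub_mul_I x y)

/-- The bounded continuous function `x ↦ 1 / (x - i y)`. -/
noncomputable def cauchyKernel (y : ℝ) (hy : y ≠ 0) : ℝ →ᵇ ℂ :=
  BoundedContinuousFunction.ofNormedAddCommGroup (fun x : ℝ => ((x : ℂ) - y * Complex.I)⁻¹)
    (Continuous.inv₀ (by fun_prop) (ofReal_sub_mul_I_ne_zero hy)) |y|⁻¹
    (norm_inv_ofReal_sub_mul_I_le hy)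

@[simp]
theorem cauchyKernel_apply (y : ℝ) (hy : y ≠ 0) (x : ℝ) :
    cauchyKernel y hy x = ((x : ℂ) - y * Complex.I)⁻¹ := rfl

/-- The scalar resolvent identity. Read from right to left it writes a product of two distinct
kernels as a linear combination of them; read from left to right it gives continuity in `y` for the
supremum norm. -/
theorem cauchyKernel_sub (y w : ℝ) (hy : y ≠ 0) (hw : w ≠ 0) :
    cauchyKernel y hy - cauchyKernel w hw =
      (((y - w : ℝ) : ℂ) * Complex.I) • (cauchyKernel y hy * cauchyKernel w hw) := by
  ext x
  have h1 := ofReal_sub_mul_I_ne_zero hy x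
  have h2 := ofReal_sub_mul_I_ne_zero hw x
  simp only [BoundedContinuousFunction.coe_sub, Pi.sub_apply, cauchyKernel_apply,
    BoundedContinuousFunction.coe_smul, BoundedContinuousFunction.coe_mul, Pi.mul_apply,
    smul_eq_mul]
  rw [inv_sub_inv h1 h2, ← mul_inv, div_eq_mul_inv]
  push_cast
  ring

theorem norm_cauchyKernel_le (y : ℝ) (hy : y ≠ 0) : ‖cauchyKernel y hy‖ ≤ |y|⁻¹ :=
  BoundedContinuousFunction.norm_ofNormedAddCommGroup_le _ (by positivity) _

theorem norm_cauchyKernel_sub_le (y w : ℝ) (hy : y ≠ 0) (hw : w ≠ 0) :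
    ‖cauchyKernel y hy - cauchyKernel w hw‖ ≤ |y - w| * (|y|⁻¹ * |w|⁻¹) := by
  rw [cauchyKernel_sub, norm_smul]
  have h : ‖((y - w : ℝ) : ℂ) * Complex.I‖ = |y - w| := by
    rw [norm_mul, Complex.norm_I, mul_one, Complex.norm_real, Real.norm_eq_abs]
  rw [h]
  gcongr
  refine (norm_mul_le _ _).trans ?_
  gcongr <;> exact norm_cauchyKernel_le _ _

theorem star_cauchyKernel (y : ℝ) (hy : y ≠ 0) :
    star (cauchyKernel y hy) = cauchyKernel (-y) (neg_ne_zero.2 hy) := by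
  ext x
  simp [BoundedContinuousFunction.star_apply]

/-- The functions `x ↦ 1 / (x - i y)` with `|y| > 2`. -/
def cauchyKernels : Set (ℝ →ᵇ ℂ) := {f | ∃ (y : ℝ) (hy : y ≠ 0), 2 < |y| ∧ f = cauchyKernel y hy}

/-- The bounded continuous functions whose integrals converge along a sequence of measures. -/
def convergenceSubmodule (μ : ℕ → ProbabilityMeasure ℝ) (ν : ProbabilityMeasure ℝ) :
    Submodule ℂ (ℝ →ᵇ ℂ) where
  carrier := {f | Tendsto (fun n => ∫ x, f x ∂(μ n : Measure ℝ)) atTop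
    (𝓝 (∫ x, f x ∂(ν : Measure ℝ)))}
  add_mem' {f g} hf hg := by
    have h : ∀ ρ : ProbabilityMeasure ℝ, ∫ x, (f + g) x ∂(ρ : Measure ℝ) =
        ∫ x, f x ∂(ρ : Measure ℝ) + ∫ x, g x ∂(ρ : Measure ℝ) := fun ρ =>
      integral_add (f.integrable _) (g.integrable _)
    simp only [Set.mem_ofPred_eq, h] at hf hg ⊢
    exact hf.add hg
  zero_mem' := by simp
  smul_mem' c f hf := by
    have h : ∀ ρ : ProbabilityMeasure ℝ, ∫ x, (c • f) x ∂(ρ : Measure ℝ) =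
        c * ∫ x, f x ∂(ρ : Measure ℝ) := fun ρ => integral_const_mul c _
    simp only [Set.mem_ofPred_eq, h] at hf ⊢
    exact hf.const_mul c

theorem mem_convergenceSubmodule {μ : ℕ → ProbabilityMeasure ℝ} {ν : ProbabilityMeasure ℝ}
    {f : ℝ →ᵇ ℂ} : f ∈ convergenceSubmodule μ ν ↔
      Tendsto (fun n => ∫ x, f x ∂(μ n : Measure ℝ)) atTop (𝓝 (∫ x, f x ∂(ν : Measure ℝ))) :=
  Iff.rfl

theorem norm_integral_sub_integral_le (ρ : ProbabilityMeasure ℝ) (f g : ℝ →ᵇ ℂ) :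
    ‖∫ x, f x ∂(ρ : Measure ℝ) - ∫ x, g x ∂(ρ : Measure ℝ)‖ ≤ ‖f - g‖ := by
  rw [← integral_sub (f.integrable _) (g.integrable _)]
  exact (f - g).norm_integral_le_norm (ρ : Measure ℝ)

/-- An ε/3 argument: integration against any probability measure is 1-Lipschitz for the supremum
norm, uniformly along the sequence. -/
theorem isClosed_convergenceSubmodule (μ : ℕ → ProbabilityMeasure ℝ) (ν : ProbabilityMeasure ℝ) :
    IsClosed (convergenceSubmodule μ ν : Set (ℝ →ᵇ ℂ)) := by
  refine isClosed_of_closure_subset fun f hf => ?_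
  rw [SetLike.mem_coe, mem_convergenceSubmodule, Metric.tendsto_atTop]
  intro ε hε
  obtain ⟨g, hg, hfg⟩ := Metric.mem_closure_iff.1 hf (ε / 3) (by positivity)
  rw [SetLike.mem_coe, mem_convergenceSubmodule, Metric.tendsto_atTop] at hg
  obtain ⟨N, hN⟩ := hg (ε / 3) (by positivity)
  refine ⟨N, fun n hn => ?_⟩
  have h1 := norm_integral_sub_integral_le (μ n) f g
  have h2 := norm_integral_sub_integral_le ν g f
  have h3 := hN n hn
  rw [dist_eq_norm] at hfg h3
  rw [norm_sub_rev g] at h2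
  rw [dist_eq_norm]
  have h4 : ∫ x, f x ∂(μ n : Measure ℝ) - ∫ x, f x ∂(ν : Measure ℝ) =
    (∫ x, f x ∂(μ n : Measure ℝ) - ∫ x, g x ∂(μ n : Measure ℝ)) +
    (∫ x, g x ∂(μ n : Measure ℝ) - ∫ x, g x ∂(ν : Measure ℝ)) -
    (∫ x, f x ∂(ν : Measure ℝ) - ∫ x, g x ∂(ν : Measure ℝ)) := by ring
  rw [h4]
  have h5 := norm_sub_le ((∫ x, f x ∂(μ n : Measure ℝ) - ∫ x, g x ∂(μ n : Measure ℝ)) +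
    (∫ x, g x ∂(μ n : Measure ℝ) - ∫ x, g x ∂(ν : Measure ℝ)))
    (∫ x, f x ∂(ν : Measure ℝ) - ∫ x, g x ∂(ν : Measure ℝ))
  have h6 := norm_add_le (∫ x, f x ∂(μ n : Measure ℝ) - ∫ x, g x ∂(μ n : Measure ℝ))
    (∫ x, g x ∂(μ n : Measure ℝ) - ∫ x, g x ∂(ν : Measure ℝ))
  rw [norm_sub_rev] at h2
  linarith only [h1, h2, h3, h5, h6, hfg]

theorem tendsto_cauchyKernel {y : ℝ} (hy : y ≠ 0) {w : ℕ → ℝ} (hw : ∀ k, w k ≠ 0)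
    (hlim : Tendsto w atTop (𝓝 y)) :
    Tendsto (fun k => cauchyKernel (w k) (hw k)) atTop (𝓝 (cauchyKernel y hy)) := by
  rw [tendsto_iff_norm_sub_tendsto_zero]
  have h : Tendsto (fun k => |w k - y| * (|w k|⁻¹ * |y|⁻¹)) atTop
      (𝓝 (|y - y| * (|y|⁻¹ * |y|⁻¹))) :=
    (hlim.sub_const y).abs.mul ((hlim.abs.inv₀ (abs_ne_zero.2 hy)).mul_const _)
  rw [sub_self, abs_zero, zero_mul] at h
  exact squeeze_zero (fun _ => norm_nonneg _) (fun k => norm_cauchyKernel_sub_le _ _ _ _) h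

/-- The closed linear span of `1` and the functions `x ↦ 1 / (x - i y)` with `|y| > 2`. -/
noncomputable def cauchySpan : Submodule ℂ (ℝ →ᵇ ℂ) :=
  (Submodule.span ℂ (insert 1 cauchyKernels)).topologicalClosure

theorem subset_cauchySpan : insert 1 cauchyKernels ⊆ (cauchySpan : Set (ℝ →ᵇ ℂ)) :=
  Submodule.subset_span.trans (Submodule.le_topologicalClosure _)

theorem cauchyKernel_mul_mem_of_ne {y w : ℝ} (hy : y ≠ 0) (hw : w ≠ 0) (hy2 : 2 < |y|)
    (hw2 : 2 < |w|) (hne : y ≠ w) : cauchyKernel y hy * cauchyKernel w hw ∈ cauchySpan := by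
  have hc : ((y - w : ℝ) : ℂ) * Complex.I ≠ 0 :=
    mul_ne_zero (by exact_mod_cast sub_ne_zero.2 hne) Complex.I_ne_zero
  have h : cauchyKernel y hy * cauchyKernel w hw =
      (((y - w : ℝ) : ℂ) * Complex.I)⁻¹ • (cauchyKernel y hy - cauchyKernel w hw) := by
    rw [cauchyKernel_sub, smul_smul, inv_mul_cancel₀ hc, one_smul]
  rw [h]
  exact Submodule.smul_mem _ _ (Submodule.sub_mem _
    (subset_cauchySpan (Or.inr ⟨y, hy, hy2, rfl⟩)) (subset_cauchySpan (Or.inr ⟨w, hw, hw2, rfl⟩)))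

theorem isClosed_cauchySpan : IsClosed (cauchySpan : Set (ℝ →ᵇ ℂ)) :=
  Submodule.isClosed_topologicalClosure _

theorem cauchyKernel_mul_mem {y w : ℝ} (hy : y ≠ 0) (hw : w ≠ 0) (hy2 : 2 < |y|)
    (hw2 : 2 < |w|) : cauchyKernel y hy * cauchyKernel w hw ∈ cauchySpan := by
  by_cases hne : y = w
  · subst hne
    -- The resolvent identity says nothing about squares. A square is a uniform limit of products
    -- with the kernels at `y * (1 + 1 / (k + 1))`; moving away from the origin keeps the modulus
    -- above 2 and the two points distinct.
    have hlim : Tendsto (fun k : ℕ => y * (1 + 1 / ((k : ℝ) + 1))) atTop (𝓝 y) := by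
      have := (tendsto_one_div_add_atTop_nhds_zero_nat (𝕜 := ℝ)).const_add 1 |>.const_mul y
      simpa using this
    have hk : ∀ k : ℕ, (1 : ℝ) < 1 + 1 / ((k : ℝ) + 1) := fun k => by
      have : 0 < 1 / ((k : ℝ) + 1) := by positivity
      linarith
    have hne' : ∀ k : ℕ, y * (1 + 1 / ((k : ℝ) + 1)) ≠ 0 := fun k =>
      mul_ne_zero hy (by linarith [hk k])
    have h := (tendsto_cauchyKernel hy hne' hlim).const_mul (cauchyKernel y hy)
    refine isClosed_cauchySpan.mem_of_tendsto h (Eventually.of_forall fun k => ?_)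
    refine cauchyKernel_mul_mem_of_ne hy (hne' k) hy2 ?_ ?_
    · rw [abs_mul, abs_of_pos (by linarith [hk k] : (0 : ℝ) < 1 + 1 / ((k : ℝ) + 1))]
      nlinarith [hk k]
    · intro h
      have h1 : y * (1 / ((k : ℝ) + 1)) = 0 := by linarith
      rcases mul_eq_zero.1 h1 with h2 | h2
      · exact hy h2
      · linarith [hk k]
  · exact cauchyKernel_mul_mem_of_ne hy hw hy2 hw2 hne

theorem mul_mem_cauchySpan {f g : ℝ →ᵇ ℂ} (hf : f ∈ cauchySpan) (hg : g ∈ cauchySpan) :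
    f * g ∈ cauchySpan := by
  have h : ∀ f ∈ Submodule.span ℂ (insert 1 cauchyKernels),
      ∀ g ∈ Submodule.span ℂ (insert 1 cauchyKernels), f * g ∈ cauchySpan := by
    intro f hf g hg
    refine Submodule.span_induction₂ (p := fun f g _ _ => f * g ∈ cauchySpan) ?_ ?_ ?_ ?_ ?_ ?_ ?_
      hf hg
    · rintro f g (rfl | ⟨y, hy, hy2, rfl⟩) hg
      · rw [one_mul]
        exact subset_cauchySpan hg
      · rcases hg with rfl | ⟨w, hw, hw2, rfl⟩
        · rw [mul_one]
          exact subset_cauchySpan (Or.inr ⟨y, hy, hy2, rfl⟩)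
        · exact cauchyKernel_mul_mem hy hw hy2 hw2
    · intro g _
      simp
    · intro f _
      simp
    · intro f₁ f₂ g _ _ _ h1 h2
      rw [add_mul]
      exact add_mem h1 h2
    · intro f g₁ g₂ _ _ _ h1 h2
      rw [mul_add]
      exact add_mem h1 h2
    · intro c f g _ _ h1
      rw [smul_mul_assoc]
      exact Submodule.smul_mem _ _ h1
    · intro c f g _ _ h1
      rw [mul_smul_comm]
      exact Submodule.smul_mem _ _ h1
  have h1 := map_mem_closure₂ (f := fun a b : ℝ →ᵇ ℂ => a * b) continuous_mul hf hg h
  rwa [isClosed_cauchySpan.closure_eq] at h1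

theorem adjoin_cauchyKernels_le {f : ℝ →ᵇ ℂ} (hf : f ∈ StarAlgebra.adjoin ℂ cauchyKernels) :
    f ∈ cauchySpan := by
  have hstar : star cauchyKernels ⊆ cauchyKernels := by
    rintro f ⟨y, hy, hy2, h⟩
    refine ⟨-y, neg_ne_zero.2 hy, by rwa [abs_neg], ?_⟩
    rw [← star_cauchyKernel y hy, ← h, star_star]
  have hf' : f ∈ Algebra.adjoin ℂ (cauchyKernels ∪ star cauchyKernels) := hf
  rw [Set.union_eq_self_of_subset_right hstar] at hf'
  refine Algebra.adjoin_induction (p := fun f _ => f ∈ cauchySpan) ?_ ?_ ?_ ?_ hf'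
  · exact fun f hf => subset_cauchySpan (Or.inr hf)
  · intro c
    rw [Algebra.algebraMap_eq_smul_one]
    exact Submodule.smul_mem _ _ (subset_cauchySpan (Or.inl rfl))
  · exact fun f g _ _ hf hg => add_mem hf hg
  · exact fun f g _ _ hf hg => mul_mem_cauchySpan hf hg

theorem separatesPoints_adjoin_cauchyKernels :
    ((StarAlgebra.adjoin ℂ cauchyKernels).map (toContinuousMapStarₐ ℂ)).SeparatesPoints := by
  intro x x' hx
  refine ⟨cauchyKernel 3 (by norm_num), ?_, ?_⟩
  · simp only [StarSubalgebra.coe_toSubalgebra, StarSubalgebra.coe_map, Set.mem_image,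
      SetLike.mem_coe, exists_exists_and_eq_and]
    exact ⟨_, StarAlgebra.subset_adjoin ℂ _ ⟨3, by norm_num, by norm_num, rfl⟩, rfl⟩
  · rw [cauchyKernel_apply, cauchyKernel_apply]
    intro h
    exact hx (by simpa using h)

/-- Real `y > 2` are reached from rationals decreasing to `y`, which stay above 2, by closedness of
the set of good test functions. Negative `y` follow by complex conjugation. -/
theorem cauchyKernels_subset_convergenceSubmodule {μ : ℕ → ProbabilityMeasure ℝ}
    {ν : ProbabilityMeasure ℝ}
    (h : ∀ q : ℚ, 2 < (q : ℝ) → Tendsto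
      (fun n => ∫ x : ℝ, ((x : ℂ) - (q : ℝ) * Complex.I)⁻¹ ∂(μ n : Measure ℝ)) atTop
      (𝓝 (∫ x : ℝ, ((x : ℂ) - (q : ℝ) * Complex.I)⁻¹ ∂(ν : Measure ℝ)))) :
    cauchyKernels ⊆ (convergenceSubmodule μ ν : Set (ℝ →ᵇ ℂ)) := by
  have hpos : ∀ (y : ℝ) (hy : y ≠ 0), 2 < y → cauchyKernel y hy ∈ convergenceSubmodule μ ν := by
    intro y hy hy2
    obtain ⟨u, -, hu, hlim⟩ := Real.exists_seq_rat_strictAnti_tendsto y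
    have hu2 : ∀ k, (2 : ℝ) < u k := fun k => hy2.trans (hu k)
    have hu0 : ∀ k, (u k : ℝ) ≠ 0 := fun k => by linarith [hu2 k]
    exact (isClosed_convergenceSubmodule μ ν).mem_of_tendsto (tendsto_cauchyKernel hy hu0 hlim)
      (Eventually.of_forall fun k => h (u k) (hu2 k))
  rintro f ⟨y, hy, hy2, rfl⟩
  rcases lt_or_gt_of_ne hy with hneg | hpos'
  · rw [abs_of_neg hneg] at hy2
    have h1 := hpos (-y) (neg_ne_zero.2 hy) hy2
    have h2 : cauchyKernel y hy = star (cauchyKernel (-y) (neg_ne_zero.2 hy)) := by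
      rw [star_cauchyKernel]
      congr 1
      ring
    rw [SetLike.mem_coe, h2, mem_convergenceSubmodule]
    rw [mem_convergenceSubmodule] at h1
    have h3 : ∀ ρ : ProbabilityMeasure ℝ,
        ∫ x, (star (cauchyKernel (-y) (neg_ne_zero.2 hy))) x ∂(ρ : Measure ℝ) =
          (starRingEnd ℂ) (∫ x, cauchyKernel (-y) (neg_ne_zero.2 hy) x ∂(ρ : Measure ℝ)) :=
      fun ρ => integral_conj
    simp only [h3]
    exact (Complex.continuous_conj.tendsto _).comp h1
  · rw [abs_of_pos hpos'] at hy2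
    exact hpos y hy hy2

theorem norm_im_cauchyKernel {y : ℝ} (hy : 0 < y) (x : ℝ) :
    1 - y * (((x : ℂ) - y * Complex.I)⁻¹).im = x ^ 2 / (x ^ 2 + y ^ 2) := by
  have h : x ^ 2 + y ^ 2 ≠ 0 := by positivity
  simp only [Complex.inv_im, Complex.normSq_apply, Complex.sub_im, Complex.ofReal_im,
    Complex.mul_im, Complex.ofReal_re, Complex.I_im, Complex.I_re, Complex.sub_re, Complex.mul_re]
  have h' : (x - (y * 0 - 0 * 1)) * (x - (y * 0 - 0 * 1)) +
      (0 - (y * 1 + 0 * 0)) * (0 - (y * 1 + 0 * 0)) = x ^ 2 + y ^ 2 := by ring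
  rw [h']
  field_simp
  ring

/-- The function x²/(x² + y²) is at least 1/2 where |x| > y, and its integral is 1 - y Im of the
transform at iy. So the transform at a single point controls a tail of the measure, which is what
tightness needs. -/
theorem measure_abs_gt_le_cauchy (ρ : ProbabilityMeasure ℝ) {y : ℝ} (hy : 0 < y) :
    (ρ : Measure ℝ) {x | y < ‖x‖} ≤ ENNReal.ofReal
      (2 * (1 - y * (∫ x : ℝ, ((x : ℂ) - y * Complex.I)⁻¹ ∂(ρ : Measure ℝ)).im)) := by
  have hint : Integrable (fun x : ℝ => ((x : ℂ) - y * Complex.I)⁻¹) (ρ : Measure ℝ) :=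
    (cauchyKernel y hy.ne').integrable _
  have h1 : 1 - y * (∫ x : ℝ, ((x : ℂ) - y * Complex.I)⁻¹ ∂(ρ : Measure ℝ)).im =
      ∫ x : ℝ, x ^ 2 / (x ^ 2 + y ^ 2) ∂(ρ : Measure ℝ) := by
    have h2 : (∫ x : ℝ, ((x : ℂ) - y * Complex.I)⁻¹ ∂(ρ : Measure ℝ)).im =
        ∫ x : ℝ, (((x : ℂ) - y * Complex.I)⁻¹).im ∂(ρ : Measure ℝ) :=
      (integral_im hint).symm
    have h3 : ∫ x : ℝ, (1 - y * (((x : ℂ) - y * Complex.I)⁻¹).im) ∂(ρ : Measure ℝ) =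
        1 - y * ∫ x : ℝ, (((x : ℂ) - y * Complex.I)⁻¹).im ∂(ρ : Measure ℝ) := by
      refine (integral_sub (integrable_const _) (hint.im.const_mul y)).trans ?_
      rw [integral_const_mul]
      simp
    rw [h2, ← h3]
    exact integral_congr_ae (Eventually.of_forall (norm_im_cauchyKernel hy))
  rw [h1, ← integral_const_mul, ofReal_integral_eq_lintegral_ofReal]
  · have hmeas : MeasurableSet {x : ℝ | y < ‖x‖} := measurableSet_lt measurable_const (by fun_prop)
    rw [← lintegral_indicator_one hmeas]
    refine lintegral_mono fun x => ?_
    by_cases hx : y < ‖x‖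
    · rw [Set.indicator_of_mem (by exact hx)]
      simp only [Pi.one_apply]
      rw [← ENNReal.ofReal_one]
      apply ENNReal.ofReal_le_ofReal
      have : y ^ 2 < x ^ 2 := by
        rw [Real.norm_eq_abs] at hx
        exact sq_lt_sq' (by linarith [abs_nonneg x, neg_abs_le x]) hx |>.trans_eq (sq_abs x)
      rw [← mul_div_assoc, le_div_iff₀ (by positivity)]
      linarith
    · rw [Set.indicator_of_notMem (by exact hx)]
      exact zero_le
  · refine Integrable.const_mul (Integrable.of_bound
      (Measurable.aestronglyMeasurable (by fun_prop)) 1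
      (Eventually.of_forall fun x => ?_)) _
    rw [Real.norm_of_nonneg (by positivity)]
    exact div_le_one_of_le₀ (by nlinarith) (by positivity)
  · exact Eventually.of_forall fun x => by positivity

theorem tendsto_one_sub_cauchy (ν : ProbabilityMeasure ℝ) :
    Tendsto (fun k : ℕ => 2 * (1 - (k : ℝ) *
      (∫ x : ℝ, ((x : ℂ) - (k : ℝ) * Complex.I)⁻¹ ∂(ν : Measure ℝ)).im)) atTop (𝓝 0) := by
  have hd : Tendsto (fun k : ℕ => ∫ x : ℝ, (1 - (k : ℝ) * (((x : ℂ) - (k : ℝ) * Complex.I)⁻¹).im)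
      ∂(ν : Measure ℝ)) atTop (𝓝 (∫ _ : ℝ, (0 : ℝ) ∂(ν : Measure ℝ))) := by
    refine tendsto_integral_filter_of_dominated_convergence (fun _ => (1 : ℝ)) ?_ ?_
      (integrable_const _) ?_
    · exact Eventually.of_forall fun k => Measurable.aestronglyMeasurable (by fun_prop)
    · filter_upwards [eventually_gt_atTop 0] with k hk
      have hk' : (0 : ℝ) < k := by exact_mod_cast hk
      refine Eventually.of_forall fun x => ?_
      rw [norm_im_cauchyKernel hk', Real.norm_of_nonneg (by positivity)]
      exact div_le_one_of_le₀ (by nlinarith) (by positivity)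
    · refine Eventually.of_forall fun x => ?_
      have hlim : Tendsto (fun k : ℕ => x ^ 2 / (x ^ 2 + (k : ℝ) ^ 2)) atTop (𝓝 0) := by
        refine Tendsto.div_atTop tendsto_const_nhds (tendsto_atTop_add_const_left _ _ ?_)
        exact (tendsto_pow_atTop two_ne_zero).comp tendsto_natCast_atTop_atTop
      refine hlim.congr' ?_
      filter_upwards [eventually_gt_atTop 0] with k hk
      exact (norm_im_cauchyKernel (by exact_mod_cast hk) x).symm
  have h := hd.const_mul 2
  simp only [integral_zero, mul_zero] at h
  refine h.congr' ?_
  filter_upwards [eventually_gt_atTop 0] with k hk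
  have hk' : (k : ℝ) ≠ 0 := by exact_mod_cast hk.ne'
  have hint : Integrable (fun x : ℝ => ((x : ℂ) - (k : ℝ) * Complex.I)⁻¹) (ν : Measure ℝ) :=
    (cauchyKernel (k : ℝ) hk').integrable _
  have h2 : (∫ x : ℝ, ((x : ℂ) - (k : ℝ) * Complex.I)⁻¹ ∂(ν : Measure ℝ)).im =
      ∫ x : ℝ, (((x : ℂ) - (k : ℝ) * Complex.I)⁻¹).im ∂(ν : Measure ℝ) := (integral_im hint).symm
  rw [h2]
  congr 1
  refine (integral_sub (integrable_const _) (hint.im.const_mul (k : ℝ))).trans ?_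
  rw [integral_const_mul]
  simp

/-- Convergence of the Stieltjes transforms at the points `i q`, where `q > 2` is rational, implies
weak convergence. -/
theorem tendsto_of_tendsto_cauchy {μ : ℕ → ProbabilityMeasure ℝ} {ν : ProbabilityMeasure ℝ}
    (h : ∀ q : ℚ, 2 < (q : ℝ) → Tendsto
      (fun n => ∫ x : ℝ, ((x : ℂ) - (q : ℝ) * Complex.I)⁻¹ ∂(μ n : Measure ℝ)) atTop
      (𝓝 (∫ x : ℝ, ((x : ℂ) - (q : ℝ) * Complex.I)⁻¹ ∂(ν : Measure ℝ)))) :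
    Tendsto μ atTop (𝓝 ν) := by
  have hsub := cauchyKernels_subset_convergenceSubmodule h
  have hone : (1 : ℝ →ᵇ ℂ) ∈ convergenceSubmodule μ ν := by
    rw [mem_convergenceSubmodule]
    simp
  have hle : cauchySpan ≤ convergenceSubmodule μ ν :=
    Submodule.topologicalClosure_minimal _
      (Submodule.span_le.2 (Set.insert_subset hone hsub)) (isClosed_convergenceSubmodule μ ν)
  refine ProbabilityMeasure.tendsto_of_tight_of_separatesPoints ℂ ?_
    separatesPoints_adjoin_cauchyKernels
    (fun g hg => hle (adjoin_cauchyKernels_le hg))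
  refine isTightMeasureSet_range_of_tendsto_limsup_measure_norm_gt ?_
  rw [ENNReal.tendsto_atTop_zero]
  intro ε hε
  by_cases hεt : ε = ⊤
  · exact ⟨0, fun _ _ => hεt ▸ le_top⟩
  have hεr : 0 < ε.toReal := ENNReal.toReal_pos hε.ne' hεt
  -- An integer k ≥ 3 is both an admissible point of the transform and a cut-off beyond which the
  -- tail bound for the limit measure is below ε.
  obtain ⟨k, hk, hk3⟩ := (((tendsto_one_sub_cauchy ν).eventually_lt_const hεr).and
    (eventually_ge_atTop 3)).exists
  have hk3' : (3 : ℝ) ≤ k := by exact_mod_cast hk3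
  refine ⟨k, fun r hr => ?_⟩
  have hlim : Tendsto (fun n => 2 * (1 - (k : ℝ) *
      (∫ x : ℝ, ((x : ℂ) - (k : ℝ) * Complex.I)⁻¹ ∂(μ n : Measure ℝ)).im)) atTop
      (𝓝 (2 * (1 - (k : ℝ) *
      (∫ x : ℝ, ((x : ℂ) - (k : ℝ) * Complex.I)⁻¹ ∂(ν : Measure ℝ)).im))) := by
    have hq := h (k : ℚ) (by push_cast; linarith)
    simp only [Rat.cast_natCast] at hq
    exact (((Complex.continuous_im.tendsto _).comp hq).const_mul (k : ℝ)).const_sub 1 |>.const_mul 2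
  refine limsup_le_of_le (by isBoundedDefault) ?_
  filter_upwards [hlim.eventually_lt_const hk] with n hn
  calc (μ n : Measure ℝ) {x | r < ‖x‖} ≤ (μ n : Measure ℝ) {x | (k : ℝ) < ‖x‖} :=
        measure_mono fun x hx => lt_of_le_of_lt hr hx
    _ ≤ _ := measure_abs_gt_le_cauchy (μ n) (by linarith)
    _ ≤ ENNReal.ofReal ε.toReal := ENNReal.ofReal_le_ofReal hn.le
    _ = ε := ENNReal.ofReal_toReal hεt

end WeakConvergence

/-! ### The Stieltjes transform of the semicircle law -/

section Semicircle

/-- Writing 4 - x² = (y² + 4) - (x² + y²) splits the integrand into (y² + 4)/((x² + y²)√(4 - x²))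
and -1/√(4 - x²). The substitution t = x/√(4 - x²) turns the first into an arctangent, and the
second gives the arcsine. -/
theorem hasDerivAt_semicircle_primitive {y : ℝ} (hy : 0 < y) {x : ℝ} (hx : x ∈ Set.Ioo (-2 : ℝ) 2) :
    HasDerivAt (fun x : ℝ => √(y ^ 2 + 4) / y * Real.arctan (√(y ^ 2 + 4) / y * (x / √(4 - x ^ 2)))
      - Real.arcsin (x / 2)) (√(4 - x ^ 2) / (x ^ 2 + y ^ 2)) x := by
  have h4 : 0 < 4 - x ^ 2 := by nlinarith [hx.1, hx.2]
  have hs : 0 < √(4 - x ^ 2) := Real.sqrt_pos.2 h4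
  have hss : √(4 - x ^ 2) ^ 2 = 4 - x ^ 2 := Real.sq_sqrt h4.le
  have hk : √(y ^ 2 + 4) ^ 2 = y ^ 2 + 4 := Real.sq_sqrt (by positivity)
  have h1 : HasDerivAt (fun x : ℝ => √(4 - x ^ 2)) (-(2 * x) / (2 * √(4 - x ^ 2))) x := by
    have : HasDerivAt (fun x : ℝ => 4 - x ^ 2) (-(2 * x)) x := by
      simpa using (hasDerivAt_pow 2 x).const_sub 4
    exact this.sqrt h4.ne'
  have h2 := ((hasDerivAt_id x).div h1 hs.ne').const_mul (√(y ^ 2 + 4) / y)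
  have h3 := (h2.arctan).const_mul (√(y ^ 2 + 4) / y)
  have h5 : HasDerivAt (fun x : ℝ => Real.arcsin (x / 2)) (1 / √(4 - x ^ 2)) x := by
    have h6 := (Real.hasDerivAt_arcsin (x := x / 2) (by linarith [hx.1]) (by linarith [hx.2])).comp x
      ((hasDerivAt_id x).div_const 2)
    convert! h6 using 1
    have h7 : √(4 - x ^ 2) = 2 * √(1 - (x / 2) ^ 2) := by
      rw [show (4 : ℝ) - x ^ 2 = 2 ^ 2 * (1 - (x / 2) ^ 2) by ring, Real.sqrt_mul (by norm_num),
        Real.sqrt_sq (by norm_num)]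
    rw [h7]
    ring
  refine (h3.sub h5).congr_deriv ?_
  simp only [id, Pi.div_apply]
  have hden : 1 + (√(y ^ 2 + 4) / y * (x / √(4 - x ^ 2))) ^ 2 =
      4 * (x ^ 2 + y ^ 2) / (y ^ 2 * (4 - x ^ 2)) := by
    rw [mul_pow, div_pow, div_pow, hk, hss]
    field_simp
    ring
  have hnum : (1 * √(4 - x ^ 2) - x * (-(2 * x) / (2 * √(4 - x ^ 2)))) / √(4 - x ^ 2) ^ 2 =
      4 / ((4 - x ^ 2) * √(4 - x ^ 2)) := by
    rw [hss]
    field_simp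
    rw [hss]
    ring
  rw [hden, hnum]
  have hxy : x ^ 2 + y ^ 2 ≠ 0 := by positivity
  have hy' : y ≠ 0 := hy.ne'
  have e1 : √(y ^ 2 + 4) / y * (1 / (4 * (x ^ 2 + y ^ 2) / (y ^ 2 * (4 - x ^ 2))) *
      (√(y ^ 2 + 4) / y * (4 / ((4 - x ^ 2) * √(4 - x ^ 2))))) =
      √(y ^ 2 + 4) ^ 2 / ((x ^ 2 + y ^ 2) * √(4 - x ^ 2)) := by
    field_simp
  rw [e1, hk]
  field_simp
  rw [hss]
  ring

theorem tendsto_div_sqrt_right : Tendsto (fun x : ℝ => x / √(4 - x ^ 2)) (𝓝[<] 2) atTop := by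
  have h1 : Tendsto (fun x : ℝ => √(4 - x ^ 2)) (𝓝[<] 2) (𝓝[>] 0) := by
    refine tendsto_nhdsWithin_iff.2 ⟨?_, ?_⟩
    · have : Continuous fun x : ℝ => √(4 - x ^ 2) := by fun_prop
      have h := (this.tendsto 2).mono_left (nhdsWithin_le_nhds (s := Set.Iio 2))
      norm_num at h
      exact h
    · filter_upwards [Ioo_mem_nhdsLT (show (0 : ℝ) < 2 by norm_num)] with x hx
      exact Real.sqrt_pos.2 (by nlinarith [hx.1, hx.2])
  have h2 : Tendsto (fun x : ℝ => x) (𝓝[<] 2) (𝓝 2) := nhdsWithin_le_nhds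
  exact h2.pos_mul_atTop (by norm_num) (tendsto_inv_nhdsGT_zero.comp h1)

theorem tendsto_div_sqrt_left : Tendsto (fun x : ℝ => x / √(4 - x ^ 2)) (𝓝[>] (-2)) atBot := by
  have h1 : Tendsto (fun x : ℝ => -x) (𝓝[>] (-2)) (𝓝[<] 2) := by
    have := tendsto_neg_nhdsGT (a := (-2 : ℝ))
    rwa [neg_neg] at this
  have h2 := tendsto_neg_atTop_atBot.comp (tendsto_div_sqrt_right.comp h1)
  refine h2.congr fun x => ?_
  simp only [Function.comp]
  rw [neg_sq]
  ring

/-- The argument of the arctangent in the primitive tends to ±∞ at ±2, so the fundamental theorem is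
applied with one-sided limits, where the arctangent tends to ±π/2. -/
theorem integral_sqrt_div_sq_add_sq {y : ℝ} (hy : 0 < y) :
    ∫ x in (-2 : ℝ)..2, √(4 - x ^ 2) / (x ^ 2 + y ^ 2) =
      Real.pi * ((√(y ^ 2 + 4) - y) / y) := by
  have hk : 0 < √(y ^ 2 + 4) / y := by positivity
  have hcont : Continuous fun x : ℝ => √(4 - x ^ 2) / (x ^ 2 + y ^ 2) :=
    Continuous.div (by fun_prop) (by fun_prop) (fun x => by positivity)
  have harc : Continuous fun x : ℝ => Real.arcsin (x / 2) := by fun_prop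
  have hb : Tendsto (fun x : ℝ => √(y ^ 2 + 4) / y *
      Real.arctan (√(y ^ 2 + 4) / y * (x / √(4 - x ^ 2))) - Real.arcsin (x / 2)) (𝓝[<] 2)
      (𝓝 (√(y ^ 2 + 4) / y * (Real.pi / 2) - Real.pi / 2)) := by
    have h1 := (tendsto_nhds_of_tendsto_nhdsWithin Real.tendsto_arctan_atTop).comp
      (tendsto_div_sqrt_right.const_mul_atTop hk)
    have h2 := (harc.tendsto 2).mono_left (nhdsWithin_le_nhds (s := Set.Iio 2))
    norm_num at h2
    exact (h1.const_mul _).sub h2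
  have ha : Tendsto (fun x : ℝ => √(y ^ 2 + 4) / y *
      Real.arctan (√(y ^ 2 + 4) / y * (x / √(4 - x ^ 2))) - Real.arcsin (x / 2)) (𝓝[>] (-2))
      (𝓝 (√(y ^ 2 + 4) / y * (-(Real.pi / 2)) - -(Real.pi / 2))) := by
    have h1 := (tendsto_nhds_of_tendsto_nhdsWithin Real.tendsto_arctan_atBot).comp
      (tendsto_div_sqrt_left.const_mul_atBot hk)
    have h2 := (harc.tendsto (-2)).mono_left (nhdsWithin_le_nhds (s := Set.Ioi (-2)))
    norm_num at h2
    exact (h1.const_mul _).sub h2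
  rw [intervalIntegral.integral_eq_sub_of_hasDerivAt_of_tendsto (by norm_num)
    (fun x hx => hasDerivAt_semicircle_primitive hy hx) (hcont.intervalIntegrable _ _) ha hb]
  field_simp
  ring

theorem integral_odd_semicircle (y : ℝ) :
    ∫ x in (-2 : ℝ)..2, √(4 - x ^ 2) * (x / (x ^ 2 + y ^ 2)) = 0 := by
  have h := intervalIntegral.integral_comp_neg (a := -2) (b := 2)
    (fun x : ℝ => √(4 - x ^ 2) * (x / (x ^ 2 + y ^ 2)))
  simp only [neg_sq, neg_neg, neg_div, mul_neg, intervalIntegral.integral_neg] at h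
  linarith

theorem integral_semicircleMeasure (f : ℝ → ℂ) :
    ∫ x, f x ∂semicircleMeasure =
      ∫ x in (-2 : ℝ)..2, ((1 / (2 * Real.pi) * √(4 - x ^ 2) : ℝ) : ℂ) * f x := by
  have hm : Measurable (fun x : ℝ =>
      (Set.Icc (-2 : ℝ) 2).indicator (fun x => 1 / (2 * Real.pi) * √(4 - x ^ 2)) x) :=
    Measurable.indicator (by fun_prop) measurableSet_Icc
  rw [semicircleMeasure, integral_withDensity_eq_integral_toReal_smul (by fun_prop)
    (Eventually.of_forall fun x => ENNReal.ofReal_lt_top),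
    intervalIntegral.integral_of_le (by norm_num), ← integral_Icc_eq_integral_Ioc,
    ← integral_indicator measurableSet_Icc]
  refine integral_congr_ae (Eventually.of_forall fun x => ?_)
  by_cases hx : x ∈ Set.Icc (-2 : ℝ) 2
  · simp only [Set.indicator_of_mem hx]
    rw [ENNReal.toReal_ofReal (by positivity), Complex.real_smul]
  · simp [Set.indicator_of_notMem hx]

theorem inv_ofReal_sub_mul_I (y x : ℝ) :
    ((x : ℂ) - y * Complex.I)⁻¹ =
      ((x / (x ^ 2 + y ^ 2) : ℝ) : ℂ) + ((y / (x ^ 2 + y ^ 2) : ℝ) : ℂ) * Complex.I := by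
  have h2 : x * x + y * y = x ^ 2 + y ^ 2 := by ring
  apply Complex.ext <;> simp [Complex.normSq_apply, -Complex.ofReal_div, h2]

/-- The Stieltjes transform of the semicircle distribution on the imaginary axis. -/
theorem integral_cauchy_semicircleDistribution {y : ℝ} (hy : 0 < y) :
    ∫ x : ℝ, ((x : ℂ) - y * Complex.I)⁻¹ ∂(semicircleDistribution : Measure ℝ) =
      (((√(y ^ 2 + 4) - y) / 2 : ℝ) : ℂ) * Complex.I := by
  have hc1 : Continuous fun x : ℝ => √(4 - x ^ 2) * (x / (x ^ 2 + y ^ 2)) :=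
    Continuous.mul (by fun_prop) (Continuous.div (by fun_prop) (by fun_prop)
      (fun x => by positivity))
  have hc2 : Continuous fun x : ℝ => √(4 - x ^ 2) / (x ^ 2 + y ^ 2) :=
    Continuous.div (by fun_prop) (by fun_prop) (fun x => by positivity)
  change ∫ x : ℝ, ((x : ℂ) - y * Complex.I)⁻¹ ∂semicircleMeasure = _
  rw [integral_semicircleMeasure]
  have h : ∀ x : ℝ, ((1 / (2 * Real.pi) * √(4 - x ^ 2) : ℝ) : ℂ) * ((x : ℂ) - y * Complex.I)⁻¹ =
      ((1 / (2 * Real.pi) : ℝ) : ℂ) * ((√(4 - x ^ 2) * (x / (x ^ 2 + y ^ 2)) : ℝ) : ℂ) +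
      ((y / (2 * Real.pi) : ℝ) : ℂ) * Complex.I * ((√(4 - x ^ 2) / (x ^ 2 + y ^ 2) : ℝ) : ℂ) := by
    intro x
    rw [inv_ofReal_sub_mul_I]
    push_cast
    ring
  simp only [h]
  rw [intervalIntegral.integral_add, intervalIntegral.integral_const_mul,
    intervalIntegral.integral_const_mul, intervalIntegral.integral_ofReal,
    intervalIntegral.integral_ofReal, integral_odd_semicircle, integral_sqrt_div_sq_add_sq hy]
  · have : (y / (2 * Real.pi)) * (Real.pi * ((√(y ^ 2 + 4) - y) / y)) =
        (√(y ^ 2 + 4) - y) / 2 := by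
      have := Real.pi_pos
      field_simp
    rw [← this]
    push_cast
    ring
  · exact (Continuous.intervalIntegrable (by fun_prop) _ _)
  · exact (Continuous.intervalIntegrable (by fun_prop) _ _)

end Semicircle

/-! ### Frobenius norm estimates for the resolvent -/

section Frobenius

open scoped Matrix.Norms.Frobenius
open Matrix

variable {ι κ : Type*}

/-- A real matrix viewed as a complex one. -/
def complexify (X : Matrix ι ι ℝ) : Matrix ι ι ℂ := X.map Complex.ofReal

@[simp]
theorem complexify_apply (X : Matrix ι ι ℝ) (p q : ι) : complexify X p q = (X p q : ℂ) := rfl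

theorem complexify_sub (X Y : Matrix ι ι ℝ) : complexify (X - Y) = complexify X - complexify Y := by
  ext; simp

theorem conjTranspose_complexify {X : Matrix ι ι ℝ} (hX : X.IsSymm) :
    (complexify X)ᴴ = complexify X := by
  ext p q
  simp [hX.apply p q]

theorem transpose_complexify {X : Matrix ι ι ℝ} (hX : X.IsSymm) :
    (complexify X)ᵀ = complexify X := by
  ext p q
  simp [hX.apply p q]

variable [Fintype ι] [Fintype κ]

theorem complexify_mul (X Y : Matrix ι ι ℝ) : complexify (X * Y) = complexify X * complexify Y := by
  ext p q
  simp [Matrix.mul_apply]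

theorem frobenius_norm_sq (A : Matrix ι κ ℂ) : ‖A‖ ^ 2 = ∑ p, ∑ q, ‖A p q‖ ^ 2 := by
  rw [Matrix.frobenius_norm_def, ← Real.sqrt_eq_rpow, Real.sq_sqrt]
  · simp
  · positivity

theorem norm_trace_mul_le (A B : Matrix ι ι ℂ) : ‖(A * B).trace‖ ≤ ‖A‖ * ‖B‖ := by
  have h : (A * B).trace = ∑ x : ι × ι, A x.1 x.2 * B x.2 x.1 := by
    rw [Fintype.sum_prod_type]
    simp [Matrix.trace, Matrix.mul_apply]
  have hA : ‖A‖ ^ 2 = ∑ x : ι × ι, ‖A x.1 x.2‖ ^ 2 := by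
    rw [frobenius_norm_sq, Fintype.sum_prod_type]
  have hB : ‖B‖ ^ 2 = ∑ x : ι × ι, ‖B x.2 x.1‖ ^ 2 := by
    rw [frobenius_norm_sq, Fintype.sum_prod_type, Finset.sum_comm]
  rw [h]
  refine abs_le_of_sq_le_sq' ?_ (by positivity) |>.2
  calc ‖∑ x : ι × ι, A x.1 x.2 * B x.2 x.1‖ ^ 2
      ≤ (∑ x : ι × ι, ‖A x.1 x.2‖ * ‖B x.2 x.1‖) ^ 2 := by
        gcongr
        refine (norm_sum_le _ _).trans_eq ?_
        simp
    _ ≤ (∑ x : ι × ι, ‖A x.1 x.2‖ ^ 2) * ∑ x : ι × ι, ‖B x.2 x.1‖ ^ 2 :=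
        Finset.sum_mul_sq_le_sq_mul_sq _ _ _
    _ = (‖A‖ * ‖B‖) ^ 2 := by rw [mul_pow, hA, hB]

theorem trace_conjTranspose_mul_self (A : Matrix ι ι ℂ) :
    (Aᴴ * A).trace = ((‖A‖ ^ 2 : ℝ) : ℂ) := by
  rw [frobenius_norm_sq, Finset.sum_comm]
  simp only [Matrix.trace, Matrix.diag, Matrix.mul_apply, Matrix.conjTranspose_apply]
  push_cast
  refine Finset.sum_congr rfl fun q _ => Finset.sum_congr rfl fun p _ => ?_
  exact Complex.conj_mul' _

theorem frobenius_norm_one_sq [DecidableEq ι] : ‖(1 : Matrix ι ι ℂ)‖ ^ 2 = Fintype.card ι := by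
  rw [frobenius_norm_sq]
  simp [Matrix.one_apply, apply_ite]

variable [DecidableEq ι]

/-- The matrix `X - i y`. -/
noncomputable def shiftedMatrix (y : ℝ) (X : Matrix ι ι ℝ) : Matrix ι ι ℂ :=
  complexify X - ((y : ℂ) * Complex.I) • 1

/-- The resolvent `(X - i y)⁻¹`. -/
noncomputable def green (y : ℝ) (X : Matrix ι ι ℝ) : Matrix ι ι ℂ := (shiftedMatrix y X)⁻¹

/-- For real symmetric X the cross terms in (X - iy)ᴴ(X - iy) cancel, leaving X² + y². This one
inequality yields both the invertibility of X - iy and the bound 1/y for multiplication by the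
resolvent. -/
theorem sq_mul_norm_sq_le_norm_shiftedMatrix_mul {X : Matrix ι ι ℝ} (hX : X.IsSymm) (y : ℝ)
    (B : Matrix ι ι ℂ) : y ^ 2 * ‖B‖ ^ 2 ≤ ‖shiftedMatrix y X * B‖ ^ 2 := by
  have h1 : (shiftedMatrix y X)ᴴ * shiftedMatrix y X =
      (complexify X)ᴴ * complexify X + ((y ^ 2 : ℝ) : ℂ) • 1 := by
    have : (shiftedMatrix y X)ᴴ = complexify X + ((y : ℂ) * Complex.I) • 1 := by
      rw [shiftedMatrix, conjTranspose_sub, conjTranspose_complexify hX, conjTranspose_smul,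
        conjTranspose_one]
      simp
    rw [this, shiftedMatrix, conjTranspose_complexify hX, add_mul, mul_sub, mul_sub]
    simp only [smul_mul_assoc, mul_smul_comm, one_mul, mul_one, smul_smul]
    have h2 : (y : ℂ) * Complex.I * (y * Complex.I) = -((y ^ 2 : ℝ) : ℂ) := by
      push_cast
      linear_combination (y : ℂ) ^ 2 * Complex.I_sq
    rw [h2, neg_smul, sub_neg_eq_add]
    abel
  have h2 := trace_conjTranspose_mul_self (shiftedMatrix y X * B)
  rw [conjTranspose_mul, Matrix.mul_assoc, ← Matrix.mul_assoc _ _ B, h1, Matrix.add_mul,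
    Matrix.mul_add, Matrix.mul_assoc, ← Matrix.mul_assoc Bᴴ, ← conjTranspose_mul, trace_add,
    trace_conjTranspose_mul_self, smul_mul_assoc, one_mul, mul_smul_comm, trace_smul,
    trace_conjTranspose_mul_self, smul_eq_mul] at h2
  have h3 : ‖complexify X * B‖ ^ 2 + y ^ 2 * ‖B‖ ^ 2 = ‖shiftedMatrix y X * B‖ ^ 2 := by
    exact_mod_cast h2
  rw [← h3]
  linarith [sq_nonneg ‖complexify X * B‖]

theorem isUnit_det_shiftedMatrix {X : Matrix ι ι ℝ} (hX : X.IsSymm) {y : ℝ} (hy : y ≠ 0) :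
    IsUnit (shiftedMatrix y X).det := by
  rw [isUnit_iff_ne_zero]
  intro h
  obtain ⟨v, hv, hv0⟩ := Matrix.exists_mulVec_eq_zero_iff.2 h
  -- A kernel vector is turned into a square matrix all of whose columns equal it, so that the
  -- Frobenius inequality applies.
  have hB : shiftedMatrix y X * Matrix.of (fun p (_ : ι) => v p) = 0 := by
    ext p q
    simpa [Matrix.mul_apply, Matrix.mulVec, dotProduct] using congrFun hv0 p
  have h1 := sq_mul_norm_sq_le_norm_shiftedMatrix_mul hX y (Matrix.of (fun p (_ : ι) => v p))
  rw [hB, norm_zero] at h1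
  have h2 : ‖Matrix.of (fun p (_ : ι) => v p)‖ ^ 2 = 0 := by
    have : 0 < y ^ 2 := by positivity
    nlinarith [sq_nonneg ‖Matrix.of (fun p (_ : ι) => v p)‖]
  have h3 : Matrix.of (fun p (_ : ι) => v p) = 0 := by simpa using h2
  apply hv
  ext p
  exact congrFun (congrFun h3 p) p

theorem shiftedMatrix_mul_green {X : Matrix ι ι ℝ} (hX : X.IsSymm) {y : ℝ} (hy : y ≠ 0) :
    shiftedMatrix y X * green y X = 1 :=
  Matrix.mul_nonsing_inv _ (isUnit_det_shiftedMatrix hX hy)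

theorem green_mul_shiftedMatrix {X : Matrix ι ι ℝ} (hX : X.IsSymm) {y : ℝ} (hy : y ≠ 0) :
    green y X * shiftedMatrix y X = 1 :=
  Matrix.nonsing_inv_mul _ (isUnit_det_shiftedMatrix hX hy)

theorem transpose_green {X : Matrix ι ι ℝ} (hX : X.IsSymm) (y : ℝ) :
    (green y X)ᵀ = green y X := by
  rw [green, Matrix.transpose_nonsing_inv, shiftedMatrix, transpose_sub, transpose_complexify hX,
    transpose_smul, transpose_one]

theorem norm_green_mul_le {X : Matrix ι ι ℝ} (hX : X.IsSymm) {y : ℝ} (hy : 0 < y)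
    (A : Matrix ι ι ℂ) : ‖green y X * A‖ ≤ y⁻¹ * ‖A‖ := by
  have h := sq_mul_norm_sq_le_norm_shiftedMatrix_mul hX y (green y X * A)
  rw [← Matrix.mul_assoc, shiftedMatrix_mul_green hX hy.ne', one_mul, ← mul_pow] at h
  rw [inv_mul_eq_div, le_div_iff₀ hy, mul_comm]
  exact abs_le_of_sq_le_sq' h (norm_nonneg _) |>.2

/-- Transposition moves the resolvent to the left: it is complex symmetric, though not Hermitian. -/
theorem norm_mul_green_le {X : Matrix ι ι ℝ} (hX : X.IsSymm) {y : ℝ} (hy : 0 < y)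
    (A : Matrix ι ι ℂ) : ‖A * green y X‖ ≤ y⁻¹ * ‖A‖ := by
  have h := norm_green_mul_le hX hy Aᵀ
  rwa [← transpose_green hX, ← transpose_mul, frobenius_norm_transpose,
    frobenius_norm_transpose] at h

theorem norm_green_le {X : Matrix ι ι ℝ} (hX : X.IsSymm) {y : ℝ} (hy : 0 < y) :
    ‖green y X‖ ≤ y⁻¹ * √(Fintype.card ι) := by
  have h := norm_green_mul_le hX hy 1
  rwa [mul_one, show ‖(1 : Matrix ι ι ℂ)‖ = √(Fintype.card ι) by
    rw [← frobenius_norm_one_sq, Real.sqrt_sq (norm_nonneg _)]] at h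

theorem green_sub_green {X Y : Matrix ι ι ℝ} (hX : X.IsSymm) (hY : Y.IsSymm) {y : ℝ}
    (hy : y ≠ 0) : green y X - green y Y = -(green y X * complexify (X - Y) * green y Y) := by
  have h : complexify (X - Y) = shiftedMatrix y X - shiftedMatrix y Y := by
    simp [shiftedMatrix, complexify_sub]
  rw [h, mul_sub, sub_mul, green_mul_shiftedMatrix hX hy, one_mul, Matrix.mul_assoc,
    shiftedMatrix_mul_green hY hy, mul_one]
  abel

theorem complexify_mul_green {X : Matrix ι ι ℝ} (hX : X.IsSymm) {y : ℝ} (hy : y ≠ 0) :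
    complexify X * green y X = 1 + ((y : ℂ) * Complex.I) • green y X := by
  have h : complexify X = shiftedMatrix y X + ((y : ℂ) * Complex.I) • 1 := by
    simp [shiftedMatrix]
  rw [h, add_mul, shiftedMatrix_mul_green hX hy, smul_mul_assoc, one_mul]

theorem trace_green_eq_sum {X : Matrix ι ι ℝ} (hX : X.IsHermitian) {y : ℝ} (hy : y ≠ 0) :
    (green y X).trace = ∑ k, ((hX.eigenvalues k : ℂ) - y * Complex.I)⁻¹ := by
  set U : Matrix ι ι ℝ := (hX.eigenvectorUnitary : Matrix ι ι ℝ) with hU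
  have hUU : U * star U = 1 := Unitary.coe_mul_star_self hX.eigenvectorUnitary
  have hUU' : star U * U = 1 := Unitary.coe_star_mul_self hX.eigenvectorUnitary
  have hspec : X = U * diagonal hX.eigenvalues * star U := by
    have h := hX.spectral_theorem
    rw [Unitary.conjStarAlgAut_apply] at h
    exact h
  have hcU : complexify U * complexify (star U) = 1 := by
    rw [← complexify_mul, hUU]
    ext p q
    simp [Matrix.one_apply, apply_ite]
  have hcU' : complexify (star U) * complexify U = 1 := by
    rw [← complexify_mul, hUU']
    ext p q
    simp [Matrix.one_apply, apply_ite]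
  have hdiag : complexify (diagonal hX.eigenvalues) =
      diagonal fun k => (hX.eigenvalues k : ℂ) := by
    ext p q
    by_cases h : p = q
    · subst h
      simp
    · simp [h]
  have hshift : shiftedMatrix y X = complexify U *
      diagonal (fun k => (hX.eigenvalues k : ℂ) - y * Complex.I) * complexify (star U) := by
    have h1 : diagonal (fun k => (hX.eigenvalues k : ℂ) - y * Complex.I) =
        complexify (diagonal hX.eigenvalues) - ((y : ℂ) * Complex.I) • 1 := by
      rw [hdiag]
      ext p q
      by_cases h : p = q
      · subst h
        simp
      · simp [h]
    rw [h1, mul_sub, sub_mul, ← complexify_mul, ← complexify_mul, ← hspec, mul_smul_comm, mul_one,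
      smul_mul_assoc, hcU, shiftedMatrix]
  have hgreen : green y X = complexify U *
      diagonal (fun k => ((hX.eigenvalues k : ℂ) - y * Complex.I)⁻¹) * complexify (star U) := by
    refine Matrix.inv_eq_right_inv ?_
    rw [hshift]
    simp only [Matrix.mul_assoc]
    rw [← Matrix.mul_assoc (complexify (star U)), hcU', Matrix.one_mul,
      ← Matrix.mul_assoc (diagonal _) (diagonal _), diagonal_mul_diagonal]
    simp only [mul_inv_cancel₀ (ofReal_sub_mul_I_ne_zero hy _)]
    rw [diagonal_one, Matrix.one_mul, hcU]
  rw [hgreen, trace_mul_comm, ← Matrix.mul_assoc, hcU', Matrix.one_mul, trace_diagonal]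

theorem integral_empiricalEigenvalueDistribution [Nonempty ι] {X : Matrix ι ι ℝ}
    (hX : X.IsHermitian) {y : ℝ} (hy : y ≠ 0) :
    ∫ x : ℝ, ((x : ℂ) - y * Complex.I)⁻¹ ∂(empiricalEigenvalueDistribution hX : Measure ℝ) =
      (Fintype.card ι : ℂ)⁻¹ * (green y X).trace := by
  rw [trace_green_eq_sum hX hy]
  change ∫ x : ℝ, ((x : ℂ) - y * Complex.I)⁻¹ ∂(empiricalEigenvalueMeasure hX) = _
  rw [empiricalEigenvalueMeasure, integral_smul_measure, integral_finsetSum_measure]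
  · simp
  · intro k _
    exact (cauchyKernel y hy).integrable _

end Frobenius

/-! ### Restriction of matrices to skew-diagonals -/

section SkewPart

open scoped Matrix.Norms.Frobenius
open Matrix

theorem norm_sum_sq_of_unique {ι : Type*} (s : Finset ι) (f : ι → ℂ)
    (h : ∀ i ∈ s, ∀ j ∈ s, f i ≠ 0 → f j ≠ 0 → i = j) : ‖∑ i ∈ s, f i‖ ^ 2 = ∑ i ∈ s, ‖f i‖ ^ 2 := by
  by_cases hs : ∃ i ∈ s, f i ≠ 0
  · obtain ⟨i, hi, hfi⟩ := hs
    have h0 : ∀ j ∈ s, j ≠ i → f j = 0 := fun j hj hji => by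
      by_contra hfj
      exact hji (h j hj i hi hfj hfi)
    rw [Finset.sum_eq_single_of_mem i hi h0, Finset.sum_eq_single_of_mem i hi]
    intro j hj hji
    simp [h0 j hj hji]
  · push Not at hs
    rw [Finset.sum_eq_zero hs, Finset.sum_eq_zero]
    · simp
    · intro i hi
      simp [hs i hi]

variable {n : ℕ} {R : Type*}

/-- The part of a matrix on the skew-diagonal `p + q = r`, with rows and columns numbered from
`0`. -/
def skewPart [Zero R] (r : ℕ) (A : Matrix (Fin n) (Fin n) R) : Matrix (Fin n) (Fin n) R :=
  Matrix.of fun p q => if (p : ℕ) + q = r then A p q else 0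

theorem skewPart_apply [Zero R] (r : ℕ) (A : Matrix (Fin n) (Fin n) R) (p q : Fin n) :
    skewPart r A p q = if (p : ℕ) + q = r then A p q else 0 := rfl

theorem transpose_skewPart [Zero R] (r : ℕ) (A : Matrix (Fin n) (Fin n) R) :
    (skewPart r A)ᵀ = skewPart r Aᵀ := by
  ext p q
  simp [skewPart_apply, add_comm]

theorem isSymm_skewPart [Zero R] (r : ℕ) {A : Matrix (Fin n) (Fin n) R} (hA : A.IsSymm) :
    (skewPart r A).IsSymm := by
  rw [Matrix.IsSymm, transpose_skewPart, hA.eq]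

theorem complexify_skewPart (r : ℕ) (X : Matrix (Fin n) (Fin n) ℝ) :
    complexify (skewPart r X) = skewPart r (complexify X) := by
  ext p q
  by_cases h : (p : ℕ) + q = r <;> simp [skewPart_apply, h]

theorem skewPart_sub (r : ℕ) (A B : Matrix (Fin n) (Fin n) ℂ) :
    skewPart r (A - B) = skewPart r A - skewPart r B := by
  ext p q
  by_cases h : (p : ℕ) + q = r <;> simp [skewPart_apply, h]

theorem sum_ite_add_eq [AddCommMonoid R] (p q : Fin n) (x : R) :
    ∑ r ∈ Finset.range (2 * n), (if (p : ℕ) + q = r then x else 0) = x := by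
  rw [Finset.sum_ite_eq, if_pos]
  rw [Finset.mem_range]
  omega

theorem sum_skewPart [AddCommMonoid R] (A : Matrix (Fin n) (Fin n) R) :
    ∑ r ∈ Finset.range (2 * n), skewPart r A = A := by
  ext p q
  rw [Matrix.sum_apply]
  exact sum_ite_add_eq p q (A p q)

theorem sum_norm_skewPart_sq (A : Matrix (Fin n) (Fin n) ℂ) :
    ∑ r ∈ Finset.range (2 * n), ‖skewPart r A‖ ^ 2 = ‖A‖ ^ 2 := by
  simp only [frobenius_norm_sq]
  rw [Finset.sum_comm]
  refine Finset.sum_congr rfl fun p _ => ?_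
  rw [Finset.sum_comm]
  refine Finset.sum_congr rfl fun q _ => ?_
  rw [← sum_ite_add_eq p q (‖A p q‖ ^ 2)]
  refine Finset.sum_congr rfl fun r _ => ?_
  by_cases h : (p : ℕ) + q = r <;> simp [skewPart_apply, h]

theorem norm_skewPart_le (r : ℕ) (A : Matrix (Fin n) (Fin n) ℂ) : ‖skewPart r A‖ ≤ ‖A‖ := by
  refine abs_le_of_sq_le_sq' ?_ (norm_nonneg _) |>.2
  rw [frobenius_norm_sq, frobenius_norm_sq]
  gcongr with p _ q _
  rw [skewPart_apply]
  split_ifs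
  · exact le_rfl
  · simp

/-- A row of a skew part has at most one nonzero entry, so each entry of the product is a single
term and its squared modulus has no cross terms. -/
theorem norm_skewPart_mul_sq (r : ℕ) (D A : Matrix (Fin n) (Fin n) ℂ) :
    ‖skewPart r D * A‖ ^ 2 = ∑ q, (∑ p, ‖skewPart r D p q‖ ^ 2) * ∑ j, ‖A q j‖ ^ 2 := by
  rw [frobenius_norm_sq]
  have h : ∀ p j, ‖(skewPart r D * A) p j‖ ^ 2 = ∑ q, ‖skewPart r D p q‖ ^ 2 * ‖A q j‖ ^ 2 := by
    intro p j
    rw [Matrix.mul_apply, norm_sum_sq_of_unique]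
    · simp [mul_pow]
    · intro q _ q' _ hq hq'
      have h1 : (p : ℕ) + q = r := by
        by_contra hne
        simp [skewPart_apply, hne] at hq
      have h2 : (p : ℕ) + q' = r := by
        by_contra hne
        simp [skewPart_apply, hne] at hq'
      ext
      omega
  simp only [h, Finset.sum_mul_sum]
  rw [Finset.sum_comm' (t' := Finset.univ) (s' := fun _ => Finset.univ) (by simp)]
  rw [Finset.sum_congr rfl fun j _ => Finset.sum_comm, Finset.sum_comm]
  exact Finset.sum_congr rfl fun q _ => Finset.sum_comm

/-- A column of a skew part also has at most one nonzero entry, so multiplication by it costs only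
the largest entry. For the random matrix this is of order n^(-1/2), whereas the Frobenius norm of a
skew part is of order one. -/
theorem norm_skewPart_mul_le (r : ℕ) {D : Matrix (Fin n) (Fin n) ℂ} {k : ℝ} (hk : 0 ≤ k)
    (hD : ∀ p q, ‖D p q‖ ≤ k) (A : Matrix (Fin n) (Fin n) ℂ) :
    ‖skewPart r D * A‖ ≤ k * ‖A‖ := by
  refine abs_le_of_sq_le_sq' ?_ (by positivity) |>.2
  rw [norm_skewPart_mul_sq, mul_pow, frobenius_norm_sq A, Finset.mul_sum]
  gcongr with q _
  by_cases hq : ∃ p : Fin n, (p : ℕ) + q = r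
  · obtain ⟨p, hp⟩ := hq
    rw [Finset.sum_eq_single_of_mem p (Finset.mem_univ _)]
    · rw [skewPart_apply, if_pos hp]
      gcongr
      exact hD p q
    · intro p' _ hne
      rw [skewPart_apply, if_neg]
      · simp
      · intro h
        apply hne
        ext
        omega
  · push Not at hq
    rw [Finset.sum_eq_zero]
    · positivity
    · intro p _
      simp [skewPart_apply, hq p]

theorem norm_mul_skewPart_le (r : ℕ) {D : Matrix (Fin n) (Fin n) ℂ} {k : ℝ} (hk : 0 ≤ k)
    (hD : ∀ p q, ‖D p q‖ ≤ k) (A : Matrix (Fin n) (Fin n) ℂ) :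
    ‖A * skewPart r D‖ ≤ k * ‖A‖ := by
  have h := norm_skewPart_mul_le r hk (D := Dᵀ) (fun p q => hD q p) Aᵀ
  rwa [← transpose_skewPart, ← transpose_mul, frobenius_norm_transpose,
    frobenius_norm_transpose] at h

/-- Summed over all skew-diagonals, the cost is governed by the squared column norms. They remain of
order one in situations where a uniform bound on single entries would lose a power of n. -/
theorem sum_norm_skewPart_mul_sq_le {D : Matrix (Fin n) (Fin n) ℂ} {k : ℝ}
    (hD : ∀ q, ∑ p, ‖D p q‖ ^ 2 ≤ k) (A : Matrix (Fin n) (Fin n) ℂ) :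
    ∑ r ∈ Finset.range (2 * n), ‖skewPart r D * A‖ ^ 2 ≤ k * ‖A‖ ^ 2 := by
  simp only [norm_skewPart_mul_sq]
  rw [Finset.sum_comm, frobenius_norm_sq A, Finset.mul_sum]
  gcongr with q _
  rw [← Finset.sum_mul, Finset.sum_comm]
  gcongr
  refine le_trans (Finset.sum_le_sum fun p _ => ?_) (hD q)
  rw [← sum_ite_add_eq p q (‖D p q‖ ^ 2)]
  refine Finset.sum_le_sum fun r _ => ?_
  by_cases h : (p : ℕ) + q = r <;> simp [skewPart_apply, h]

theorem sum_norm_mul_skewPart_sq_le {D : Matrix (Fin n) (Fin n) ℂ} {k : ℝ}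
    (hD : ∀ p, ∑ q, ‖D p q‖ ^ 2 ≤ k) (A : Matrix (Fin n) (Fin n) ℂ) :
    ∑ r ∈ Finset.range (2 * n), ‖A * skewPart r D‖ ^ 2 ≤ k * ‖A‖ ^ 2 := by
  have h := sum_norm_skewPart_mul_sq_le (D := Dᵀ) (fun q => hD q) Aᵀ
  rw [frobenius_norm_transpose] at h
  refine le_trans (Finset.sum_le_sum fun r _ => ?_) h
  rw [← transpose_skewPart, ← transpose_mul, frobenius_norm_transpose]

theorem trace_mul_skewPart (r : ℕ) (W D : Matrix (Fin n) (Fin n) ℂ) :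
    (W * skewPart r D).trace = (skewPart r W * skewPart r D).trace := by
  simp only [Matrix.trace, Matrix.diag, Matrix.mul_apply]
  refine Finset.sum_congr rfl fun p _ => Finset.sum_congr rfl fun q _ => ?_
  by_cases h : (p : ℕ) + q = r
  · simp [skewPart_apply, h]
  · have h' : ¬ (q : ℕ) + p = r := by omega
    simp [skewPart_apply, h']

/-- The trace sees only the entries of `W` on the same skew-diagonal. Keeping `skewPart r W` instead
of `W` matters when summing over `r`, because the squared norms of the skew parts add up to `‖W‖ ^
2`. -/
theorem norm_trace_mul_skewPart_le (r : ℕ) (W D : Matrix (Fin n) (Fin n) ℂ) :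
    ‖(W * skewPart r D).trace‖ ≤ ‖skewPart r W‖ * ‖skewPart r D‖ := by
  rw [trace_mul_skewPart]
  exact norm_trace_mul_le _ _

end SkewPart

/-! ### The Efron–Stein inequality, for second and fourth moments -/

section EfronStein

theorem integrable_of_abs_le {Ω : Type*} [MeasurableSpace Ω] {P : Measure Ω} [IsFiniteMeasure P]
    {f : Ω → ℝ} {B : ℝ} (hf : Measurable f) (hB : ∀ x, |f x| ≤ B) : Integrable f P :=
  Integrable.of_bound hf.aestronglyMeasurable B (Eventually.of_forall hB)

theorem integrable_sq_of_abs_le {Ω : Type*} [MeasurableSpace Ω] {P : Measure Ω} [IsFiniteMeasure P]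
    {f : Ω → ℝ} {B : ℝ} (hf : Measurable f) (hB : ∀ x, |f x| ≤ B) :
    Integrable (fun x => f x ^ 2) P :=
  integrable_of_abs_le (B := B ^ 2) (hf.pow_const 2) fun x => by
    rw [abs_pow]
    exact pow_le_pow_left₀ (abs_nonneg _) (hB x) 2

theorem integral_sub_const_sq {Ω : Type*} [MeasurableSpace Ω] {P : Measure Ω}
    [IsProbabilityMeasure P] {f : Ω → ℝ} (hf : Integrable f P)
    (hf2 : Integrable (fun x => f x ^ 2) P) (c : ℝ) :
    ∫ x, (f x - c) ^ 2 ∂P = ∫ x, f x ^ 2 ∂P - 2 * c * ∫ x, f x ∂P + c ^ 2 := by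
  have h : ∀ x, (f x - c) ^ 2 = f x ^ 2 - 2 * c * f x + c ^ 2 := fun x => by ring
  simp only [h]
  have h1 : Integrable (fun x => 2 * c * f x) P := hf.const_mul _
  have h2 : Integrable (fun x => f x ^ 2 - 2 * c * f x) P := hf2.sub h1
  rw [integral_add h2 (integrable_const _), integral_sub hf2 h1, integral_const_mul]
  simp

theorem sq_integral_le_integral_sq {Ω : Type*} [MeasurableSpace Ω] {P : Measure Ω}
    [IsProbabilityMeasure P] {f : Ω → ℝ} (hf : Integrable f P)
    (hf2 : Integrable (fun x => f x ^ 2) P) : (∫ x, f x ∂P) ^ 2 ≤ ∫ x, f x ^ 2 ∂P := by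
  have h := integral_sub_const_sq hf hf2 (∫ x, f x ∂P)
  have h0 : 0 ≤ ∫ x, (f x - ∫ x, f x ∂P) ^ 2 ∂P := integral_nonneg fun x => sq_nonneg _
  nlinarith

theorem integral_sub_mean_sq_le {Ω : Type*} [MeasurableSpace Ω] {P : Measure Ω}
    [IsProbabilityMeasure P] {f : Ω → ℝ} (hf : Integrable f P)
    (hf2 : Integrable (fun x => f x ^ 2) P) (c : ℝ) :
    ∫ x, f x ^ 2 ∂P - (∫ x, f x ∂P) ^ 2 ≤ ∫ x, (f x - c) ^ 2 ∂P := by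
  rw [integral_sub_const_sq hf hf2]
  nlinarith [sq_nonneg (∫ x, f x ∂P - c)]

section Product

variable {E Y : Type*} [MeasurableSpace E] [MeasurableSpace Y] (μ : Measure E) (ν : Measure Y)
  [IsProbabilityMeasure μ] [IsProbabilityMeasure ν]

theorem abs_integral_le_of_abs_le {f : E → ℝ} {B : ℝ} (hB : ∀ x, |f x| ≤ B) :
    |∫ x, f x ∂μ| ≤ B := by
  have := norm_integral_le_of_norm_le_const (μ := μ) (f := f) (C := B) (Eventually.of_forall hB)
  simpa using this

theorem measurable_integral_left {g : E × Y → ℝ} (hg : Measurable g) :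
    Measurable fun y => ∫ x, g (x, y) ∂μ :=
  (StronglyMeasurable.integral_prod_right (f := fun y x => g (x, y))
    (hg.comp measurable_swap).stronglyMeasurable).measurable

/-- The law of total variance. For fixed `y` the inner mean is the best constant approximation in
mean square, so replacing it by `k y` only increases the first term. -/
theorem variance_prod_le {g : E × Y → ℝ} {k : Y → ℝ} {B : ℝ} (hg : Measurable g)
    (hgB : ∀ x, |g x| ≤ B) (hk : Measurable k) (hkB : ∀ y, |k y| ≤ B) :
    ∫ x, g x ^ 2 ∂(μ.prod ν) - (∫ x, g x ∂(μ.prod ν)) ^ 2 ≤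
      ∫ x, (g x - k x.2) ^ 2 ∂(μ.prod ν) +
      (∫ y, (∫ x, g (x, y) ∂μ) ^ 2 ∂ν - (∫ y, ∫ x, g (x, y) ∂μ ∂ν) ^ 2) := by
  have hgi : Integrable g (μ.prod ν) := integrable_of_abs_le hg hgB
  have hg2 : Integrable (fun x => g x ^ 2) (μ.prod ν) := integrable_sq_of_abs_le hg hgB
  have hgk : Integrable (fun x => (g x - k x.2) ^ 2) (μ.prod ν) := by
    refine integrable_sq_of_abs_le (B := B + B) (hg.sub (hk.comp measurable_snd)) fun x => ?_
    exact (abs_sub _ _).trans (add_le_add (hgB _) (hkB _))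
  have hm := measurable_integral_left μ hg
  have hF2 : Integrable (fun y => (∫ x, g (x, y) ∂μ) ^ 2) ν :=
    integrable_sq_of_abs_le hm fun y => abs_integral_le_of_abs_le μ fun x => hgB _
  rw [integral_prod_symm _ hgi, integral_prod_symm _ hg2, integral_prod_symm _ hgk]
  have h : ∫ y, (∫ x, g (x, y) ^ 2 ∂μ - (∫ x, g (x, y) ∂μ) ^ 2) ∂ν ≤
      ∫ y, ∫ x, (g (x, y) - k y) ^ 2 ∂μ ∂ν := by
    refine integral_mono (hg2.integral_prod_right.sub hF2) hgk.integral_prod_right fun y => ?_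
    exact integral_sub_mean_sq_le
      (integrable_of_abs_le (hg.comp (measurable_id.prodMk measurable_const)) fun x => hgB _)
      (integrable_sq_of_abs_le (hg.comp (measurable_id.prodMk measurable_const)) fun x => hgB _) _
  rw [integral_sub hg2.integral_prod_right hF2] at h
  linarith

/-- Averaging over one coordinate contracts mean square distances; this carries the comparison
functions through the induction below. -/
theorem integral_sq_integral_sub_le {g h : E × Y → ℝ} {B : ℝ} (hg : Measurable g)
    (hgB : ∀ x, |g x| ≤ B) (hh : Measurable h) (hhB : ∀ x, |h x| ≤ B) :
    ∫ y, (∫ x, g (x, y) ∂μ - ∫ x, h (x, y) ∂μ) ^ 2 ∂ν ≤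
      ∫ x, (g x - h x) ^ 2 ∂(μ.prod ν) := by
  have hb : ∀ x, |g x - h x| ≤ B + B := fun x =>
    (abs_sub _ _).trans (add_le_add (hgB _) (hhB _))
  have hgh : Integrable (fun x => (g x - h x) ^ 2) (μ.prod ν) :=
    integrable_sq_of_abs_le (hg.sub hh) hb
  rw [integral_prod_symm _ hgh]
  refine integral_mono ?_ hgh.integral_prod_right fun y => ?_
  · refine integrable_sq_of_abs_le (B := B + B)
      ((measurable_integral_left μ hg).sub (measurable_integral_left μ hh)) fun y => ?_
    exact (abs_sub _ _).trans (add_le_add (abs_integral_le_of_abs_le μ fun x => hgB _)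
      (abs_integral_le_of_abs_le μ fun x => hhB _))
  · have hpair : Measurable fun x : E => (x, y) := measurable_id.prodMk measurable_const
    have hgi : Integrable (fun x => g (x, y)) μ :=
      integrable_of_abs_le (hg.comp hpair) fun x => hgB _
    have hhi : Integrable (fun x => h (x, y)) μ :=
      integrable_of_abs_le (hh.comp hpair) fun x => hhB _
    simp only
    rw [← integral_sub hgi hhi]
    exact sq_integral_le_integral_sq (hgi.sub hhi)
      (integrable_sq_of_abs_le ((hg.comp hpair).sub (hh.comp hpair)) fun x => hb _)

end Product

theorem piFinSuccAbove_zero_symm_apply {E : Type*} [MeasurableSpace E] {N : ℕ}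
    (x : E × (Fin N → E)) :
    (MeasurableEquiv.piFinSuccAbove (fun _ : Fin (N + 1) => E) 0).symm x = Fin.cons x.1 x.2 := by
  simp [MeasurableEquiv.piFinSuccAbove]
  rfl

theorem integral_pi_succ {E : Type*} [MeasurableSpace E] {N : ℕ} (μ : Fin (N + 1) → Measure E)
    [∀ i, IsProbabilityMeasure (μ i)] (f : (Fin (N + 1) → E) → ℝ) :
    ∫ x, f x ∂(Measure.pi μ) =
      ∫ x : E × (Fin N → E), f (Fin.cons x.1 x.2) ∂((μ 0).prod (Measure.pi fun i => μ i.succ)) := by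
  have h := (measurePreserving_piFinSuccAbove μ 0).symm
  have h2 := h.integral_comp' (f := (MeasurableEquiv.piFinSuccAbove (fun _ => E) 0).symm) f
  rw [← h2]
  simp only [piFinSuccAbove_zero_symm_apply]
  rfl

/-- The Efron–Stein inequality: the variance of a function of independent variables is controlled by
its distances to functions that do not depend on one of the variables. -/
theorem variance_pi_le {E : Type*} [MeasurableSpace E] : ∀ {N : ℕ} (μ : Fin N → Measure E)
    [∀ i, IsProbabilityMeasure (μ i)] {f : (Fin N → E) → ℝ} {h : Fin N → (Fin N → E) → ℝ} {B : ℝ}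
    (_ : Measurable f) (_ : ∀ x, |f x| ≤ B) (_ : ∀ i, Measurable (h i))
    (_ : ∀ i x, |h i x| ≤ B) (_ : ∀ i x e, h i (Function.update x i e) = h i x),
    ∫ x, f x ^ 2 ∂(Measure.pi μ) - (∫ x, f x ∂(Measure.pi μ)) ^ 2 ≤
      ∑ i, ∫ x, (f x - h i x) ^ 2 ∂(Measure.pi μ)
  | 0, μ, _, f, h, B, hf, hfB, hh, hhB, hup => by
    obtain ⟨c, hc⟩ : ∃ c, f = fun _ => c :=
      ⟨f default, funext fun x => congrArg f (Subsingleton.elim _ _)⟩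
    simp [hc]
  | N + 1, μ, _, f, h, B, hf, hfB, hh, hhB, hup => by
    have hcons : Measurable fun x : E × (Fin N → E) => (Fin.cons x.1 x.2 : Fin (N + 1) → E) := by
      simp only [← piFinSuccAbove_zero_symm_apply]
      exact MeasurableEquiv.measurable _
    have hne : Nonempty E := (μ 0).nonempty_of_neZero
    obtain ⟨e₀⟩ := hne
    rw [Fin.sum_univ_succ]
    simp only [integral_pi_succ μ]
    -- `h 0` ignores coordinate 0, so it is a function of the tail alone; the point `e₀` fills the
    -- empty slot.
    have hk : ∀ x : E × (Fin N → E), h 0 (Fin.cons x.1 x.2) = h 0 (Fin.cons e₀ x.2) := by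
      intro x
      rw [← hup 0 (Fin.cons e₀ x.2) x.1, Fin.update_cons_zero]
    have hpair : Measurable fun y : Fin N → E => (e₀, y) := measurable_const.prodMk measurable_id
    have step := variance_prod_le (μ 0) (Measure.pi fun i => μ i.succ)
      (g := fun x => f (Fin.cons x.1 x.2)) (k := fun y => h 0 (Fin.cons e₀ y)) (B := B)
      (hf.comp hcons) (fun x => hfB _) ((hh 0).comp (hcons.comp hpair)) (fun y => hhB _ _)
    -- The variance left over is that of the average over coordinate 0. The averages of the other
    -- comparison functions still ignore their own coordinate, so the induction hypothesis applies.
    have ih := variance_pi_le (fun i => μ i.succ)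
      (f := fun y => ∫ x, f (Fin.cons x y) ∂(μ 0))
      (h := fun i y => ∫ x, h i.succ (Fin.cons x y) ∂(μ 0)) (B := B)
      (measurable_integral_left (μ 0) (hf.comp hcons))
      (fun y => abs_integral_le_of_abs_le _ fun x => hfB _)
      (fun i => measurable_integral_left (μ 0) ((hh i.succ).comp hcons))
      (fun i y => abs_integral_le_of_abs_le _ fun x => hhB _ _)
      (fun i y e => by simp only [Fin.cons_update, hup])
    simp only [hk]
    refine step.trans (add_le_add le_rfl (ih.trans (Finset.sum_le_sum fun i _ => ?_)))
    exact integral_sq_integral_sub_le (μ 0) _ (hf.comp hcons) (fun x => hfB _)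
      ((hh i.succ).comp hcons) (fun x => hhB _ _)

variable {Ω E : Type*} [MeasurableSpace Ω] [MeasurableSpace E] {P : Measure Ω}
  [IsProbabilityMeasure P] {N : ℕ} {Y : Fin N → Ω → E}

theorem variance_comp_le (hY : ∀ i, Measurable (Y i)) (hind : iIndepFun Y P)
    {f : (Fin N → E) → ℝ} {h : Fin N → (Fin N → E) → ℝ} {B : ℝ}
    (hf : Measurable f) (hfB : ∀ x, |f x| ≤ B) (hh : ∀ i, Measurable (h i))
    (hhB : ∀ i x, |h i x| ≤ B) (hup : ∀ i x e, h i (Function.update x i e) = h i x) :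
    ∫ ω, f (fun i => Y i ω) ^ 2 ∂P - (∫ ω, f (fun i => Y i ω) ∂P) ^ 2 ≤
      ∑ i, ∫ ω, (f (fun i => Y i ω) - h i (fun i => Y i ω)) ^ 2 ∂P := by
  have hYm : Measurable fun ω i => Y i ω := measurable_pi_lambda _ hY
  have hp : ∀ i, IsProbabilityMeasure (P.map (Y i)) := fun i =>
    Measure.isProbabilityMeasure_map (hY i).aemeasurable
  have hmap := hind.map_fun_eq_pi_map fun i => (hY i).aemeasurable
  have key := variance_pi_le (fun i => P.map (Y i)) hf hfB hh hhB hup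
  rw [← hmap] at key
  have hint : ∀ g : (Fin N → E) → ℝ, Measurable g →
      ∫ x, g x ∂(P.map fun ω i => Y i ω) = ∫ ω, g (fun i => Y i ω) ∂P := fun g hg =>
    integral_map hYm.aemeasurable hg.aestronglyMeasurable
  rw [hint _ (hf.pow_const 2), hint _ hf] at key
  refine key.trans_eq (Finset.sum_congr rfl fun i _ => hint _ ((hf.sub (hh i)).pow_const 2))

/-- A fourth moment version of the Efron–Stein inequality. -/
theorem fourth_moment_comp_le (hY : ∀ i, Measurable (Y i)) (hind : iIndepFun Y P)
    {f : (Fin N → E) → ℝ} {h : Fin N → (Fin N → E) → ℝ} {B : ℝ}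
    (hf : Measurable f) (hfB : ∀ x, |f x| ≤ B) (hh : ∀ i, Measurable (h i))
    (hhB : ∀ i x, |h i x| ≤ B) (hup : ∀ i x e, h i (Function.update x i e) = h i x) :
    ∫ ω, (f (fun i => Y i ω) - ∫ ω, f (fun i => Y i ω) ∂P) ^ 4 ∂P ≤
      70 * ∫ ω, (∑ i, (f (fun i => Y i ω) - h i (fun i => Y i ω)) ^ 2) ^ 2 ∂P := by
  have hYm : Measurable fun ω i => Y i ω := measurable_pi_lambda _ hY
  set c : ℝ := ∫ ω, f (fun i => Y i ω) ∂P with hc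
  set g : Ω → ℝ := fun ω => f (fun i => Y i ω) - c with hg
  set d : Fin N → Ω → ℝ := fun i ω => (f (fun i => Y i ω) - h i (fun i => Y i ω)) ^ 2 with hd
  set V : Ω → ℝ := fun ω => ∑ i, d i ω with hV
  have hcB : |c| ≤ B := abs_integral_le_of_abs_le P fun ω => hfB _
  have hfc : ∀ x, |f x - c| ≤ B + B := fun x => (abs_sub _ _).trans (add_le_add (hfB _) hcB)
  have hhc : ∀ i x, |h i x - c| ≤ B + B := fun i x =>
    (abs_sub _ _).trans (add_le_add (hhB _ _) hcB)
  have hd0 : ∀ i ω, 0 ≤ d i ω := fun i ω => sq_nonneg _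
  have hV0 : ∀ ω, 0 ≤ V ω := fun ω => Finset.sum_nonneg fun i _ => hd0 i ω
  have hdm : ∀ i, Measurable (d i) := fun i => ((hf.sub (hh i)).comp hYm).pow_const 2
  have hVm : Measurable V := Finset.measurable_fun_sum _ fun i _ => hdm i
  have hgm : Measurable g := (hf.comp hYm).sub_const c
  have hdB : ∀ i ω, d i ω ≤ (B + B) ^ 2 := fun i ω => by
    rw [hd]
    simp only
    rw [← sq_abs]
    exact pow_le_pow_left₀ (abs_nonneg _)
      ((abs_sub _ _).trans (add_le_add (hfB _) (hhB _ _))) 2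
  have hVB : ∀ ω, |V ω| ≤ N * (B + B) ^ 2 := fun ω => by
    rw [abs_of_nonneg (hV0 ω)]
    refine (Finset.sum_le_sum fun i _ => hdB i ω).trans_eq ?_
    simp
  have hgB : ∀ ω, |g ω| ≤ B + B := fun ω => hfc _
  have hg2 : Integrable (fun ω => g ω ^ 2) P := integrable_sq_of_abs_le hgm hgB
  have hg4 : Integrable (fun ω => g ω ^ 4) P :=
    integrable_of_abs_le (B := (B + B) ^ 4) (hgm.pow_const 4) fun ω => by
      rw [abs_pow]
      exact pow_le_pow_left₀ (abs_nonneg _) (hgB ω) 4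
  have hVi : Integrable V P := integrable_of_abs_le hVm hVB
  have hV2 : Integrable (fun ω => V ω ^ 2) P := integrable_sq_of_abs_le hVm hVB
  have hsq : ∀ u : ℝ, |u| ≤ B + B → |u ^ 2| ≤ (B + B) ^ 2 := fun u hu => by
    rw [abs_pow]
    exact pow_le_pow_left₀ (abs_nonneg _) hu 2
  -- Efron–Stein is applied to the square of the centred function, with squared comparison
  -- functions. It bounds the fourth moment up to the squared variance, and the latter is handled by
  -- Efron–Stein for `f` itself.
  have h1 := variance_comp_le hY hind (f := fun x => (f x - c) ^ 2)
    (h := fun i x => (h i x - c) ^ 2) (B := (B + B) ^ 2) ((hf.sub_const c).pow_const 2)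
    (fun x => hsq _ (hfc x)) (fun i => ((hh i).sub_const c).pow_const 2)
    (fun i x => hsq _ (hhc i x)) (fun i x e => by simp only [hup])
  have h2 := variance_comp_le hY hind hf hfB hh hhB hup
  have h3 : ∫ ω, g ω ^ 2 ∂P ≤ ∫ ω, V ω ∂P := by
    have h4 : ∫ ω, g ω ^ 2 ∂P = ∫ ω, f (fun i => Y i ω) ^ 2 ∂P - c ^ 2 := by
      have h := integral_sub_const_sq (P := P) (f := fun ω => f (fun i => Y i ω))
        (integrable_of_abs_le (hf.comp hYm) fun ω => hfB _)
        (integrable_sq_of_abs_le (hf.comp hYm) fun ω => hfB _) c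
      rw [← hc] at h
      refine h.trans ?_
      ring
    rw [h4, hV, integral_finsetSum]
    · exact h2
    · exact fun i _ => integrable_of_abs_le (B := (B + B) ^ 2) (hdm i) fun ω => by
        rw [abs_of_nonneg (hd0 i ω)]
        exact hdB i ω
  -- The bound 8g²V + 2V² is weakened by 8g²V ≤ g⁴/2 + 32V², so that half of the fourth moment can
  -- be absorbed on the left. With (E g²)² ≤ E V² this leaves 35 E V² for one half of the fourth
  -- moment, hence the constant 70.
  have h5 : ∑ i, ∫ ω, ((f (fun i => Y i ω) - c) ^ 2 - (h i (fun i => Y i ω) - c) ^ 2) ^ 2 ∂P ≤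
      ∫ ω, (g ω ^ 4 / 2 + 34 * V ω ^ 2) ∂P := by
    rw [← integral_finsetSum]
    · refine integral_mono_of_nonneg (Eventually.of_forall fun ω => Finset.sum_nonneg fun i _ =>
        sq_nonneg _) ((hg4.div_const 2).add (hV2.const_mul 34)) (Eventually.of_forall fun ω => ?_)
      have h6 : ∀ i, ((f (fun i => Y i ω) - c) ^ 2 - (h i (fun i => Y i ω) - c) ^ 2) ^ 2 ≤
          8 * g ω ^ 2 * d i ω + 2 * V ω * d i ω := by
        intro i
        have h7 : d i ω ≤ V ω := Finset.single_le_sum (f := fun i => d i ω)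
          (fun i _ => hd0 i ω) (Finset.mem_univ i)
        have h8 : 2 * d i ω * d i ω ≤ 2 * V ω * d i ω := by
          gcongr
        refine le_trans ?_ (add_le_add le_rfl h8)
        -- With d = u - v one has u² - v² = d(2u - d), and (2u - d)² ≤ 8u² + 2d²; the difference of
        -- the two sides is (2u + d)² = (3u - v)².
        have h9 : ∀ u v : ℝ, (u ^ 2 - v ^ 2) ^ 2 ≤
            8 * u ^ 2 * (u - v) ^ 2 + 2 * (u - v) ^ 2 * (u - v) ^ 2 := by
          intro u v
          have h10 : 0 ≤ (u - v) ^ 2 * (3 * u - v) ^ 2 := by positivity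
          nlinarith
        have h11 := h9 (f (fun i => Y i ω) - c) (h i (fun i => Y i ω) - c)
        rw [sub_sub_sub_cancel_right] at h11
        exact h11
      refine (Finset.sum_le_sum fun i _ => h6 i).trans ?_
      rw [Finset.sum_add_distrib, ← Finset.mul_sum, ← Finset.mul_sum]
      change 8 * g ω ^ 2 * V ω + 2 * V ω * V ω ≤ g ω ^ 4 / 2 + 34 * V ω ^ 2
      nlinarith [sq_nonneg (g ω ^ 2 - 8 * V ω)]
    · intro i _
      refine integrable_sq_of_abs_le (B := (B + B) ^ 2 + (B + B) ^ 2)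
        ((((hf.sub_const c).pow_const 2).sub (((hh i).sub_const c).pow_const 2)).comp hYm)
        fun ω => ?_
      exact (abs_sub _ _).trans (add_le_add (hsq _ (hfc _)) (hsq _ (hhc _ _)))
  rw [integral_add (hg4.div_const 2) (hV2.const_mul 34), integral_div, integral_const_mul] at h5
  have h12 : (∫ ω, g ω ^ 2 ∂P) ^ 2 ≤ ∫ ω, V ω ^ 2 ∂P := by
    refine (pow_le_pow_left₀ (integral_nonneg fun ω => sq_nonneg _) h3 2).trans ?_
    exact sq_integral_le_integral_sq hVi hV2
  have h13 : ∀ ω, ((f (fun i => Y i ω) - c) ^ 2) ^ 2 = g ω ^ 4 := fun ω => by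
    rw [hg]
    ring
  simp only [h13] at h1
  have h14 := h1.trans h5
  change _ - (∫ ω, g ω ^ 2 ∂P) ^ 2 ≤ _ at h14
  linarith

end EfronStein

/-! ### Measurability of matrix functions, entry by entry -/

section Measurability

open Matrix

variable {Ω ι : Type*} [MeasurableSpace Ω] [Fintype ι]

theorem measurable_mul_entries {A B : Ω → Matrix ι ι ℂ} (hA : ∀ p q, Measurable fun ω => A ω p q)
    (hB : ∀ p q, Measurable fun ω => B ω p q) (p q : ι) :
    Measurable fun ω => (A ω * B ω) p q := by
  simp only [Matrix.mul_apply]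
  exact Finset.measurable_fun_sum _ fun i _ => (hA p i).mul (hB i q)

theorem measurable_trace_of_entries {A : Ω → Matrix ι ι ℂ}
    (hA : ∀ p q, Measurable fun ω => A ω p q) : Measurable fun ω => (A ω).trace := by
  simp only [Matrix.trace, Matrix.diag]
  exact Finset.measurable_fun_sum _ fun i _ => hA i i

open scoped Matrix.Norms.Frobenius in
theorem measurable_norm_of_entries {A : Ω → Matrix ι ι ℂ}
    (hA : ∀ p q, Measurable fun ω => A ω p q) : Measurable fun ω => ‖A ω‖ := by
  have h : (fun ω => ‖A ω‖) = fun ω => √(∑ p, ∑ q, ‖A ω p q‖ ^ 2) := by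
    funext ω
    rw [← frobenius_norm_sq, Real.sqrt_sq (norm_nonneg _)]
  rw [h]
  exact (Finset.measurable_fun_sum _ fun p _ => Finset.measurable_fun_sum _ fun q _ =>
    ((hA p q).norm.pow_const 2)).sqrt

variable [DecidableEq ι]

theorem measurable_det_of_entries {A : Ω → Matrix ι ι ℂ}
    (hA : ∀ p q, Measurable fun ω => A ω p q) : Measurable fun ω => (A ω).det := by
  simp only [Matrix.det_apply]
  exact Finset.measurable_fun_sum _ fun σ _ =>
    (Finset.measurable_fun_prod _ fun i _ => hA _ _).const_smul _

theorem measurable_inv_of_entries {A : Ω → Matrix ι ι ℂ}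
    (hA : ∀ p q, Measurable fun ω => A ω p q) (p q : ι) : Measurable fun ω => (A ω)⁻¹ p q := by
  simp only [Matrix.inv_def, Matrix.smul_apply, Matrix.adjugate_apply, smul_eq_mul,
    Ring.inverse_eq_inv']
  refine (measurable_det_of_entries hA).inv.mul (measurable_det_of_entries fun i j => ?_)
  by_cases h : i = q
  · subst h
    simp only [Matrix.updateRow_self]
    exact measurable_const
  · simp only [Matrix.updateRow_ne h]
    exact hA i j

theorem measurable_green {A : Ω → Matrix ι ι ℝ} (hA : ∀ p q, Measurable fun ω => A ω p q) (y : ℝ)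
    (p q : ι) : Measurable fun ω => green y (A ω) p q := by
  refine measurable_inv_of_entries (fun i j => ?_) p q
  simp only [shiftedMatrix, Matrix.sub_apply, complexify_apply]
  exact (Complex.measurable_ofReal.comp (hA i j)).sub measurable_const

theorem measurable_skewPart {n : ℕ} {R : Type*} [MeasurableSpace R] [Zero R]
    {A : Ω → Matrix (Fin n) (Fin n) R} (hA : ∀ p q, Measurable fun ω => A ω p q) (r : ℕ)
    (p q : Fin n) : Measurable fun ω => skewPart r (A ω) p q := by
  simp only [skewPart_apply]
  by_cases h : (p : ℕ) + q = r
  · simpa only [h, if_true] using! hA p q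
  · simp only [h, if_false]
    exact measurable_const

end Measurability

/-! ### The random matrix: independent blocks, largest entry, column norms -/

section Ensemble

open Matrix

variable {Ω : Type*} {n : ℕ}

/-- The assumptions on the entries of one matrix: centered, of variance one, with moments of all
orders, and independent across skew-diagonals. -/
structure IsSkewEnsemble [MeasurableSpace Ω] (P : Measure Ω) (a : Fin n → Fin n → Ω → ℝ) : Prop where
  measurable : ∀ p q, p ≤ q → Measurable (a p q)
  integral_eq_zero : ∀ p q, p ≤ q → ∫ ω, a p q ω ∂P = 0
  integral_sq_eq_one : ∀ p q, p ≤ q → ∫ ω, a p q ω ^ 2 ∂P = 1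
  integrable_pow : ∀ (k : ℕ) (p q), p ≤ q → Integrable (fun ω => |a p q ω| ^ k) P
  indep : iIndepFun (fun (r : ℕ) (ω : Ω) (pq : SkewDiagonal n r) => a pq.1.1 pq.1.2 ω) P

/-- The entry of the symmetric matrix in row `p` and column `q`, before rescaling. -/
def symmEntry (a : Fin n → Fin n → Ω → ℝ) (p q : Fin n) : Ω → ℝ := a (min p q) (max p q)

/-- The rescaled symmetric random matrix. -/
noncomputable def ensembleMatrix (a : Fin n → Fin n → Ω → ℝ) (ω : Ω) : Matrix (Fin n) (Fin n) ℝ :=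
  rescaledSymmetricMatrix fun p q => a p q ω

/-- The random matrix with one skew-diagonal set to zero. -/
noncomputable def removeSkew (r : ℕ) (X : Matrix (Fin n) (Fin n) ℝ) : Matrix (Fin n) (Fin n) ℝ :=
  X - skewPart r X

theorem removeSkew_apply (r : ℕ) (X : Matrix (Fin n) (Fin n) ℝ) (p q : Fin n) :
    removeSkew r X p q = if (p : ℕ) + q = r then 0 else X p q := by
  by_cases h : (p : ℕ) + q = r <;> simp [removeSkew, skewPart_apply, h]

theorem isSymm_removeSkew (r : ℕ) {X : Matrix (Fin n) (Fin n) ℝ} (hX : X.IsSymm) :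
    (removeSkew r X).IsSymm :=
  hX.sub (isSymm_skewPart r hX)

/-- The entries on one skew-diagonal, extended by zero. -/
def skewBlock (a : Fin n → Fin n → Ω → ℝ) (r : ℕ) (ω : Ω) (p q : Fin n) : ℝ :=
  if p ≤ q ∧ (p : ℕ) + q = r then a p q ω else 0

/-- The symmetric matrix whose skew-diagonals are given by the blocks `x`. -/
noncomputable def assemble (x : Fin (2 * n) → Fin n → Fin n → ℝ) : Matrix (Fin n) (Fin n) ℝ :=
  Matrix.of fun p q => 1 / √(n : ℝ) * x ⟨p + q, by omega⟩ (min p q) (max p q)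

theorem min_add_max_val (p q : Fin n) : ((min p q : Fin n) : ℕ) + (max p q : Fin n) = p + q := by
  rcases le_total p q with h | h
  · simp [h]
  · simp [h, add_comm]

theorem isSymm_assemble (x : Fin (2 * n) → Fin n → Fin n → ℝ) : (assemble x).IsSymm := by
  ext p q
  simp [assemble, min_comm, max_comm, add_comm]

theorem assemble_skewBlock (a : Fin n → Fin n → Ω → ℝ) (ω : Ω) :
    assemble (fun r : Fin (2 * n) => skewBlock a r ω) = ensembleMatrix a ω := by
  ext p q
  simp only [assemble, ensembleMatrix, rescaledSymmetricMatrix, skewBlock, Matrix.of_apply]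
  rw [if_pos ⟨min_le_max, min_add_max_val p q⟩]

theorem measurable_assemble (p q : Fin n) :
    Measurable fun x : Fin (2 * n) → Fin n → Fin n → ℝ => assemble x p q := by
  simp only [assemble, Matrix.of_apply]
  fun_prop

/-- The matrix with block `r` deleted ignores coordinate `r`. This makes functions of it admissible
comparison functions in the Efron–Stein inequality. -/
theorem removeSkew_assemble_update (r : Fin (2 * n)) (x : Fin (2 * n) → Fin n → Fin n → ℝ)
    (e : Fin n → Fin n → ℝ) :
    removeSkew r (assemble (Function.update x r e)) = removeSkew r (assemble x) := by
  ext p q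
  rw [removeSkew_apply, removeSkew_apply]
  split_ifs with h
  · rfl
  · simp only [assemble, Matrix.of_apply]
    rw [Function.update_of_ne]
    intro h'
    exact h (congrArg Fin.val h')

theorem isSymm_ensembleMatrix (a : Fin n → Fin n → Ω → ℝ) (ω : Ω) :
    (ensembleMatrix a ω).IsSymm := by
  rw [← assemble_skewBlock]
  exact isSymm_assemble _

theorem ensembleMatrix_apply (a : Fin n → Fin n → Ω → ℝ) (ω : Ω) (p q : Fin n) :
    ensembleMatrix a ω p q = 1 / √(n : ℝ) * symmEntry a p q ω := rfl

/-- A bound for all entries of the random matrix, before rescaling. -/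
noncomputable def entryBound (a : Fin n → Fin n → Ω → ℝ) (ω : Ω) : ℝ :=
  1 + ‖fun x : Fin n × Fin n => symmEntry a x.1 x.2 ω‖

theorem one_le_entryBound (a : Fin n → Fin n → Ω → ℝ) (ω : Ω) : 1 ≤ entryBound a ω := by
  rw [entryBound]
  linarith [norm_nonneg fun x : Fin n × Fin n => symmEntry a x.1 x.2 ω]

theorem abs_symmEntry_le (a : Fin n → Fin n → Ω → ℝ) (ω : Ω) (p q : Fin n) :
    |symmEntry a p q ω| ≤ entryBound a ω := by
  have h := norm_le_pi_norm (fun x : Fin n × Fin n => symmEntry a x.1 x.2 ω) (p, q)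
  rw [Real.norm_eq_abs] at h
  rw [entryBound]
  linarith

theorem norm_complexify_ensembleMatrix_le (a : Fin n → Fin n → Ω → ℝ) (ω : Ω) (p q : Fin n) :
    ‖complexify (ensembleMatrix a ω) p q‖ ≤ entryBound a ω / √(n : ℝ) := by
  rw [complexify_apply, Complex.norm_real, Real.norm_eq_abs, ensembleMatrix_apply, abs_mul,
    abs_of_nonneg (by positivity), one_div, inv_mul_eq_div]
  gcongr
  exact abs_symmEntry_le a ω p q

/-- The maximum is bounded by the sum over all n² positions. The loss of n² is repaired later by
using a high moment. -/
theorem entryBound_pow_le (a : Fin n → Fin n → Ω → ℝ) (ω : Ω) (k : ℕ) :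
    entryBound a ω ^ k ≤ 2 ^ k * (1 + ∑ x : Fin n × Fin n, |symmEntry a x.1 x.2 ω| ^ k) := by
  set f : Fin n × Fin n → ℝ := fun x => symmEntry a x.1 x.2 ω with hf
  have h1 : entryBound a ω ≤ 2 * max 1 ‖f‖ := by
    rw [entryBound]
    linarith [le_max_left 1 ‖f‖, le_max_right 1 ‖f‖]
  have h2 : ‖f‖ ^ k ≤ 1 + ∑ x, |f x| ^ k := by
    by_cases hn : Nonempty (Fin n × Fin n)
    · obtain ⟨x, -, hx⟩ := Finset.exists_mem_eq_sup' (Finset.univ_nonempty (α := Fin n × Fin n))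
        fun x => ‖f x‖₊
      have hx' : ‖f‖ ≤ |f x| := by
        rw [pi_norm_le_iff_of_nonneg (abs_nonneg _)]
        intro z
        have h3 : ‖f z‖₊ ≤ ‖f x‖₊ := by
          rw [← hx]
          exact Finset.le_sup' (fun x => ‖f x‖₊) (Finset.mem_univ z)
        exact_mod_cast h3
      refine (pow_le_pow_left₀ (norm_nonneg _) hx' k).trans ?_
      have := Finset.single_le_sum (f := fun x => |f x| ^ k) (fun i _ => by positivity)
        (Finset.mem_univ x)
      linarith
    · rw [not_nonempty_iff] at hn
      have h3 : ‖f‖ = 0 := by rw [Subsingleton.elim f 0, norm_zero]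
      rw [h3]
      have : (0 : ℝ) ^ k ≤ 1 := pow_le_one₀ le_rfl zero_le_one
      have h4 : 0 ≤ ∑ x, |f x| ^ k := Finset.sum_nonneg fun i _ => by positivity
      linarith
  have h0 : 0 ≤ entryBound a ω := zero_le_one.trans (one_le_entryBound a ω)
  refine (pow_le_pow_left₀ h0 h1 k).trans ?_
  rw [mul_pow]
  gcongr
  rcases max_choice 1 ‖f‖ with h | h <;> rw [h]
  · rw [one_pow]
    have h4 : 0 ≤ ∑ x, |f x| ^ k := Finset.sum_nonneg fun i _ => by positivity
    linarith
  · exact h2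

namespace IsSkewEnsemble

variable [MeasurableSpace Ω] {P : Measure Ω} {a : Fin n → Fin n → Ω → ℝ} (h : IsSkewEnsemble P a)
include h

theorem measurable_symmEntry (p q : Fin n) : Measurable (symmEntry a p q) :=
  h.measurable _ _ min_le_max

theorem measurable_ensembleMatrix (p q : Fin n) : Measurable fun ω => ensembleMatrix a ω p q :=
  (h.measurable_symmEntry p q).const_mul _

theorem measurable_removeSkew (r : ℕ) (p q : Fin n) :
    Measurable fun ω => removeSkew r (ensembleMatrix a ω) p q :=
  (h.measurable_ensembleMatrix p q).sub (measurable_skewPart h.measurable_ensembleMatrix r p q)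

theorem measurable_entryBound : Measurable (entryBound a) :=
  (measurable_pi_lambda (fun ω (x : Fin n × Fin n) => symmEntry a x.1 x.2 ω)
    fun x => h.measurable_symmEntry x.1 x.2).norm.const_add 1

theorem integrable_symmEntry_pow [IsProbabilityMeasure P] (k : ℕ) (p q : Fin n) :
    Integrable (fun ω => |symmEntry a p q ω| ^ k) P :=
  h.integrable_pow k _ _ min_le_max

theorem integrable_entryBound_pow [IsProbabilityMeasure P] (k : ℕ) :
    Integrable (fun ω => entryBound a ω ^ k) P := by
  refine Integrable.mono' (g := fun ω => 2 ^ k * (1 + ∑ x : Fin n × Fin n,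
    |symmEntry a x.1 x.2 ω| ^ k)) ?_ (h.measurable_entryBound.pow_const k).aestronglyMeasurable
    (Eventually.of_forall fun ω => ?_)
  · exact ((integrable_const _).add (integrable_finsetSum _ fun x _ =>
      h.integrable_symmEntry_pow k x.1 x.2)).const_mul _
  · rw [Real.norm_of_nonneg (pow_nonneg (zero_le_one.trans (one_le_entryBound a ω)) k)]
    exact entryBound_pow_le a ω k

theorem integral_entryBound_pow_le [IsProbabilityMeasure P] {k : ℕ} {M : ℝ}
    (hM : ∀ p q, p ≤ q → ∫ ω, |a p q ω| ^ k ∂P ≤ M) :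
    ∫ ω, entryBound a ω ^ k ∂P ≤ 2 ^ k * (1 + (n : ℝ) ^ 2 * M) := by
  have hi : Integrable (fun ω => ∑ x : Fin n × Fin n, |symmEntry a x.1 x.2 ω| ^ k) P :=
    integrable_finsetSum _ fun x _ => h.integrable_symmEntry_pow k x.1 x.2
  have hi1 : Integrable
      (fun ω => 1 + ∑ x : Fin n × Fin n, |symmEntry a x.1 x.2 ω| ^ k) P :=
    (integrable_const _).add hi
  refine (integral_mono (h.integrable_entryBound_pow k)
    (hi1.const_mul _) (entryBound_pow_le a · k)).trans ?_
  rw [integral_const_mul, integral_add (integrable_const _) hi, integral_finsetSum _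
    fun x _ => h.integrable_symmEntry_pow k x.1 x.2]
  gcongr
  · simp
  · refine (Finset.sum_le_sum fun x _ => hM _ _ min_le_max).trans_eq ?_
    simp [sq]

/-- Truncation at t = n^(1/4): x ≤ t + x⁹/t⁸ with x = K⁸ brings in the moment 72 = 8 · 9. The union
bound makes that moment O(n²), exactly cancelled by t⁸ = n². -/
theorem integral_entryBound_pow_eight_le [IsProbabilityMeasure P] (hn : 0 < n) {M : ℝ}
    (hM : ∀ p q, p ≤ q → ∫ ω, |a p q ω| ^ 72 ∂P ≤ M) :
    ∫ ω, entryBound a ω ^ 8 ∂P ≤ (1 + 2 ^ 72 * (1 + M)) * (n : ℝ) ^ (1 / 4 : ℝ) := by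
  have hn' : (1 : ℝ) ≤ n := by exact_mod_cast hn
  have hM0 : 0 ≤ M := (integral_nonneg fun ω => by positivity).trans (hM ⟨0, hn⟩ ⟨0, hn⟩ le_rfl)
  set t : ℝ := (n : ℝ) ^ (1 / 4 : ℝ) with ht
  have ht1 : 1 ≤ t := Real.one_le_rpow hn' (by norm_num)
  have ht0 : 0 < t := zero_lt_one.trans_le ht1
  have ht8 : t ^ 8 = (n : ℝ) ^ 2 := by
    rw [ht, ← Real.rpow_natCast, ← Real.rpow_mul (by positivity)]
    norm_num
  have hpt : ∀ x : ℝ, 0 ≤ x → x ≤ t + x ^ 9 / t ^ 8 := by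
    intro x hx
    rcases le_total x t with hxt | hxt
    · have : 0 ≤ x ^ 9 / t ^ 8 := by positivity
      linarith
    · have h1 : x ≤ x ^ 9 / t ^ 8 := by
        rw [le_div_iff₀ (by positivity)]
        calc x * t ^ 8 ≤ x * x ^ 8 := by gcongr
          _ = x ^ 9 := by ring
      linarith
  have hK : ∀ ω, entryBound a ω ^ 8 ≤ t + entryBound a ω ^ 72 / t ^ 8 := fun ω => by
    have h1 := hpt (entryBound a ω ^ 8)
      (pow_nonneg (zero_le_one.trans (one_le_entryBound a ω)) 8)
    rwa [← pow_mul] at h1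
  have hi : Integrable (fun ω => entryBound a ω ^ 72 / t ^ 8) P :=
    (h.integrable_entryBound_pow 72).div_const _
  refine (integral_mono (h.integrable_entryBound_pow 8) ((integrable_const _).add hi) hK).trans ?_
  have h2 : ∫ ω, (t + entryBound a ω ^ 72 / t ^ 8) ∂P =
      t + (∫ ω, entryBound a ω ^ 72 ∂P) / t ^ 8 := by
    rw [integral_add (integrable_const _) hi, integral_div]
    simp
  refine h2.le.trans ?_
  rw [ht8]
  have h3 := h.integral_entryBound_pow_le hM
  have h4 : (∫ ω, entryBound a ω ^ 72 ∂P) / (n : ℝ) ^ 2 ≤ 2 ^ 72 * (1 + M) := by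
    rw [div_le_iff₀ (by positivity)]
    refine h3.trans ?_
    have : (1 : ℝ) ≤ (n : ℝ) ^ 2 := one_le_pow₀ hn'
    nlinarith
  have h5 : 0 ≤ (2 : ℝ) ^ 72 * (1 + M) := by positivity
  have h6 : (2 : ℝ) ^ 72 * (1 + M) * 1 ≤ 2 ^ 72 * (1 + M) * t :=
    mul_le_mul_of_nonneg_left ht1 h5
  linarith

theorem measurable_skewBlock (r : ℕ) : Measurable (skewBlock a r) := by
  refine measurable_pi_lambda _ fun p => measurable_pi_lambda _ fun q => ?_
  by_cases hpq : p ≤ q ∧ (p : ℕ) + q = r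
  · simpa only [skewBlock, hpq, and_self, if_true] using! h.measurable p q hpq.1
  · simp only [skewBlock, hpq, if_false]
    exact measurable_const

theorem iIndepFun_skewBlock : iIndepFun (fun r : Fin (2 * n) => skewBlock a (r : ℕ)) P := by
  -- Blocks are indexed by the sum of the zero-based indices, `SkewDiagonal` by the sum of the
  -- one-based ones; hence the shift by 2.
  have h1 := h.indep.precomp (g := fun r : Fin (2 * n) => (r : ℕ) + 2)
    (fun r s hrs => by ext; simpa using hrs)
  have h2 := h1.comp (fun (r : Fin (2 * n)) (b : SkewDiagonal n ((r : ℕ) + 2) → ℝ) (p q : Fin n) =>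
    if hpq : p ≤ q ∧ ((p : ℕ) + 1) + ((q : ℕ) + 1) = (r : ℕ) + 2 then b ⟨(p, q), hpq⟩ else 0)
    (fun r => by
      refine measurable_pi_lambda _ fun p => measurable_pi_lambda _ fun q => ?_
      by_cases hpq : p ≤ q ∧ ((p : ℕ) + 1) + ((q : ℕ) + 1) = (r : ℕ) + 2
      · simp only [hpq, and_self, dite_true]
        exact measurable_pi_apply _
      · simp only [hpq, dite_false]
        exact measurable_const)
  convert h2 using 1
  funext r ω p q
  simp only [skewBlock, Function.comp]
  by_cases hpq : p ≤ q ∧ (p : ℕ) + q = r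
  · rw [if_pos hpq, dif_pos ⟨hpq.1, by omega⟩]
  · rw [if_neg hpq, dif_neg (fun h' => hpq ⟨h'.1, by omega⟩)]

theorem indepFun_skewPart_removeSkew (r : Fin (2 * n)) :
    IndepFun (fun ω (p q : Fin n) => skewPart r (ensembleMatrix a ω) p q)
      (fun ω (p q : Fin n) => removeSkew r (ensembleMatrix a ω) p q) P := by
  classical
  have h1 := h.iIndepFun_skewBlock.indepFun_finset {r} (Finset.univ \ {r})
    Finset.disjoint_sdiff (fun i => h.measurable_skewBlock i)
  have h2 := h1.comp
    (φ := fun (x : ({r} : Finset (Fin (2 * n))) → Fin n → Fin n → ℝ) (p q : Fin n) =>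
      if (p : ℕ) + q = r then 1 / √(n : ℝ) * x ⟨r, Finset.mem_singleton_self r⟩ (min p q) (max p q)
      else 0)
    (ψ := fun (x : (Finset.univ \ {r} : Finset (Fin (2 * n))) → Fin n → Fin n → ℝ) (p q : Fin n) =>
      if hpq : (p : ℕ) + q = r then 0
      else 1 / √(n : ℝ) * x ⟨⟨p + q, by omega⟩, by
        simp only [Finset.mem_sdiff, Finset.mem_univ, Finset.mem_singleton, true_and]
        exact fun h' => hpq (congrArg Fin.val h')⟩ (min p q) (max p q))
    (by
      refine measurable_pi_lambda _ fun p => measurable_pi_lambda _ fun q => ?_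
      by_cases hpq : (p : ℕ) + q = r
      · simp only [hpq, if_true]
        fun_prop
      · simp only [hpq, if_false]
        fun_prop)
    (by
      refine measurable_pi_lambda _ fun p => measurable_pi_lambda _ fun q => ?_
      by_cases hpq : (p : ℕ) + q = r
      · simp only [hpq, dite_true]
        fun_prop
      · simp only [hpq, dite_false]
        fun_prop)
  convert h2 using 1
  · funext ω p q
    simp only [Function.comp, skewPart_apply, ← assemble_skewBlock, assemble, Matrix.of_apply]
    by_cases hpq : (p : ℕ) + q = r
    · simp [hpq]
    · simp [hpq]
  · funext ω p q
    simp only [Function.comp, removeSkew_apply, ← assemble_skewBlock, assemble, Matrix.of_apply]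
    by_cases hpq : (p : ℕ) + q = r
    · simp [hpq]
    · simp [hpq]

theorem indepFun_symmEntry {p q u v : Fin n} (hne : (p : ℕ) + q ≠ u + v) :
    IndepFun (symmEntry a p q) (symmEntry a u v) P := by
  have h1 := h.iIndepFun_skewBlock.indepFun (i := ⟨p + q, by omega⟩) (j := ⟨u + v, by omega⟩)
    (by simpa using hne)
  have h2 := h1.comp (φ := fun e : Fin n → Fin n → ℝ => e (min p q) (max p q))
    (ψ := fun e : Fin n → Fin n → ℝ => e (min u v) (max u v)) (by fun_prop) (by fun_prop)
  convert h2 using 1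
  · funext ω
    simp [skewBlock, symmEntry]
  · funext ω
    simp [skewBlock, symmEntry]

theorem integral_symmEntry (p q : Fin n) : ∫ ω, symmEntry a p q ω ∂P = 0 :=
  h.integral_eq_zero _ _ min_le_max

theorem integral_symmEntry_sq (p q : Fin n) : ∫ ω, symmEntry a p q ω ^ 2 ∂P = 1 :=
  h.integral_sq_eq_one _ _ min_le_max

end IsSkewEnsemble

/-- The squared norm of a column of the random matrix. -/
noncomputable def columnMass (a : Fin n → Fin n → Ω → ℝ) (q : Fin n) (ω : Ω) : ℝ :=
  ∑ p, ‖complexify (ensembleMatrix a ω) p q‖ ^ 2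

/-- A bound for the squared norms of all columns of the random matrix. -/
noncomputable def massBound (a : Fin n → Fin n → Ω → ℝ) (ω : Ω) : ℝ :=
  2 + ∑ q, (columnMass a q ω - 1) ^ 2

/-- The elementary bound x ≤ 2 + (x - 1)² replaces the maximum over columns by a sum of squared
deviations. It has bounded expectation because each of the n deviations has variance O(1/n). -/
theorem columnMass_le_massBound (a : Fin n → Fin n → Ω → ℝ) (q : Fin n) (ω : Ω) :
    columnMass a q ω ≤ massBound a ω := by
  have h1 := Finset.single_le_sum (f := fun q => (columnMass a q ω - 1) ^ 2)
    (fun i _ => sq_nonneg _) (Finset.mem_univ q)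
  have h2 : columnMass a q ω ≤ 2 + (columnMass a q ω - 1) ^ 2 := by
    nlinarith [sq_nonneg (columnMass a q ω - 1 - 1)]
  exact h2.trans (add_le_add le_rfl h1)

theorem columnMass_eq (a : Fin n → Fin n → Ω → ℝ) (q : Fin n) (ω : Ω) :
    columnMass a q ω = (n : ℝ)⁻¹ * ∑ p, symmEntry a p q ω ^ 2 := by
  rw [columnMass, Finset.mul_sum]
  refine Finset.sum_congr rfl fun p _ => ?_
  rw [complexify_apply, Complex.norm_real, Real.norm_eq_abs, sq_abs, ensembleMatrix_apply, mul_pow,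
    div_pow, one_pow, Real.sq_sqrt (by positivity), one_div]

namespace IsSkewEnsemble

variable [MeasurableSpace Ω] {P : Measure Ω} [IsProbabilityMeasure P] {a : Fin n → Fin n → Ω → ℝ}
  (h : IsSkewEnsemble P a)
include h

theorem memLp_symmEntry_sq (p q : Fin n) : MemLp (fun ω => symmEntry a p q ω ^ 2) 2 P := by
  rw [memLp_two_iff_integrable_sq ((h.measurable_symmEntry p q).pow_const 2).aestronglyMeasurable]
  refine (h.integrable_symmEntry_pow 4 p q).congr (Eventually.of_forall fun ω => ?_)
  simp only
  rw [← pow_mul, Even.pow_abs (by decide)]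

/-- Entries of one column lie on different skew-diagonals and are therefore independent, so the
variance of the sum of their squares is at most n M. -/
theorem integral_columnMass_sub_sq_le {M : ℝ} (hM : ∀ p q, p ≤ q → ∫ ω, |a p q ω| ^ 4 ∂P ≤ M)
    (q : Fin n) : Integrable (fun ω => (columnMass a q ω - 1) ^ 2) P ∧
      ∫ ω, (columnMass a q ω - 1) ^ 2 ∂P ≤ (n : ℝ)⁻¹ * M := by
  have hn : (n : ℝ) ≠ 0 := by
    have := q.pos
    positivity
  set Z : Fin n → Ω → ℝ := fun p ω => symmEntry a p q ω ^ 2 with hZ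
  have hZ2 : ∀ p, MemLp (Z p) 2 P := fun p => h.memLp_symmEntry_sq p q
  have hS2 : MemLp (∑ p, Z p) 2 P := memLp_finsetSum' _ fun p _ => hZ2 p
  have hES : ∫ ω, (∑ p, Z p) ω ∂P = (n : ℝ) := by
    simp only [Finset.sum_apply]
    rw [integral_finsetSum _ fun p _ => (hZ2 p).integrable one_le_two]
    simp [hZ, h.integral_symmEntry_sq]
  have hpt : ∀ ω, (columnMass a q ω - 1) ^ 2 = (n : ℝ)⁻¹ ^ 2 * ((∑ p, Z p) ω - n) ^ 2 := by
    intro ω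
    rw [columnMass_eq, Finset.sum_apply, ← mul_pow, mul_sub, inv_mul_cancel₀ hn]
  have hvar : variance (∑ p, Z p) P ≤ n * M := by
    rw [IndepFun.variance_sum (fun p _ => hZ2 p)]
    · refine (Finset.sum_le_sum fun p _ => ?_).trans_eq (b := ∑ _ : Fin n, M) (by simp)
      refine (variance_le_expectation_sq (hZ2 p).aestronglyMeasurable).trans ?_
      refine le_of_eq_of_le (integral_congr_ae (Eventually.of_forall fun ω => ?_))
        (hM (min p q) (max p q) min_le_max)
      simp only [hZ, Pi.pow_apply]
      rw [← pow_mul, symmEntry, Even.pow_abs (by decide)]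
    · intro p _ p' _ hne
      exact (h.indepFun_symmEntry (p := p) (q := q) (u := p') (v := q)
        (fun h' => hne (by ext; omega))).comp (φ := fun x : ℝ => x ^ 2) (ψ := fun x : ℝ => x ^ 2)
        (by fun_prop) (by fun_prop)
  have hint : Integrable (fun ω => ((∑ p, Z p) ω - n) ^ 2) P := by
    have := (hS2.sub (memLp_const (n : ℝ))).integrable_sq
    exact this
  rw [variance_eq_integral hS2.aestronglyMeasurable.aemeasurable, hES] at hvar
  simp only [hpt]
  refine ⟨hint.const_mul _, ?_⟩
  rw [integral_const_mul]
  calc (n : ℝ)⁻¹ ^ 2 * ∫ ω, ((∑ p, Z p) ω - n) ^ 2 ∂P ≤ (n : ℝ)⁻¹ ^ 2 * (n * M) := by gcongr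
    _ = (n : ℝ)⁻¹ * M := by field_simp

theorem integral_massBound_le {M : ℝ} (hM0 : 0 ≤ M)
    (hM : ∀ p q, p ≤ q → ∫ ω, |a p q ω| ^ 4 ∂P ≤ M) :
    Integrable (massBound a) P ∧ ∫ ω, massBound a ω ∂P ≤ 2 + M := by
  have hi : Integrable (fun ω => ∑ q, (columnMass a q ω - 1) ^ 2) P :=
    integrable_finsetSum _ fun q _ => (h.integral_columnMass_sub_sq_le hM q).1
  refine ⟨(integrable_const _).add hi, ?_⟩
  simp only [massBound]
  rw [integral_add (integrable_const _) hi,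
    integral_finsetSum _ fun q _ => (h.integral_columnMass_sub_sq_le hM q).1]
  gcongr
  · simp
  · refine (Finset.sum_le_sum fun q _ => (h.integral_columnMass_sub_sq_le hM q).2).trans ?_
    rw [Finset.sum_const, Finset.card_univ, Fintype.card_fin, nsmul_eq_mul]
    by_cases hn : n = 0
    · simp [hn, hM0]
    · have : (n : ℝ) ≠ 0 := by exact_mod_cast hn
      rw [mul_inv_cancel_left₀ this]

end IsSkewEnsemble

end Ensemble

/-! ### Effect on the resolvent of deleting one skew-diagonal -/

section ResolventPerturbation

open scoped Matrix.Norms.Frobenius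
open Matrix

theorem norm_green_mul_le_self {ι : Type*} [Fintype ι] [DecidableEq ι] {X : Matrix ι ι ℝ}
    (hX : X.IsSymm) {y : ℝ} (hy : 1 ≤ y) (A : Matrix ι ι ℂ) : ‖green y X * A‖ ≤ ‖A‖ :=
  (norm_green_mul_le hX (zero_lt_one.trans_le hy) A).trans
    (mul_le_of_le_one_left (norm_nonneg _) (inv_le_one_of_one_le₀ hy))

theorem norm_mul_green_le_self {ι : Type*} [Fintype ι] [DecidableEq ι] {X : Matrix ι ι ℝ}
    (hX : X.IsSymm) {y : ℝ} (hy : 1 ≤ y) (A : Matrix ι ι ℂ) : ‖A * green y X‖ ≤ ‖A‖ :=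
  (norm_mul_green_le hX (zero_lt_one.trans_le hy) A).trans
    (mul_le_of_le_one_left (norm_nonneg _) (inv_le_one_of_one_le₀ hy))

variable {n : ℕ}

theorem norm_green_le_sqrt {X : Matrix (Fin n) (Fin n) ℝ} (hX : X.IsSymm) {y : ℝ} (hy : 1 ≤ y) :
    ‖green y X‖ ≤ √(n : ℝ) := by
  have h := norm_green_le hX (zero_lt_one.trans_le hy)
  rw [Fintype.card_fin] at h
  exact h.trans (mul_le_of_le_one_left (Real.sqrt_nonneg _) (inv_le_one_of_one_le₀ hy))

theorem norm_one_fin : ‖(1 : Matrix (Fin n) (Fin n) ℂ)‖ = √(n : ℝ) := by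
  rw [← Real.sqrt_sq (norm_nonneg _), frobenius_norm_one_sq, Fintype.card_fin]

variable {X : Matrix (Fin n) (Fin n) ℝ} {y : ℝ}

theorem green_sub_green_removeSkew (hX : X.IsSymm) (hy : y ≠ 0) (r : ℕ) :
    green y X - green y (removeSkew r X) =
      -(green y X * skewPart r (complexify X) * green y (removeSkew r X)) := by
  rw [green_sub_green hX (isSymm_removeSkew r hX) hy, removeSkew, sub_sub_cancel,
    complexify_skewPart]

theorem green_sub_green_removeSkew' (hX : X.IsSymm) (hy : y ≠ 0) (r : ℕ) :
    green y X - green y (removeSkew r X) =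
      -(green y (removeSkew r X) * skewPart r (complexify X) * green y X) := by
  rw [← neg_sub, green_sub_green (isSymm_removeSkew r hX) hX hy, ← complexify_skewPart]
  have : removeSkew r X - X = -skewPart r X := by simp [removeSkew]
  rw [this]
  have h2 : complexify (-skewPart r X) = -complexify (skewPart r X) := by
    ext
    simp
  rw [h2]
  simp

theorem green_eq_removeSkew_sub (hX : X.IsSymm) (hy : y ≠ 0) (r : ℕ) :
    green y X = green y (removeSkew r X) -
      green y (removeSkew r X) * skewPart r (complexify X) * green y X := by
  have h := green_sub_green_removeSkew' hX hy r
  rw [sub_eq_iff_eq_add] at h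
  rw [sub_eq_add_neg, add_comm]
  exact h

/-- The resolvent identity used twice. In the first two terms the deleted skew-diagonal occurs only
next to the resolvent independent of it; the full resolvent survives only in the second order
remainder. -/
theorem green_eq_removeSkew_expansion (hX : X.IsSymm) (hy : y ≠ 0) (r : ℕ) :
    green y X = green y (removeSkew r X) -
      green y (removeSkew r X) * skewPart r (complexify X) * green y (removeSkew r X) +
      green y (removeSkew r X) * skewPart r (complexify X) * green y (removeSkew r X) *
        skewPart r (complexify X) * green y X := by
  have h := green_eq_removeSkew_sub hX hy r
  have h2 : green y (removeSkew r X) * skewPart r (complexify X) * green y X =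
      green y (removeSkew r X) * skewPart r (complexify X) * green y (removeSkew r X) -
      green y (removeSkew r X) * skewPart r (complexify X) * green y (removeSkew r X) *
        skewPart r (complexify X) * green y X := by
    conv_lhs => rw [h]
    rw [mul_sub]
    simp only [Matrix.mul_assoc]
  conv_lhs => rw [h, h2]
  abel

theorem norm_skewPart_mul_mul_skewPart_sq (r : ℕ) (D M : Matrix (Fin n) (Fin n) ℂ) :
    ‖skewPart r D * M * skewPart r D‖ ^ 2 = ∑ q, ∑ u, ∑ p, ∑ v,
      ‖skewPart r D p q‖ ^ 2 * ‖skewPart r D u v‖ ^ 2 * ‖M q u‖ ^ 2 := by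
  rw [Matrix.mul_assoc, norm_skewPart_mul_sq]
  refine Finset.sum_congr rfl fun q _ => ?_
  have h1 : ∑ j, ‖(M * skewPart r D) q j‖ ^ 2 =
      ∑ u, ∑ v, ‖skewPart r D u v‖ ^ 2 * ‖M q u‖ ^ 2 := by
    rw [Finset.sum_comm]
    refine Finset.sum_congr rfl fun j _ => ?_
    rw [Matrix.mul_apply, norm_sum_sq_of_unique]
    · exact Finset.sum_congr rfl fun u _ => by rw [norm_mul, mul_pow, mul_comm]
    · intro u _ u' _ hu hu'
      have h1 : (u : ℕ) + j = r := by
        by_contra hne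
        simp [skewPart_apply, hne] at hu
      have h2 : (u' : ℕ) + j = r := by
        by_contra hne
        simp [skewPart_apply, hne] at hu'
      ext
      omega
  rw [h1, Finset.mul_sum]
  refine Finset.sum_congr rfl fun u _ => ?_
  rw [Finset.sum_mul_sum]
  refine Finset.sum_congr rfl fun p _ => Finset.sum_congr rfl fun v _ => ?_
  ring

theorem sum_sum_ite_add_eq_le (q u : Fin n) (r : ℕ) {x : ℝ} (hx : 0 ≤ x) :
    ∑ p : Fin n, ∑ v : Fin n, (if (p : ℕ) + q = r ∧ (u : ℕ) + v = r then x else 0) ≤ x := by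
  have h : ∀ w : Fin n, ∀ z : ℝ, 0 ≤ z →
      ∑ p : Fin n, (if (p : ℕ) + w = r then z else 0) ≤ z := by
    intro w z hz
    by_cases hw : ∃ p : Fin n, (p : ℕ) + w = r
    · obtain ⟨p, hp⟩ := hw
      rw [Finset.sum_eq_single_of_mem p (Finset.mem_univ _), if_pos hp]
      intro p' _ hne
      rw [if_neg]
      intro h
      exact hne (by ext; omega)
    · push Not at hw
      rw [Finset.sum_eq_zero fun p _ => if_neg (hw p)]
      exact hz
  refine le_trans (Finset.sum_le_sum fun p _ => ?_) (h q x hx)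
  by_cases hp : (p : ℕ) + q = r
  · simp only [hp, true_and, if_true]
    refine le_trans (le_of_eq (Finset.sum_congr rfl fun v _ => ?_)) (h u x hx)
    simp only [add_comm]
  · simp [hp]

/-- The first order term is paired with D along its skew-diagonal, and the second order term is
bounded by Cauchy–Schwarz. The right side involves only D and the resolvent without D, so its
expectation can be computed by independence. -/
theorem norm_trace_mul_green_sub_sq_le (hX : X.IsSymm) (hy : 1 ≤ y) (r : ℕ)
    (S : Matrix (Fin n) (Fin n) ℂ) :
    ‖(S * (green y X - green y (removeSkew r X))).trace‖ ^ 2 ≤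
      2 * (‖skewPart r (green y (removeSkew r X) * S * green y (removeSkew r X))‖ ^ 2 *
        ‖skewPart r (complexify X)‖ ^ 2) +
      2 * ‖S‖ ^ 2 * ‖skewPart r (complexify X) * green y (removeSkew r X) *
        skewPart r (complexify X)‖ ^ 2 := by
  have hy0 : y ≠ 0 := by linarith
  have hXr := isSymm_removeSkew r hX
  set G := green y X with hG
  set Gr := green y (removeSkew r X) with hGr
  set D := skewPart r (complexify X) with hD
  have h1 : S * (G - Gr) = -(S * (Gr * D * Gr)) + S * (Gr * D * Gr * D * G) := by
    have h := green_eq_removeSkew_expansion hX hy0 r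
    rw [← hG, ← hGr, ← hD] at h
    conv_lhs => rw [h]
    rw [← mul_neg, ← mul_add]
    congr 1
    abel
  have h2 : (S * (Gr * D * Gr)).trace = (Gr * S * Gr * D).trace := by
    rw [← Matrix.mul_assoc, ← Matrix.mul_assoc, trace_mul_comm]
    simp only [Matrix.mul_assoc]
  have h3 : ‖(S * (Gr * D * Gr)).trace‖ ≤ ‖skewPart r (Gr * S * Gr)‖ * ‖D‖ := by
    rw [h2]
    exact norm_trace_mul_skewPart_le r _ _
  have h4 : ‖(S * (Gr * D * Gr * D * G)).trace‖ ≤ ‖S‖ * ‖D * Gr * D‖ := by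
    refine (norm_trace_mul_le _ _).trans ?_
    gcongr
    refine (norm_mul_green_le_self hX hy _).trans ?_
    rw [Matrix.mul_assoc, Matrix.mul_assoc Gr, ← Matrix.mul_assoc D]
    exact norm_green_mul_le_self hXr hy _
  rw [h1, trace_add, trace_neg]
  have h5 : ‖-(S * (Gr * D * Gr)).trace + (S * (Gr * D * Gr * D * G)).trace‖ ≤
      ‖skewPart r (Gr * S * Gr)‖ * ‖D‖ + ‖S‖ * ‖D * Gr * D‖ := by
    refine (norm_add_le _ _).trans ?_
    rw [norm_neg]
    exact add_le_add h3 h4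
  refine (pow_le_pow_left₀ (norm_nonneg _) h5 2).trans ?_
  nlinarith [sq_nonneg (‖skewPart r (Gr * S * Gr)‖ * ‖D‖ - ‖S‖ * ‖D * Gr * D‖)]

/-- Returns from the resolvent without D, which varies with `r`, to the full resolvent. This is
needed in order to sum over `r` by orthogonality of the skew parts of one fixed matrix. -/
theorem norm_skewPart_green_sq_le (hX : X.IsSymm) (hy : 1 ≤ y) (r : ℕ)
    (S : Matrix (Fin n) (Fin n) ℂ) :
    ‖skewPart r (green y (removeSkew r X) * S * green y (removeSkew r X))‖ ^ 2 ≤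
      3 * (‖skewPart r (green y X * S * green y X)‖ ^ 2 +
        ‖skewPart r (complexify X) * (green y X * S * green y X)‖ ^ 2 +
        ‖S * green y X * skewPart r (complexify X)‖ ^ 2) := by
  have hy0 : y ≠ 0 := by linarith
  have hXr := isSymm_removeSkew r hX
  have e1 := green_sub_green_removeSkew hX hy0 r
  have e2 := green_sub_green_removeSkew' hX hy0 r
  set G := green y X with hG
  set Gr := green y (removeSkew r X) with hGr
  set D := skewPart r (complexify X) with hD
  have h1 : Gr * S * Gr = G * S * G + (Gr * (D * (G * S * G)) + Gr * (S * G * D) * Gr) := by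
    have h : G * S * G - Gr * S * Gr = (G - Gr) * (S * G) + Gr * S * (G - Gr) := by
      simp only [sub_mul, mul_sub, Matrix.mul_assoc]
      abel
    have h' : (G - Gr) * (S * G) = -(Gr * D * G) * (S * G) := by rw [e2]
    have h'' : Gr * S * (G - Gr) = Gr * S * -(G * D * Gr) := by rw [e1]
    rw [h', h'', sub_eq_iff_eq_add, ← sub_eq_iff_eq_add'] at h
    refine h.symm.trans ?_
    simp only [neg_mul, mul_neg, Matrix.mul_assoc]
    abel
  have h2 : ‖skewPart r (Gr * S * Gr)‖ ≤
      ‖skewPart r (G * S * G)‖ + (‖D * (G * S * G)‖ + ‖S * G * D‖) := by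
    have h3 : skewPart r (Gr * S * Gr) = skewPart r (G * S * G) -
        skewPart r (-(Gr * (D * (G * S * G)) + Gr * (S * G * D) * Gr)) := by
      rw [← skewPart_sub, sub_neg_eq_add, ← h1]
    rw [h3]
    refine (norm_sub_le _ _).trans (add_le_add le_rfl ?_)
    refine (norm_skewPart_le r _).trans ?_
    rw [norm_neg]
    refine (norm_add_le _ _).trans (add_le_add (norm_green_mul_le_self hXr hy _) ?_)
    exact (norm_mul_green_le_self hXr hy _).trans (norm_green_mul_le_self hXr hy _)
  refine (pow_le_pow_left₀ (norm_nonneg _) h2 2).trans ?_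
  set u := ‖skewPart r (G * S * G)‖
  set v := ‖D * (G * S * G)‖
  set w := ‖S * G * D‖
  nlinarith [sq_nonneg (u - v), sq_nonneg (u - w), sq_nonneg (v - w)]

theorem sum_norm_skewPart_green_sq_le (hX : X.IsSymm) (hy : 1 ≤ y) {k : ℝ}
    (hk : ∀ q, ∑ p, ‖complexify X p q‖ ^ 2 ≤ k) (S : Matrix (Fin n) (Fin n) ℂ) :
    ∑ r ∈ Finset.range (2 * n),
      ‖skewPart r (green y (removeSkew r X) * S * green y (removeSkew r X))‖ ^ 2 ≤
      3 * (1 + 2 * k) * ‖S‖ ^ 2 := by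
  by_cases hn : n = 0
  · subst hn
    have : ∀ A : Matrix (Fin 0) (Fin 0) ℂ, ‖A‖ = 0 := fun A => by
      rw [Subsingleton.elim A 0, norm_zero]
    simp [this]
  have hk0 : 0 ≤ k := le_trans (by positivity) (hk ⟨0, Nat.pos_of_ne_zero hn⟩)
  have hk' : ∀ p, ∑ q, ‖complexify X p q‖ ^ 2 ≤ k := fun p => by
    refine le_trans (le_of_eq (Finset.sum_congr rfl fun q _ => ?_)) (hk p)
    rw [complexify_apply, complexify_apply, hX.apply p q]
  have h1 : ‖green y X * S * green y X‖ ≤ ‖S‖ :=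
    (norm_mul_green_le_self hX hy _).trans (norm_green_mul_le_self hX hy _)
  have h2 : ‖S * green y X‖ ≤ ‖S‖ := norm_mul_green_le_self hX hy _
  have h3 := sum_norm_skewPart_mul_sq_le hk (green y X * S * green y X)
  have h4 := sum_norm_mul_skewPart_sq_le hk' (S * green y X)
  have h5 : ‖green y X * S * green y X‖ ^ 2 ≤ ‖S‖ ^ 2 := pow_le_pow_left₀ (norm_nonneg _) h1 2
  have h6 : ‖S * green y X‖ ^ 2 ≤ ‖S‖ ^ 2 := pow_le_pow_left₀ (norm_nonneg _) h2 2
  have h7 : k * ‖green y X * S * green y X‖ ^ 2 ≤ k * ‖S‖ ^ 2 := by gcongr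
  have h8 : k * ‖S * green y X‖ ^ 2 ≤ k * ‖S‖ ^ 2 := by gcongr
  refine (Finset.sum_le_sum fun r _ => norm_skewPart_green_sq_le hX hy r S).trans ?_
  rw [← Finset.mul_sum, Finset.sum_add_distrib, Finset.sum_add_distrib, sum_norm_skewPart_sq]
  linarith

/-- A pathwise bound. The first order terms are at most K ‖skewPart r (G²)‖, and these norms have
square sum at most n; each of the 2n remainders is at most K². Since K ≥ 1, the total 2nK² + 4nK⁴ is
at most 6nK⁴. -/
theorem sum_norm_trace_green_sub_sq_le (hX : X.IsSymm) (hy : 1 ≤ y) {K : ℝ} (hK : 1 ≤ K)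
    (hXK : ∀ p q, ‖complexify X p q‖ ≤ K / √(n : ℝ)) :
    ∑ r ∈ Finset.range (2 * n), ‖(green y X - green y (removeSkew r X)).trace‖ ^ 2 ≤
      6 * n * K ^ 4 := by
  have hy0 : y ≠ 0 := by linarith
  have hK0 : 0 ≤ K := zero_le_one.trans hK
  have hκ : 0 ≤ K / √(n : ℝ) := by positivity
  by_cases hn : n = 0
  · subst hn
    simp
  have hn' : (0 : ℝ) < n := by exact_mod_cast Nat.pos_of_ne_zero hn
  have hs : 0 < √(n : ℝ) := Real.sqrt_pos.2 hn'
  have hss : √(n : ℝ) ^ 2 = n := Real.sq_sqrt hn'.le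
  have key : ∀ r, ‖(green y X - green y (removeSkew r X)).trace‖ ^ 2 ≤
      2 * K ^ 2 * ‖skewPart r (green y X * green y X)‖ ^ 2 + 2 * K ^ 4 := by
    intro r
    have hXr := isSymm_removeSkew r hX
    have e1 := green_sub_green_removeSkew hX hy0 r
    set G := green y X with hG
    set Gr := green y (removeSkew r X) with hGr
    set D := skewPart r (complexify X) with hD
    have h1 : G - Gr = -(G * D * G) - G * D * (G * D * Gr) := by
      have e3 : Gr = G + G * D * Gr := by
        rw [← neg_eq_iff_eq_neg] at e1
        rw [← e1]
        abel
      rw [e1]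
      conv_lhs => rw [e3]
      rw [mul_add, neg_add]
      abel
    have hDn : ‖D‖ ≤ K := by
      have h := norm_skewPart_mul_le r hκ hXK 1
      rwa [mul_one, norm_one_fin, div_mul_cancel₀ _ hs.ne'] at h
    have h2 : ‖(G * D * G).trace‖ ≤ ‖skewPart r (G * G)‖ * K := by
      have h3 : (G * D * G).trace = (G * G * D).trace := by
        rw [trace_mul_comm, Matrix.mul_assoc]
      rw [h3]
      refine (norm_trace_mul_skewPart_le r _ _).trans ?_
      gcongr
    have h4 : ‖(G * D * (G * D * Gr)).trace‖ ≤ K ^ 2 := by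
      have h5 := norm_trace_mul_le 1 (G * D * (G * D * Gr))
      rw [one_mul, norm_one_fin] at h5
      have h6 : ‖G * D * (G * D * Gr)‖ ≤ K / √(n : ℝ) * (K / √(n : ℝ) * √(n : ℝ)) := by
        rw [Matrix.mul_assoc]
        refine (norm_green_mul_le_self hX hy _).trans ?_
        refine (norm_skewPart_mul_le r hκ hXK _).trans ?_
        gcongr
        rw [Matrix.mul_assoc]
        refine (norm_green_mul_le_self hX hy _).trans ?_
        refine (norm_skewPart_mul_le r hκ hXK _).trans ?_
        gcongr
        exact norm_green_le_sqrt hXr hy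
      refine h5.trans ?_
      calc √(n : ℝ) * ‖G * D * (G * D * Gr)‖
          ≤ √(n : ℝ) * (K / √(n : ℝ) * (K / √(n : ℝ) * √(n : ℝ))) := by gcongr
        _ = K ^ 2 := by field_simp
    rw [h1, trace_sub, trace_neg]
    have h5 : ‖-(G * D * G).trace - (G * D * (G * D * Gr)).trace‖ ≤
        ‖skewPart r (G * G)‖ * K + K ^ 2 := by
      refine (norm_sub_le _ _).trans ?_
      rw [norm_neg]
      exact add_le_add h2 h4
    refine (pow_le_pow_left₀ (norm_nonneg _) h5 2).trans ?_
    nlinarith [sq_nonneg (‖skewPart r (G * G)‖ * K - K ^ 2)]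
  refine (Finset.sum_le_sum fun r _ => key r).trans ?_
  rw [Finset.sum_add_distrib, ← Finset.mul_sum, sum_norm_skewPart_sq]
  have h1 : ‖green y X * green y X‖ ^ 2 ≤ n := by
    rw [← hss]
    exact pow_le_pow_left₀ (norm_nonneg _)
      ((norm_green_mul_le_self hX hy _).trans (norm_green_le_sqrt hX hy)) 2
  have h2 : K ^ 2 ≤ K ^ 4 := pow_le_pow_right₀ hK (by norm_num)
  have h3 : 2 * K ^ 2 * ‖green y X * green y X‖ ^ 2 ≤ 2 * K ^ 4 * n := by gcongr
  rw [Finset.sum_const, Finset.card_range, nsmul_eq_mul]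
  push_cast
  linarith

end ResolventPerturbation

/-! ### Efron–Stein for complex-valued functions -/

section ComplexEfronStein

variable {Ω E : Type*} [MeasurableSpace Ω] [MeasurableSpace E] {P : Measure Ω}
  [IsProbabilityMeasure P] {N : ℕ} {Y : Fin N → Ω → E}

theorem integral_norm_sub_sq_le_of_indep (hY : ∀ i, Measurable (Y i)) (hind : iIndepFun Y P)
    {f : (Fin N → E) → ℂ} {h : Fin N → (Fin N → E) → ℂ} {B : ℝ}
    (hf : Measurable f) (hfB : ∀ x, ‖f x‖ ≤ B) (hh : ∀ i, Measurable (h i))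
    (hhB : ∀ i x, ‖h i x‖ ≤ B) (hup : ∀ i x e, h i (Function.update x i e) = h i x) :
    ∫ ω, ‖f (fun i => Y i ω) - ∫ ω, f (fun i => Y i ω) ∂P‖ ^ 2 ∂P ≤
      ∑ i, ∫ ω, ‖f (fun i => Y i ω) - h i (fun i => Y i ω)‖ ^ 2 ∂P := by
  have hYm : Measurable fun ω i => Y i ω := measurable_pi_lambda _ hY
  have hfi : Integrable (fun ω => f fun i => Y i ω) P :=
    Integrable.of_bound (hf.comp hYm).aestronglyMeasurable B (Eventually.of_forall fun ω => hfB _)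
  set c : ℂ := ∫ ω, f (fun i => Y i ω) ∂P with hc
  have hcB : ‖c‖ ≤ B := by
    have := norm_integral_le_of_norm_le_const (μ := P) (f := fun ω => f fun i => Y i ω) (C := B)
      (Eventually.of_forall fun ω => hfB _)
    simpa using this
  have hsplit : ∀ w : ℂ, ‖w‖ ^ 2 = w.re ^ 2 + w.im ^ 2 := fun w => by
    rw [← Complex.normSq_eq_norm_sq, Complex.normSq_apply]
    ring
  have hre := variance_comp_le hY hind (f := fun x => (f x).re) (h := fun i x => (h i x).re)
    (B := B) (Complex.measurable_re.comp hf) (fun x => (Complex.abs_re_le_norm _).trans (hfB x))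
    (fun i => Complex.measurable_re.comp (hh i))
    (fun i x => (Complex.abs_re_le_norm _).trans (hhB i x)) (fun i x e => by simp only [hup])
  have him := variance_comp_le hY hind (f := fun x => (f x).im) (h := fun i x => (h i x).im)
    (B := B) (Complex.measurable_im.comp hf) (fun x => (Complex.abs_im_le_norm _).trans (hfB x))
    (fun i => Complex.measurable_im.comp (hh i))
    (fun i x => (Complex.abs_im_le_norm _).trans (hhB i x)) (fun i x e => by simp only [hup])
  have hcre : ∫ ω, (f fun i => Y i ω).re ∂P = c.re := integral_re hfi
  have hcim : ∫ ω, (f fun i => Y i ω).im ∂P = c.im := integral_im hfi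
  have ire : ∀ {g : Ω → ℂ} {b : ℝ}, Measurable g → (∀ ω, ‖g ω‖ ≤ b) →
      Integrable (fun ω => (g ω).re ^ 2) P := fun hg hb =>
    integrable_sq_of_abs_le (Complex.measurable_re.comp hg) fun ω =>
      (Complex.abs_re_le_norm _).trans (hb ω)
  have iim : ∀ {g : Ω → ℂ} {b : ℝ}, Measurable g → (∀ ω, ‖g ω‖ ≤ b) →
      Integrable (fun ω => (g ω).im ^ 2) P := fun hg hb =>
    integrable_sq_of_abs_le (Complex.measurable_im.comp hg) fun ω =>
      (Complex.abs_im_le_norm _).trans (hb ω)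
  have hfm : Measurable fun ω => f fun i => Y i ω := hf.comp hYm
  have hdm : ∀ i, Measurable fun ω => f (fun i => Y i ω) - h i (fun i => Y i ω) := fun i =>
    hfm.sub ((hh i).comp hYm)
  have hdB : ∀ i ω, ‖f (fun i => Y i ω) - h i (fun i => Y i ω)‖ ≤ B + B := fun i ω =>
    (norm_sub_le _ _).trans (add_le_add (hfB _) (hhB _ _))
  have hcm : Measurable fun ω => f (fun i => Y i ω) - c := hfm.sub_const c
  have hcB' : ∀ ω, ‖f (fun i => Y i ω) - c‖ ≤ B + B := fun ω =>
    (norm_sub_le _ _).trans (add_le_add (hfB _) hcB)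
  simp only [hsplit]
  rw [integral_add (ire hcm hcB') (iim hcm hcB')]
  have hsum : ∀ i, ∫ ω, ((f (fun i => Y i ω) - h i (fun i => Y i ω)).re ^ 2 +
      (f (fun i => Y i ω) - h i (fun i => Y i ω)).im ^ 2) ∂P =
      ∫ ω, (f (fun i => Y i ω) - h i (fun i => Y i ω)).re ^ 2 ∂P +
      ∫ ω, (f (fun i => Y i ω) - h i (fun i => Y i ω)).im ^ 2 ∂P := fun i =>
    integral_add (ire (hdm i) (hdB i)) (iim (hdm i) (hdB i))
  simp only [hsum]
  rw [Finset.sum_add_distrib]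
  simp only [Complex.sub_re, Complex.sub_im]
  rw [hcre] at hre
  rw [hcim] at him
  have e1 := integral_sub_const_sq (P := P) (f := fun ω => (f fun i => Y i ω).re)
    hfi.re (ire hfm fun ω => hfB _) c.re
  have e2 := integral_sub_const_sq (P := P) (f := fun ω => (f fun i => Y i ω).im)
    hfi.im (iim hfm fun ω => hfB _) c.im
  rw [hcre] at e1
  rw [hcim] at e2
  refine add_le_add (e1.trans_le ?_) (e2.trans_le ?_)
  · linarith
  · linarith

theorem integral_norm_sub_pow_four_le_of_indep (hY : ∀ i, Measurable (Y i)) (hind : iIndepFun Y P)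
    {f : (Fin N → E) → ℂ} {h : Fin N → (Fin N → E) → ℂ} {B : ℝ}
    (hf : Measurable f) (hfB : ∀ x, ‖f x‖ ≤ B) (hh : ∀ i, Measurable (h i))
    (hhB : ∀ i x, ‖h i x‖ ≤ B) (hup : ∀ i x e, h i (Function.update x i e) = h i x) :
    ∫ ω, ‖f (fun i => Y i ω) - ∫ ω, f (fun i => Y i ω) ∂P‖ ^ 4 ∂P ≤
      280 * ∫ ω, (∑ i, ‖f (fun i => Y i ω) - h i (fun i => Y i ω)‖ ^ 2) ^ 2 ∂P := by
  have hYm : Measurable fun ω i => Y i ω := measurable_pi_lambda _ hY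
  have hfi : Integrable (fun ω => f fun i => Y i ω) P :=
    Integrable.of_bound (hf.comp hYm).aestronglyMeasurable B (Eventually.of_forall fun ω => hfB _)
  set c : ℂ := ∫ ω, f (fun i => Y i ω) ∂P with hc
  have hcB : ‖c‖ ≤ B := by
    have := norm_integral_le_of_norm_le_const (μ := P) (f := fun ω => f fun i => Y i ω) (C := B)
      (Eventually.of_forall fun ω => hfB _)
    simpa using this
  have hsplit : ∀ w : ℂ, ‖w‖ ^ 2 = w.re ^ 2 + w.im ^ 2 := fun w => by
    rw [← Complex.normSq_eq_norm_sq, Complex.normSq_apply]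
    ring
  have hre := fourth_moment_comp_le hY hind (f := fun x => (f x).re) (h := fun i x => (h i x).re)
    (B := B) (Complex.measurable_re.comp hf) (fun x => (Complex.abs_re_le_norm _).trans (hfB x))
    (fun i => Complex.measurable_re.comp (hh i))
    (fun i x => (Complex.abs_re_le_norm _).trans (hhB i x)) (fun i x e => by simp only [hup])
  have him := fourth_moment_comp_le hY hind (f := fun x => (f x).im) (h := fun i x => (h i x).im)
    (B := B) (Complex.measurable_im.comp hf) (fun x => (Complex.abs_im_le_norm _).trans (hfB x))
    (fun i => Complex.measurable_im.comp (hh i))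
    (fun i x => (Complex.abs_im_le_norm _).trans (hhB i x)) (fun i x e => by simp only [hup])
  have hcre : ∫ ω, (f fun i => Y i ω).re ∂P = c.re := integral_re hfi
  have hcim : ∫ ω, (f fun i => Y i ω).im ∂P = c.im := integral_im hfi
  rw [hcre] at hre
  rw [hcim] at him
  have hfm : Measurable fun ω => f fun i => Y i ω := hf.comp hYm
  have hcm : Measurable fun ω => f (fun i => Y i ω) - c := hfm.sub_const c
  have hcB' : ∀ ω, ‖f (fun i => Y i ω) - c‖ ≤ B + B := fun ω =>
    (norm_sub_le _ _).trans (add_le_add (hfB _) hcB)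
  have h4 : ∀ {g : Ω → ℝ}, Measurable g → (∀ ω, |g ω| ≤ B + B) →
      Integrable (fun ω => g ω ^ 4) P := fun hg hb =>
    integrable_of_abs_le (B := (B + B) ^ 4) (hg.pow_const 4) fun ω => by
      rw [abs_pow]
      exact pow_le_pow_left₀ (abs_nonneg _) (hb ω) 4
  have ire : Integrable (fun ω => (f (fun i => Y i ω) - c).re ^ 4) P :=
    h4 (Complex.measurable_re.comp hcm) fun ω => (Complex.abs_re_le_norm _).trans (hcB' ω)
  have iim : Integrable (fun ω => (f (fun i => Y i ω) - c).im ^ 4) P :=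
    h4 (Complex.measurable_im.comp hcm) fun ω => (Complex.abs_im_le_norm _).trans (hcB' ω)
  set V : Ω → ℝ := fun ω => ∑ i, ‖f (fun i => Y i ω) - h i (fun i => Y i ω)‖ ^ 2 with hV
  have hVm : Measurable V := Finset.measurable_fun_sum _ fun i _ =>
    (hfm.sub ((hh i).comp hYm)).norm.pow_const 2
  have hVB : ∀ ω, |V ω| ≤ N * (B + B) ^ 2 := fun ω => by
    rw [abs_of_nonneg (Finset.sum_nonneg fun i _ => by positivity)]
    refine (Finset.sum_le_sum fun i _ => pow_le_pow_left₀ (norm_nonneg _)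
      ((norm_sub_le _ _).trans (add_le_add (hfB _) (hhB _ _))) 2).trans_eq ?_
    simp
  have hV2 : Integrable (fun ω => V ω ^ 2) P := integrable_sq_of_abs_le hVm hVB
  have kre : ∫ ω, (∑ i, ((f fun i => Y i ω).re - (h i fun i => Y i ω).re) ^ 2) ^ 2 ∂P ≤
      ∫ ω, V ω ^ 2 ∂P := by
    refine integral_mono_of_nonneg (Eventually.of_forall fun ω => sq_nonneg _) hV2
      (Eventually.of_forall fun ω => pow_le_pow_left₀
        (Finset.sum_nonneg fun i _ => sq_nonneg _) (Finset.sum_le_sum fun i _ => ?_) 2)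
    rw [hsplit, Complex.sub_re]
    linarith [sq_nonneg (f (fun i => Y i ω) - h i fun i => Y i ω).im]
  have kim : ∫ ω, (∑ i, ((f fun i => Y i ω).im - (h i fun i => Y i ω).im) ^ 2) ^ 2 ∂P ≤
      ∫ ω, V ω ^ 2 ∂P := by
    refine integral_mono_of_nonneg (Eventually.of_forall fun ω => sq_nonneg _) hV2
      (Eventually.of_forall fun ω => pow_le_pow_left₀
        (Finset.sum_nonneg fun i _ => sq_nonneg _) (Finset.sum_le_sum fun i _ => ?_) 2)
    rw [hsplit, Complex.sub_im]
    linarith [sq_nonneg (f (fun i => Y i ω) - h i fun i => Y i ω).re]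
  -- The inequality |w|⁴ ≤ 2 (Re w)⁴ + 2 (Im w)⁴ reduces to the real case; two parts with constant 2
  -- · 70 each make 280.
  have hle : ∫ ω, ‖f (fun i => Y i ω) - c‖ ^ 4 ∂P ≤
      ∫ ω, (2 * (f (fun i => Y i ω) - c).re ^ 4 + 2 * (f (fun i => Y i ω) - c).im ^ 4) ∂P := by
    refine integral_mono_of_nonneg (Eventually.of_forall fun ω => by positivity)
      ((ire.const_mul 2).add (iim.const_mul 2)) (Eventually.of_forall fun ω => ?_)
    have e : ‖f (fun i => Y i ω) - c‖ ^ 4 = (‖f (fun i => Y i ω) - c‖ ^ 2) ^ 2 := by ring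
    simp only
    rw [e, hsplit]
    nlinarith [sq_nonneg ((f (fun i => Y i ω) - c).re ^ 2 - (f (fun i => Y i ω) - c).im ^ 2)]
  rw [integral_add (ire.const_mul 2) (iim.const_mul 2), integral_const_mul,
    integral_const_mul] at hle
  simp only [Complex.sub_re, Complex.sub_im] at hle
  linarith

end ComplexEfronStein

/-! ### Expectations of quadratic expressions in one skew-diagonal -/

section Variance

open scoped Matrix.Norms.Frobenius
open Matrix

variable {Ω : Type*} {n : ℕ}

theorem norm_skewPart_ensembleMatrix_mul_le (a : Fin n → Fin n → Ω → ℝ) (ω : Ω) (r : ℕ)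
    (A : Matrix (Fin n) (Fin n) ℂ) : ‖skewPart r (complexify (ensembleMatrix a ω)) * A‖ ≤
      entryBound a ω / √(n : ℝ) * ‖A‖ :=
  norm_skewPart_mul_le r (div_nonneg (zero_le_one.trans (one_le_entryBound a ω))
    (Real.sqrt_nonneg _)) (norm_complexify_ensembleMatrix_le a ω) A

theorem norm_skewPart_ensembleMatrix_le (a : Fin n → Fin n → Ω → ℝ) (ω : Ω) (r : ℕ) :
    ‖skewPart r (complexify (ensembleMatrix a ω))‖ ≤ entryBound a ω := by
  have h := norm_skewPart_ensembleMatrix_mul_le a ω r 1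
  rw [mul_one, norm_one_fin] at h
  rw [div_mul_eq_mul_div] at h
  exact h.trans (div_le_of_le_mul₀ (Real.sqrt_nonneg _)
    (zero_le_one.trans (one_le_entryBound a ω)) le_rfl)

theorem norm_entry_le_norm (A : Matrix (Fin n) (Fin n) ℂ) (p q : Fin n) : ‖A p q‖ ≤ ‖A‖ := by
  refine abs_le_of_sq_le_sq' ?_ (norm_nonneg _) |>.2
  rw [frobenius_norm_sq]
  refine le_trans ?_ (Finset.single_le_sum (f := fun p => ∑ q, ‖A p q‖ ^ 2)
    (fun i _ => Finset.sum_nonneg fun j _ => by positivity) (Finset.mem_univ p))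
  exact Finset.single_le_sum (f := fun q => ‖A p q‖ ^ 2)
    (fun i _ => by positivity) (Finset.mem_univ q)

namespace IsSkewEnsemble

variable [MeasurableSpace Ω] {P : Measure Ω} {a : Fin n → Fin n → Ω → ℝ} (h : IsSkewEnsemble P a)
include h

theorem measurable_complexify (p q : Fin n) :
    Measurable fun ω => complexify (ensembleMatrix a ω) p q :=
  Complex.measurable_ofReal.comp (h.measurable_ensembleMatrix p q)

theorem measurable_green (y : ℝ) (p q : Fin n) :
    Measurable fun ω => green y (ensembleMatrix a ω) p q :=
  _root_.measurable_green h.measurable_ensembleMatrix y p q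

theorem measurable_green_removeSkew (y : ℝ) (r : ℕ) (p q : Fin n) :
    Measurable fun ω => green y (removeSkew r (ensembleMatrix a ω)) p q :=
  _root_.measurable_green (h.measurable_removeSkew r) y p q

theorem integral_mul_skewPart_removeSkew {𝕜 : Type*} [RCLike 𝕜] (r : Fin (2 * n))
    {φ ψ : (Fin n → Fin n → ℝ) → 𝕜} (hφ : Measurable φ) (hψ : Measurable ψ) :
    ∫ ω, φ (fun p q => skewPart r (ensembleMatrix a ω) p q) *
        ψ (fun p q => removeSkew r (ensembleMatrix a ω) p q) ∂P =
      (∫ ω, φ (fun p q => skewPart r (ensembleMatrix a ω) p q) ∂P) *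
        ∫ ω, ψ (fun p q => removeSkew r (ensembleMatrix a ω) p q) ∂P :=
  (h.indepFun_skewPart_removeSkew r).integral_fun_comp_mul_comp
    (measurable_pi_lambda _ fun p => measurable_pi_lambda _ fun q =>
      measurable_skewPart h.measurable_ensembleMatrix r p q).aemeasurable
    (measurable_pi_lambda _ fun p => measurable_pi_lambda _ fun q =>
      h.measurable_removeSkew r p q).aemeasurable
    hφ.aestronglyMeasurable hψ.aestronglyMeasurable

theorem integral_norm_entry_sq (p q : Fin n) :
    ∫ ω, ‖complexify (ensembleMatrix a ω) p q‖ ^ 2 ∂P = (n : ℝ)⁻¹ := by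
  have e : ∀ ω, ‖complexify (ensembleMatrix a ω) p q‖ ^ 2 = (n : ℝ)⁻¹ * symmEntry a p q ω ^ 2 :=
    fun ω => by
      rw [complexify_apply, Complex.norm_real, Real.norm_eq_abs, sq_abs, ensembleMatrix_apply,
        mul_pow, div_pow, one_pow, Real.sq_sqrt (by positivity), one_div]
  simp only [e]
  rw [integral_const_mul, h.integral_symmEntry_sq, mul_one]

variable [IsProbabilityMeasure P]

theorem integrable_of_norm_le {E : Type*} [NormedAddCommGroup E] {f : Ω → E}
    (hf : AEStronglyMeasurable f P) (k : ℕ) (C : ℝ) (hC : ∀ ω, ‖f ω‖ ≤ C * entryBound a ω ^ k) :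
    Integrable f P :=
  ((h.integrable_entryBound_pow k).const_mul C).mono' hf (Eventually.of_forall hC)

theorem integral_norm_entry_sq_mul_le {M : ℝ} (hM : ∀ p q, p ≤ q → ∫ ω, |a p q ω| ^ 4 ∂P ≤ M)
    (p q u v : Fin n) : ∫ ω, ‖complexify (ensembleMatrix a ω) p q‖ ^ 2 *
      ‖complexify (ensembleMatrix a ω) u v‖ ^ 2 ∂P ≤ (n : ℝ)⁻¹ ^ 2 * M := by
  have e : ∀ p q ω, ‖complexify (ensembleMatrix a ω) p q‖ ^ 2 =
      (n : ℝ)⁻¹ * symmEntry a p q ω ^ 2 := fun p q ω => by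
    rw [complexify_apply, Complex.norm_real, Real.norm_eq_abs, sq_abs, ensembleMatrix_apply,
      mul_pow, div_pow, one_pow, Real.sq_sqrt (by positivity), one_div]
  have i1 := (h.integrable_symmEntry_pow 4 p q).const_mul ((n : ℝ)⁻¹ ^ 2 / 2)
  have i2 := (h.integrable_symmEntry_pow 4 u v).const_mul ((n : ℝ)⁻¹ ^ 2 / 2)
  have hle : ∫ ω, ‖complexify (ensembleMatrix a ω) p q‖ ^ 2 *
      ‖complexify (ensembleMatrix a ω) u v‖ ^ 2 ∂P ≤
      ∫ ω, ((n : ℝ)⁻¹ ^ 2 / 2 * |symmEntry a p q ω| ^ 4 +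
        (n : ℝ)⁻¹ ^ 2 / 2 * |symmEntry a u v ω| ^ 4) ∂P := by
    refine integral_mono_of_nonneg (Eventually.of_forall fun ω => by positivity) (i1.add i2)
      (Eventually.of_forall fun ω => ?_)
    simp only [e]
    rw [Even.pow_abs (by decide), Even.pow_abs (by decide)]
    have := sq_nonneg ((n : ℝ)⁻¹ * (symmEntry a p q ω ^ 2 - symmEntry a u v ω ^ 2))
    linarith
  rw [integral_add i1 i2, integral_const_mul, integral_const_mul] at hle
  have h1 : ∫ ω, |symmEntry a p q ω| ^ 4 ∂P ≤ M := hM _ _ min_le_max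
  have h2 : ∫ ω, |symmEntry a u v ω| ^ 4 ∂P ≤ M := hM _ _ min_le_max
  have h3 : (n : ℝ)⁻¹ ^ 2 / 2 * ∫ ω, |symmEntry a p q ω| ^ 4 ∂P ≤ (n : ℝ)⁻¹ ^ 2 / 2 * M := by gcongr
  have h4 : (n : ℝ)⁻¹ ^ 2 / 2 * ∫ ω, |symmEntry a u v ω| ^ 4 ∂P ≤ (n : ℝ)⁻¹ ^ 2 / 2 * M := by gcongr
  linarith

/-- A skew-diagonal has at most n entries, each of mean square 1/n. -/
theorem integral_norm_skewPart_sq_le (r : ℕ) :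
    ∫ ω, ‖skewPart r (complexify (ensembleMatrix a ω))‖ ^ 2 ∂P ≤ 1 := by
  have hi : ∀ p q, Integrable (fun ω => ‖skewPart r (complexify (ensembleMatrix a ω)) p q‖ ^ 2) P :=
    fun p q => by
      refine h.integrable_of_norm_le
        ((measurable_skewPart h.measurable_complexify r p q).norm.pow_const 2).aestronglyMeasurable
        2 1 fun ω => ?_
      rw [norm_pow, norm_norm, one_mul]
      gcongr
      exact (norm_entry_le_norm _ p q).trans (norm_skewPart_ensembleMatrix_le a ω r)
  simp only [frobenius_norm_sq]
  rw [integral_finsetSum _ fun p _ => integrable_finsetSum _ fun q _ => hi p q]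
  have h1 : ∀ p, ∫ ω, ∑ q, ‖skewPart r (complexify (ensembleMatrix a ω)) p q‖ ^ 2 ∂P ≤
      (n : ℝ)⁻¹ := by
    intro p
    rw [integral_finsetSum _ fun q _ => hi p q]
    have h2 : ∀ q : Fin n, ∫ ω, ‖skewPart r (complexify (ensembleMatrix a ω)) p q‖ ^ 2 ∂P =
        if (p : ℕ) + q = r then (n : ℝ)⁻¹ else 0 := fun q => by
      simp only [skewPart_apply]
      split_ifs
      · exact h.integral_norm_entry_sq p q
      · simp
    simp only [h2]
    by_cases hq : ∃ q : Fin n, (p : ℕ) + q = r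
    · obtain ⟨q, hq⟩ := hq
      rw [Finset.sum_eq_single_of_mem q (Finset.mem_univ _), if_pos hq]
      intro q' _ hne
      rw [if_neg]
      intro h'
      exact hne (by ext; omega)
    · push Not at hq
      rw [Finset.sum_eq_zero fun q _ => if_neg (hq q)]
      positivity
  refine (Finset.sum_le_sum fun p _ => h1 p).trans ?_
  rw [Finset.sum_const, Finset.card_univ, Fintype.card_fin, nsmul_eq_mul]
  exact mul_inv_le_one

/-- Each entry of D Gr D is a single product, and by independence its mean square factorises. The
factor from D is at most M/n², each pair (q,u) determines p and v, and ‖Gr‖² ≤ n; hence M/n. -/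
theorem integral_norm_skewPart_mul_green_mul_skewPart_sq_le {M : ℝ} (hM0 : 0 ≤ M)
    (hM : ∀ p q, p ≤ q → ∫ ω, |a p q ω| ^ 4 ∂P ≤ M) {y : ℝ} (hy : 1 ≤ y) (r : Fin (2 * n)) :
    ∫ ω, ‖skewPart r (complexify (ensembleMatrix a ω)) *
      green y (removeSkew r (ensembleMatrix a ω)) *
      skewPart r (complexify (ensembleMatrix a ω))‖ ^ 2 ∂P ≤ (n : ℝ)⁻¹ * M := by
  have hDm := measurable_skewPart h.measurable_complexify (r : ℕ)
  have hGm := h.measurable_green_removeSkew y r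
  have hGn : ∀ ω, ‖green y (removeSkew r (ensembleMatrix a ω))‖ ^ 2 ≤ n := fun ω => by
    have := pow_le_pow_left₀ (norm_nonneg _)
      (norm_green_le_sqrt (isSymm_removeSkew r (isSymm_ensembleMatrix a ω)) hy) 2
    rwa [Real.sq_sqrt (by positivity)] at this
  have hi : ∀ q u p v, Integrable (fun ω =>
      ‖skewPart r (complexify (ensembleMatrix a ω)) p q‖ ^ 2 *
      ‖skewPart r (complexify (ensembleMatrix a ω)) u v‖ ^ 2 *
      ‖green y (removeSkew r (ensembleMatrix a ω)) q u‖ ^ 2) P := by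
    intro q u p v
    refine h.integrable_of_norm_le ((((hDm p q).norm.pow_const 2).mul
      ((hDm u v).norm.pow_const 2)).mul ((hGm q u).norm.pow_const 2)).aestronglyMeasurable
      4 n fun ω => ?_
    have hD : ∀ p q, ‖skewPart r (complexify (ensembleMatrix a ω)) p q‖ ≤ entryBound a ω :=
      fun p q => (norm_entry_le_norm _ p q).trans (norm_skewPart_ensembleMatrix_le a ω r)
    have hG : ‖green y (removeSkew r (ensembleMatrix a ω)) q u‖ ^ 2 ≤ n :=
      (pow_le_pow_left₀ (norm_nonneg _) (norm_entry_le_norm _ q u) 2).trans (hGn ω)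
    rw [Real.norm_of_nonneg (by positivity)]
    calc _ ≤ entryBound a ω ^ 2 * entryBound a ω ^ 2 * n := by
          gcongr
          · exact hD p q
          · exact hD u v
      _ = n * entryBound a ω ^ 4 := by ring
  have hg : ∀ q u, Integrable (fun ω =>
      ‖green y (removeSkew r (ensembleMatrix a ω)) q u‖ ^ 2) P := fun q u => by
    refine integrable_of_abs_le (B := n) ((hGm q u).norm.pow_const 2) fun ω => ?_
    rw [abs_of_nonneg (by positivity)]
    exact (pow_le_pow_left₀ (norm_nonneg _) (norm_entry_le_norm _ q u) 2).trans (hGn ω)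
  have key : ∀ q u p v, ∫ ω, ‖skewPart r (complexify (ensembleMatrix a ω)) p q‖ ^ 2 *
      ‖skewPart r (complexify (ensembleMatrix a ω)) u v‖ ^ 2 *
      ‖green y (removeSkew r (ensembleMatrix a ω)) q u‖ ^ 2 ∂P ≤
      if (p : ℕ) + q = r ∧ (u : ℕ) + v = r then (n : ℝ)⁻¹ ^ 2 * M *
        ∫ ω, ‖green y (removeSkew r (ensembleMatrix a ω)) q u‖ ^ 2 ∂P else 0 := by
    intro q u p v
    have hind := h.integral_mul_skewPart_removeSkew (𝕜 := ℝ) r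
      (φ := fun e => ‖((e p q : ℝ) : ℂ)‖ ^ 2 * ‖((e u v : ℝ) : ℂ)‖ ^ 2)
      (ψ := fun e => ‖green y (Matrix.of e) q u‖ ^ 2)
      (by fun_prop) ((_root_.measurable_green (A := fun e : Fin n → Fin n → ℝ => Matrix.of e)
        (fun p q => by simp only [Matrix.of_apply]; fun_prop) y q u).norm.pow_const 2)
    have e1 : ∀ ω p q, ((skewPart r (ensembleMatrix a ω) p q : ℝ) : ℂ) =
        skewPart r (complexify (ensembleMatrix a ω)) p q := fun ω p q => by
      rw [← complexify_skewPart, complexify_apply]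
    simp only [e1] at hind
    refine hind.trans_le ?_
    split_ifs with hc
    · refine mul_le_mul_of_nonneg_right ?_ (integral_nonneg fun ω => by positivity)
      simp only [skewPart_apply, hc, if_true]
      exact h.integral_norm_entry_sq_mul_le hM p q u v
    · rw [not_and_or] at hc
      refine le_of_eq ?_
      rcases hc with hc | hc <;> simp [skewPart_apply, hc]
  simp only [norm_skewPart_mul_mul_skewPart_sq]
  rw [integral_finsetSum _ fun q _ => integrable_finsetSum _ fun u _ => integrable_finsetSum _
    fun p _ => integrable_finsetSum _ fun v _ => hi q u p v]
  have step : ∀ q u, ∫ ω, ∑ p, ∑ v, ‖skewPart r (complexify (ensembleMatrix a ω)) p q‖ ^ 2 *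
      ‖skewPart r (complexify (ensembleMatrix a ω)) u v‖ ^ 2 *
      ‖green y (removeSkew r (ensembleMatrix a ω)) q u‖ ^ 2 ∂P ≤
      (n : ℝ)⁻¹ ^ 2 * M * ∫ ω, ‖green y (removeSkew r (ensembleMatrix a ω)) q u‖ ^ 2 ∂P := by
    intro q u
    rw [integral_finsetSum _ fun p _ => integrable_finsetSum _ fun v _ => hi q u p v]
    refine le_trans (Finset.sum_le_sum fun p _ => ?_) (sum_sum_ite_add_eq_le q u r
      (mul_nonneg (by positivity) (integral_nonneg fun ω => by positivity)))
    rw [integral_finsetSum _ fun v _ => hi q u p v]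
    exact Finset.sum_le_sum fun v _ => key q u p v
  have step2 : ∑ q, ∑ u, ∫ ω, ‖green y (removeSkew r (ensembleMatrix a ω)) q u‖ ^ 2 ∂P ≤ n := by
    have e : ∑ q, ∑ u, ∫ ω, ‖green y (removeSkew r (ensembleMatrix a ω)) q u‖ ^ 2 ∂P =
        ∫ ω, ‖green y (removeSkew r (ensembleMatrix a ω))‖ ^ 2 ∂P := by
      simp only [frobenius_norm_sq]
      rw [integral_finsetSum _ fun q _ => integrable_finsetSum _ fun u _ => hg q u]
      exact Finset.sum_congr rfl fun q _ => (integral_finsetSum _ fun u _ => hg q u).symm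
    rw [e]
    have := abs_integral_le_of_abs_le P (B := n) (f := fun ω =>
      ‖green y (removeSkew r (ensembleMatrix a ω))‖ ^ 2) fun ω => by
        rw [abs_of_nonneg (by positivity)]
        exact hGn ω
    exact (le_abs_self _).trans this
  calc _ ≤ ∑ q, ∑ u, (n : ℝ)⁻¹ ^ 2 * M *
        ∫ ω, ‖green y (removeSkew r (ensembleMatrix a ω)) q u‖ ^ 2 ∂P := by
        refine Finset.sum_le_sum fun q _ => ?_
        rw [integral_finsetSum _ fun u _ => integrable_finsetSum _
          fun p _ => integrable_finsetSum _ fun v _ => hi q u p v]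
        exact Finset.sum_le_sum fun u _ => step q u
    _ = (n : ℝ)⁻¹ ^ 2 * M *
        ∑ q, ∑ u, ∫ ω, ‖green y (removeSkew r (ensembleMatrix a ω)) q u‖ ^ 2 ∂P := by
        simp only [Finset.mul_sum]
    _ ≤ (n : ℝ)⁻¹ ^ 2 * M * n := by gcongr
    _ = (n : ℝ)⁻¹ * M := by
        have : (n : ℝ) ≠ 0 := by
          have := r.pos
          have : 0 < n := by omega
          positivity
        field_simp

end IsSkewEnsemble

end Variance

/-! ### Concentration of traces of the resolvent -/

section Concentration

open scoped Matrix.Norms.Frobenius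
open Matrix

variable {Ω : Type*} {n : ℕ}

theorem norm_trace_mul_green_le (S : Matrix (Fin n) (Fin n) ℂ) {X : Matrix (Fin n) (Fin n) ℝ}
    (hX : X.IsSymm) {y : ℝ} (hy : 1 ≤ y) : ‖(S * green y X).trace‖ ≤ ‖S‖ * √(n : ℝ) :=
  (norm_trace_mul_le _ _).trans
    (mul_le_mul_of_nonneg_left (norm_green_le_sqrt hX hy) (norm_nonneg _))

theorem measurable_trace_mul_green {E : Type*} [MeasurableSpace E] (S : Matrix (Fin n) (Fin n) ℂ)
    {A : E → Matrix (Fin n) (Fin n) ℝ} (hA : ∀ p q, Measurable fun x => A x p q) (y : ℝ) :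
    Measurable fun x => (S * green y (A x)).trace :=
  measurable_trace_of_entries (measurable_mul_entries (A := fun _ => S)
    (fun _ _ => measurable_const) (measurable_green hA y))

theorem measurable_removeSkew_assemble (r : ℕ) (p q : Fin n) :
    Measurable fun x : Fin (2 * n) → Fin n → Fin n → ℝ => removeSkew r (assemble x) p q := by
  simp only [removeSkew_apply]
  split_ifs
  · exact measurable_const
  · exact measurable_assemble p q

theorem norm_skewPart_green_mul_green_le (S : Matrix (Fin n) (Fin n) ℂ)
    {X : Matrix (Fin n) (Fin n) ℝ} (hX : X.IsSymm) {y : ℝ} (hy : 1 ≤ y) (r : ℕ) :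
    ‖skewPart r (green y X * S * green y X)‖ ≤ ‖S‖ :=
  (norm_skewPart_le r _).trans
    ((norm_mul_green_le_self hX hy _).trans (norm_green_mul_le_self hX hy _))

theorem measurable_norm_skewPart_green_mul_green_sq {E : Type*} [MeasurableSpace E]
    (S : Matrix (Fin n) (Fin n) ℂ) {A : E → Matrix (Fin n) (Fin n) ℝ}
    (hA : ∀ p q, Measurable fun x => A x p q) (y : ℝ) (r : ℕ) :
    Measurable fun x => ‖skewPart r (green y (A x) * S * green y (A x))‖ ^ 2  := by
  have h1 : ∀ p q, Measurable fun x => green y (A x) p q := measurable_green hA y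
  have h2 : ∀ p q, Measurable fun x => (green y (A x) * S) p q :=
    measurable_mul_entries h1 (B := fun _ => S) fun _ _ => measurable_const
  have h3 : ∀ p q, Measurable fun x => (green y (A x) * S * green y (A x)) p q :=
    measurable_mul_entries h2 h1
  exact (measurable_norm_of_entries (measurable_skewPart h3 r)).pow_const 2

namespace IsSkewEnsemble

variable [MeasurableSpace Ω] {P : Measure Ω} [IsProbabilityMeasure P] {a : Fin n → Fin n → Ω → ℝ}
  (h : IsSkewEnsemble P a)
include h

theorem integral_norm_trace_sub_sq_le_sum (S : Matrix (Fin n) (Fin n) ℂ) {y : ℝ} (hy : 1 ≤ y) :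
    ∫ ω, ‖(S * green y (ensembleMatrix a ω)).trace -
        ∫ ω, (S * green y (ensembleMatrix a ω)).trace ∂P‖ ^ 2 ∂P ≤
      ∑ r : Fin (2 * n), ∫ ω, ‖(S * (green y (ensembleMatrix a ω) -
        green y (removeSkew r (ensembleMatrix a ω)))).trace‖ ^ 2 ∂P := by
  have key := integral_norm_sub_sq_le_of_indep (fun r => h.measurable_skewBlock (r : ℕ))
    h.iIndepFun_skewBlock (f := fun x => (S * green y (assemble x)).trace)
    (h := fun r x => (S * green y (removeSkew r (assemble x))).trace) (B := ‖S‖ * √(n : ℝ))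
    (measurable_trace_mul_green S measurable_assemble y)
    (fun x => norm_trace_mul_green_le S (isSymm_assemble x) hy)
    (fun r => measurable_trace_mul_green S (measurable_removeSkew_assemble r) y)
    (fun r x => norm_trace_mul_green_le S (isSymm_removeSkew r (isSymm_assemble x)) hy)
    (fun r x e => by simp only [removeSkew_assemble_update])
  simpa only [assemble_skewBlock, mul_sub, trace_sub] using key

/-- The fourth moment is needed for almost sure convergence: the variance bound for the normalised
trace is only of order 1/n, which is not summable. The constant is 280 · 6². -/
theorem integral_norm_trace_sub_pow_four_le {y : ℝ} (hy : 1 ≤ y) :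
    ∫ ω, ‖(green y (ensembleMatrix a ω)).trace -
        ∫ ω, (green y (ensembleMatrix a ω)).trace ∂P‖ ^ 4 ∂P ≤
      10080 * (n : ℝ) ^ 2 * ∫ ω, entryBound a ω ^ 8 ∂P := by
  have hB : ∀ {X : Matrix (Fin n) (Fin n) ℝ}, X.IsSymm → ‖(green y X).trace‖ ≤
      ‖(1 : Matrix (Fin n) (Fin n) ℂ)‖ * √(n : ℝ) := fun hX => by
    have := norm_trace_mul_green_le 1 hX hy
    rwa [one_mul] at this
  have key := integral_norm_sub_pow_four_le_of_indep (fun r => h.measurable_skewBlock (r : ℕ))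
    h.iIndepFun_skewBlock (f := fun x => (green y (assemble x)).trace)
    (h := fun r x => (green y (removeSkew r (assemble x))).trace)
    (B := ‖(1 : Matrix (Fin n) (Fin n) ℂ)‖ * √(n : ℝ))
    (measurable_trace_of_entries (_root_.measurable_green measurable_assemble y))
    (fun x => hB (isSymm_assemble x))
    (fun r => measurable_trace_of_entries
      (_root_.measurable_green (measurable_removeSkew_assemble r) y))
    (fun r x => hB (isSymm_removeSkew r (isSymm_assemble x)))
    (fun r x e => by simp only [removeSkew_assemble_update])
  simp only [assemble_skewBlock] at key
  refine key.trans ?_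
  have hle : ∫ ω, (∑ r : Fin (2 * n), ‖(green y (ensembleMatrix a ω)).trace -
      (green y (removeSkew r (ensembleMatrix a ω))).trace‖ ^ 2) ^ 2 ∂P ≤
      ∫ ω, (6 * n) ^ 2 * entryBound a ω ^ 8 ∂P := by
    refine integral_mono_of_nonneg (Eventually.of_forall fun ω => by positivity)
      ((h.integrable_entryBound_pow 8).const_mul _) (Eventually.of_forall fun ω => ?_)
    have h1 := sum_norm_trace_green_sub_sq_le (isSymm_ensembleMatrix a ω) hy
      (one_le_entryBound a ω) (norm_complexify_ensembleMatrix_le a ω)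
    rw [← Fin.sum_univ_eq_sum_range (fun r => ‖(green y (ensembleMatrix a ω) -
      green y (removeSkew r (ensembleMatrix a ω))).trace‖ ^ 2)] at h1
    simp only [trace_sub] at h1
    refine (pow_le_pow_left₀ (Finset.sum_nonneg fun i _ => by positivity) h1 2).trans_eq ?_
    ring
  rw [integral_const_mul] at hle
  linarith

/-- In the first order term ‖D‖² is independent of the factor built from the resolvent without D and
has mean at most one, so it can be dropped. -/
theorem integral_norm_trace_mul_green_sub_sq_le {M : ℝ} (hM0 : 0 ≤ M)
    (hM : ∀ p q, p ≤ q → ∫ ω, |a p q ω| ^ 4 ∂P ≤ M) {y : ℝ} (hy : 1 ≤ y)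
    (S : Matrix (Fin n) (Fin n) ℂ) (r : Fin (2 * n)) :
    ∫ ω, ‖(S * (green y (ensembleMatrix a ω) -
      green y (removeSkew r (ensembleMatrix a ω)))).trace‖ ^ 2 ∂P ≤
      2 * ∫ ω, ‖skewPart r (green y (removeSkew r (ensembleMatrix a ω)) * S *
        green y (removeSkew r (ensembleMatrix a ω)))‖ ^ 2 ∂P +
      2 * ‖S‖ ^ 2 * ((n : ℝ)⁻¹ * M) := by
  have hX := fun ω => isSymm_ensembleMatrix a ω
  have hDm := measurable_skewPart h.measurable_complexify (r : ℕ)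
  have hGm := h.measurable_green_removeSkew y r
  have hWm := measurable_norm_skewPart_green_mul_green_sq S (h.measurable_removeSkew r) y r
  have hWB : ∀ ω, ‖skewPart r (green y (removeSkew r (ensembleMatrix a ω)) *
      S * green y (removeSkew r (ensembleMatrix a ω)))‖ ^ 2 ≤ ‖S‖ ^ 2 := fun ω =>
    pow_le_pow_left₀ (norm_nonneg _)
      (norm_skewPart_green_mul_green_le S (isSymm_removeSkew r (hX ω)) hy r) 2
  have hK0 : ∀ ω, 0 ≤ entryBound a ω := fun ω => zero_le_one.trans (one_le_entryBound a ω)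
  have hi1 : Integrable (fun ω => ‖skewPart r
      (green y (removeSkew r (ensembleMatrix a ω)) * S *
        green y (removeSkew r (ensembleMatrix a ω)))‖ ^ 2 *
      ‖skewPart r (complexify (ensembleMatrix a ω))‖ ^ 2) P := by
    refine h.integrable_of_norm_le (hWm.mul
      ((measurable_norm_of_entries hDm).pow_const 2)).aestronglyMeasurable 2 (‖S‖ ^ 2)
      fun ω => ?_
    rw [Real.norm_of_nonneg (by positivity)]
    exact mul_le_mul (hWB ω) (pow_le_pow_left₀ (norm_nonneg _)
      (norm_skewPart_ensembleMatrix_le a ω r) 2) (by positivity) (by positivity)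
  have hi2 : Integrable (fun ω => ‖skewPart r (complexify (ensembleMatrix a ω)) *
      green y (removeSkew r (ensembleMatrix a ω)) *
        skewPart r (complexify (ensembleMatrix a ω))‖ ^ 2) P := by
    refine h.integrable_of_norm_le ((measurable_norm_of_entries (measurable_mul_entries
      (measurable_mul_entries hDm hGm) hDm)).pow_const 2).aestronglyMeasurable 4 1
      fun ω => ?_
    rw [Real.norm_of_nonneg (by positivity), one_mul,
      show entryBound a ω ^ 4 = (entryBound a ω * entryBound a ω) ^ 2 by ring]
    refine pow_le_pow_left₀ (norm_nonneg _) ?_ 2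
    refine (norm_mul_le _ _).trans (mul_le_mul ?_ (norm_skewPart_ensembleMatrix_le a ω r)
      (norm_nonneg _) (hK0 ω))
    exact (norm_mul_green_le_self (isSymm_removeSkew r (hX ω)) hy _).trans
      (norm_skewPart_ensembleMatrix_le a ω r)
  have h1 : ∫ ω, ‖(S * (green y (ensembleMatrix a ω) -
      green y (removeSkew r (ensembleMatrix a ω)))).trace‖ ^ 2 ∂P ≤ ∫ ω,
      (2 * (‖skewPart r (green y (removeSkew r (ensembleMatrix a ω)) * S *
      green y (removeSkew r (ensembleMatrix a ω)))‖ ^ 2 *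
      ‖skewPart r (complexify (ensembleMatrix a ω))‖ ^ 2) +
      2 * ‖S‖ ^ 2 * ‖skewPart r (complexify (ensembleMatrix a ω)) *
      green y (removeSkew r (ensembleMatrix a ω)) *
      skewPart r (complexify (ensembleMatrix a ω))‖ ^ 2) ∂P :=
    integral_mono_of_nonneg (Eventually.of_forall fun ω => by positivity)
      ((hi1.const_mul 2).add (hi2.const_mul _))
      (Eventually.of_forall fun ω => norm_trace_mul_green_sub_sq_le (hX ω) hy r S)
  rw [integral_add (hi1.const_mul 2) (hi2.const_mul _), integral_const_mul,
    integral_const_mul] at h1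
  have h2 := h.integral_mul_skewPart_removeSkew (𝕜 := ℝ) r
    (φ := fun e => ‖complexify (Matrix.of e)‖ ^ 2)
    (ψ := fun e => ‖skewPart r (green y (Matrix.of e) * S * green y (Matrix.of e))‖ ^ 2)
    ((measurable_norm_of_entries fun p q => by
      simp only [complexify_apply, Matrix.of_apply]
      fun_prop).pow_const 2)
    (measurable_norm_skewPart_green_mul_green_sq S (fun p q => by
      simp only [Matrix.of_apply]
      fun_prop) y r)
  have e1 : ∀ ω, Matrix.of (fun p q => skewPart r (ensembleMatrix a ω) p q) =
      skewPart r (ensembleMatrix a ω) := fun ω => rfl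
  have e2 : ∀ ω, Matrix.of (fun p q => removeSkew r (ensembleMatrix a ω) p q) =
      removeSkew r (ensembleMatrix a ω) := fun ω => rfl
  simp only [e1, e2, complexify_skewPart] at h2
  have h3 := h.integral_norm_skewPart_sq_le (r : ℕ)
  have h4 := h.integral_norm_skewPart_mul_green_mul_skewPart_sq_le hM0 hM hy r
  simp only [mul_comm (‖skewPart (r : ℕ) (complexify _)‖ ^ 2)] at h2
  rw [h2] at h1
  have h5 : (∫ ω, ‖skewPart r (complexify (ensembleMatrix a ω))‖ ^ 2 ∂P) *
      ∫ ω, ‖skewPart r (green y (removeSkew r (ensembleMatrix a ω)) * S *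
        green y (removeSkew r (ensembleMatrix a ω)))‖ ^ 2 ∂P ≤
      ∫ ω, ‖skewPart r (green y (removeSkew r (ensembleMatrix a ω)) * S *
        green y (removeSkew r (ensembleMatrix a ω)))‖ ^ 2 ∂P :=
    mul_le_of_le_one_left (integral_nonneg fun ω => by positivity) h3
  have h6 := mul_le_mul_of_nonneg_left h4 (by positivity : 0 ≤ 2 * ‖S‖ ^ 2)
  linarith

/-- Linear statistics of the resolvent have bounded variance. -/
theorem integral_norm_trace_sub_sq_le {M : ℝ} (hM0 : 0 ≤ M)
    (hM : ∀ p q, p ≤ q → ∫ ω, |a p q ω| ^ 4 ∂P ≤ M) {y : ℝ} (hy : 1 ≤ y)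
    (S : Matrix (Fin n) (Fin n) ℂ) :
    ∫ ω, ‖(S * green y (ensembleMatrix a ω)).trace -
        ∫ ω, (S * green y (ensembleMatrix a ω)).trace ∂P‖ ^ 2 ∂P ≤ (30 + 16 * M) * ‖S‖ ^ 2 := by
  -- In units of ‖S‖², the first order terms contribute 2(3 + 6(2 + M)) = 30 + 12M through the mean
  -- of `massBound`, and the 2n second order terms of size 2M/n contribute 4M.
  refine (h.integral_norm_trace_sub_sq_le_sum S hy).trans ?_
  have hWi : ∀ r : Fin (2 * n), Integrable (fun ω => ‖skewPart r
      (green y (removeSkew r (ensembleMatrix a ω)) * S *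
        green y (removeSkew r (ensembleMatrix a ω)))‖ ^ 2) P := fun r =>
    integrable_of_abs_le (B := ‖S‖ ^ 2)
      (measurable_norm_skewPart_green_mul_green_sq S (h.measurable_removeSkew r) y r) fun ω => by
      rw [abs_of_nonneg (by positivity)]
      exact pow_le_pow_left₀ (norm_nonneg _) (norm_skewPart_green_mul_green_le S
        (isSymm_removeSkew r (isSymm_ensembleMatrix a ω)) hy r) 2
  refine (Finset.sum_le_sum fun r _ => h.integral_norm_trace_mul_green_sub_sq_le hM0 hM hy S r).trans ?_
  rw [Finset.sum_add_distrib, ← Finset.mul_sum, ← integral_finsetSum _ fun r _ => hWi r,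
    Finset.sum_const, Finset.card_univ, Fintype.card_fin, nsmul_eq_mul]
  obtain ⟨hmi, hm⟩ := h.integral_massBound_le hM0 hM
  have hW : ∫ ω, ∑ r : Fin (2 * n), ‖skewPart r (green y (removeSkew r (ensembleMatrix a ω)) * S *
      green y (removeSkew r (ensembleMatrix a ω)))‖ ^ 2 ∂P ≤
      ∫ ω, (3 * ‖S‖ ^ 2 + 6 * ‖S‖ ^ 2 * massBound a ω) ∂P := by
    refine integral_mono_of_nonneg (Eventually.of_forall fun ω =>
      Finset.sum_nonneg fun r _ => by positivity) ((integrable_const _).add (hmi.const_mul _))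
      (Eventually.of_forall fun ω => ?_)
    have h1 := sum_norm_skewPart_green_sq_le (isSymm_ensembleMatrix a ω) hy (k := massBound a ω)
      (fun q => columnMass_le_massBound a q ω) S
    rw [← Fin.sum_univ_eq_sum_range (fun r => ‖skewPart r
      (green y (removeSkew r (ensembleMatrix a ω)) * S *
      green y (removeSkew r (ensembleMatrix a ω)))‖ ^ 2)] at h1
    refine h1.trans_eq ?_
    ring
  have hc : ∫ _ : Ω, 3 * ‖S‖ ^ 2 ∂P = 3 * ‖S‖ ^ 2 := by simp
  rw [integral_add (integrable_const _) (hmi.const_mul _), hc, integral_const_mul] at hW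
  have hW1 := mul_le_mul_of_nonneg_left hm (by positivity : 0 ≤ 6 * ‖S‖ ^ 2)
  have hn : (n : ℝ) * (n : ℝ)⁻¹ ≤ 1 := mul_inv_le_one
  have hn2 := mul_le_mul_of_nonneg_left hn (by positivity : 0 ≤ 4 * ‖S‖ ^ 2 * M)
  push_cast
  linarith

end IsSkewEnsemble

end Concentration

/-! ### Almost sure convergence from summable fourth moments -/

section AlmostSure

variable {Ω : Type*} [MeasurableSpace Ω] {P : Measure Ω}

/-- By monotone convergence the random series of fourth powers has finite expectation, so it
converges almost surely and its terms tend to zero. -/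
theorem ae_tendsto_zero_of_summable_integral_pow {f : ℕ → Ω → ℂ}
    (hf : ∀ n, Measurable (f n)) (hfi : ∀ n, Integrable (fun ω => ‖f n ω‖ ^ 4) P)
    (hs : Summable fun n => ∫ ω, ‖f n ω‖ ^ 4 ∂P) :
    ∀ᵐ ω ∂P, Tendsto (fun n => f n ω) atTop (𝓝 0) := by
  have h1 : ∫⁻ ω, ∑' n, ENNReal.ofReal (‖f n ω‖ ^ 4) ∂P ≠ ⊤ := by
    rw [lintegral_tsum fun n => ((hf n).norm.pow_const 4).ennreal_ofReal.aemeasurable]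
    simp only [fun n => (ofReal_integral_eq_lintegral_ofReal (hfi n)
      (Eventually.of_forall fun ω => by positivity)).symm]
    exact hs.tsum_ofReal_ne_top
  have h2 := ae_lt_top (Measurable.tsum fun n => ((hf n).norm.pow_const 4).ennreal_ofReal)
    h1
  filter_upwards [h2] with ω hω
  have h3 := ENNReal.tendsto_atTop_zero_of_tsum_ne_top hω.ne
  have h4 := (ENNReal.tendsto_toReal ENNReal.zero_ne_top).comp h3
  have h5 : Tendsto (fun n => ‖f n ω‖ ^ 4) atTop (𝓝 0) := by
    refine h4.congr fun n => ?_
    simp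
  rw [tendsto_zero_iff_norm_tendsto_zero]
  have h6 := h5.sqrt.sqrt
  rw [Real.sqrt_zero, Real.sqrt_zero] at h6
  refine h6.congr fun n => ?_
  rw [show ‖f n ω‖ ^ 4 = (‖f n ω‖ ^ 2) ^ 2 by ring, Real.sqrt_sq (by positivity),
    Real.sqrt_sq (norm_nonneg _)]

end AlmostSure

/-! ### The self-energy map defined by the covariances -/

section SelfEnergy

open scoped Matrix.Norms.Frobenius
open Matrix

variable {n : ℕ}

/-- The matrix with entries `∑ q u, κ p q u v * A q u`. -/
noncomputable def contract (κ : Fin n → Fin n → Fin n → Fin n → ℝ) (A : Matrix (Fin n) (Fin n) ℂ) :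
    Matrix (Fin n) (Fin n) ℂ :=
  Matrix.of fun p v => ∑ q, ∑ u, (κ p q u v : ℂ) * A q u

theorem contract_apply (κ : Fin n → Fin n → Fin n → Fin n → ℝ) (A : Matrix (Fin n) (Fin n) ℂ)
    (p v : Fin n) : contract κ A p v = ∑ q, ∑ u, (κ p q u v : ℂ) * A q u := rfl

theorem contract_sub (κ : Fin n → Fin n → Fin n → Fin n → ℝ) (A B : Matrix (Fin n) (Fin n) ℂ) :
    contract κ (A - B) = contract κ A - contract κ B := by
  ext p v
  simp only [contract_apply, Matrix.sub_apply, mul_sub, Finset.sum_sub_distrib]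

theorem contract_smul (κ : Fin n → Fin n → Fin n → Fin n → ℝ) (c : ℂ)
    (A : Matrix (Fin n) (Fin n) ℂ) : contract κ (c • A) = c • contract κ A := by
  ext p v
  simp only [contract_apply, Matrix.smul_apply, smul_eq_mul, Finset.mul_sum]
  exact Finset.sum_congr rfl fun q _ => Finset.sum_congr rfl fun u _ => by ring

theorem contract_sum {ι : Type*} (s : Finset ι) (κ : ι → Fin n → Fin n → Fin n → Fin n → ℝ)
    (A : Matrix (Fin n) (Fin n) ℂ) :
    contract (fun p q u v => ∑ i ∈ s, κ i p q u v) A = ∑ i ∈ s, contract (κ i) A := by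
  ext p v
  rw [Matrix.sum_apply]
  simp only [contract_apply, Complex.ofReal_sum, Finset.sum_mul]
  exact (Finset.sum_congr rfl fun q _ => Finset.sum_comm).trans Finset.sum_comm

/-- On one skew-diagonal (p,v) and (q,u) determine each other, so the map only relocates entries and
multiplies them by factors of modulus at most `b`. -/
theorem norm_contract_le {κ : Fin n → Fin n → Fin n → Fin n → ℝ} {r : ℕ} {b : ℝ} (hb : 0 ≤ b)
    (hκ : ∀ p q u v, |κ p q u v| ≤ if (p : ℕ) + q = r ∧ (u : ℕ) + v = r then b else 0)
    (A : Matrix (Fin n) (Fin n) ℂ) : ‖contract κ A‖ ≤ b * ‖A‖ := by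
  refine abs_le_of_sq_le_sq' ?_ (by positivity) |>.2
  have h0 : ∀ p q u v : Fin n, ¬((p : ℕ) + q = r ∧ (u : ℕ) + v = r) → κ p q u v = 0 := by
    intro p q u v hne
    have := hκ p q u v
    rw [if_neg hne] at this
    exact abs_nonpos_iff.1 this
  have h1 : ∀ p v : Fin n, ‖contract κ A p v‖ ^ 2 ≤ ∑ q : Fin n, ∑ u : Fin n,
      if (p : ℕ) + q = r ∧ (u : ℕ) + v = r then b ^ 2 * ‖A q u‖ ^ 2 else 0 := by
    intro p v
    rw [contract_apply, ← Fintype.sum_prod_type' (f := fun q u => (κ p q u v : ℂ) * A q u),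
      norm_sum_sq_of_unique, Fintype.sum_prod_type]
    · refine Finset.sum_le_sum fun q _ => Finset.sum_le_sum fun u _ => ?_
      rw [norm_mul, mul_pow, Complex.norm_real, Real.norm_eq_abs]
      have h2 := hκ p q u v
      split_ifs at h2 ⊢ with hc
      · gcongr
      · rw [h0 p q u v hc]
        simp
    · rintro ⟨q, u⟩ _ ⟨q', u'⟩ _ hx hx'
      have h3 : (p : ℕ) + q = r ∧ (u : ℕ) + v = r := by
        by_contra hc
        simp [h0 p q u v hc] at hx
      have h4 : (p : ℕ) + q' = r ∧ (u' : ℕ) + v = r := by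
        by_contra hc
        simp [h0 p q' u' v hc] at hx'
      rw [Prod.mk.injEq]
      exact ⟨by ext; omega, by ext; omega⟩
  rw [frobenius_norm_sq, mul_pow, frobenius_norm_sq]
  calc ∑ p, ∑ v, ‖contract κ A p v‖ ^ 2
      ≤ ∑ p : Fin n, ∑ v : Fin n, ∑ q : Fin n, ∑ u : Fin n,
          if (p : ℕ) + q = r ∧ (u : ℕ) + v = r then b ^ 2 * ‖A q u‖ ^ 2 else 0 :=
        Finset.sum_le_sum fun p _ => Finset.sum_le_sum fun v _ => h1 p v
    _ = ∑ q : Fin n, ∑ u : Fin n, ∑ p : Fin n, ∑ v : Fin n,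
          if (p : ℕ) + q = r ∧ (u : ℕ) + v = r then b ^ 2 * ‖A q u‖ ^ 2 else 0 := by
        refine (Finset.sum_congr rfl fun p _ => Finset.sum_comm.trans (Finset.sum_congr rfl
          fun q _ => Finset.sum_comm)).trans ?_
        exact Finset.sum_comm.trans (Finset.sum_congr rfl fun q _ => Finset.sum_comm)
    _ ≤ ∑ q, ∑ u, b ^ 2 * ‖A q u‖ ^ 2 :=
        Finset.sum_le_sum fun q _ => Finset.sum_le_sum fun u _ =>
          sum_sum_ite_add_eq_le q u r (by positivity)
    _ = b ^ 2 * ∑ q, ∑ u, ‖A q u‖ ^ 2 := by simp only [Finset.mul_sum]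

theorem measurable_contract {Ω : Type*} [MeasurableSpace Ω]
    (κ : Fin n → Fin n → Fin n → Fin n → ℝ) {A : Ω → Matrix (Fin n) (Fin n) ℂ}
    (hA : ∀ p q, Measurable fun ω => A ω p q) (p v : Fin n) :
    Measurable fun ω => contract κ (A ω) p v := by
  simp only [contract_apply]
  exact Finset.measurable_fun_sum _ fun q _ => Finset.measurable_fun_sum _ fun u _ =>
    (hA q u).const_mul _

variable {Ω : Type*} [MeasurableSpace Ω]

/-- The covariances of the entries of the random matrix that lie on the `r`-th skew-diagonal. -/
noncomputable def skewCov (P : Measure Ω) (a : Fin n → Fin n → Ω → ℝ) (r : ℕ) (p q u v : Fin n) :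
    ℝ :=
  if (p : ℕ) + q = r ∧ (u : ℕ) + v = r then
    ∫ ω, ensembleMatrix a ω p q * ensembleMatrix a ω u v ∂P else 0

/-- The covariances of the entries of the random matrix, extended by zero to pairs of entries on
different skew-diagonals. -/
noncomputable def entryCov (P : Measure Ω) (a : Fin n → Fin n → Ω → ℝ) (p q u v : Fin n) : ℝ :=
  if (p : ℕ) + q = u + v then ∫ ω, ensembleMatrix a ω p q * ensembleMatrix a ω u v ∂P else 0

/-- The entrywise expectation of the resolvent. -/
noncomputable def meanGreen (P : Measure Ω) (y : ℝ) (a : Fin n → Fin n → Ω → ℝ) :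
    Matrix (Fin n) (Fin n) ℂ :=
  Matrix.of fun p q => ∫ ω, green y (ensembleMatrix a ω) p q ∂P

variable {P : Measure Ω} {a : Fin n → Fin n → Ω → ℝ}

theorem entryCov_eq_sum (p q u v : Fin n) :
    entryCov P a p q u v = ∑ r ∈ Finset.range (2 * n), skewCov P a r p q u v := by
  simp only [entryCov, skewCov]
  by_cases hc : (p : ℕ) + q = u + v
  · rw [if_pos hc]
    refine (sum_ite_add_eq p q _).symm.trans (Finset.sum_congr rfl fun r _ => ?_)
    by_cases hr : (p : ℕ) + q = r
    · rw [if_pos hr, if_pos ⟨hr, hc.symm.trans hr⟩]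
    · rw [if_neg hr, if_neg fun h' => hr h'.1]
  · rw [if_neg hc, Finset.sum_eq_zero]
    intro r _
    rw [if_neg]
    omega

theorem contract_entryCov (A : Matrix (Fin n) (Fin n) ℂ) :
    contract (entryCov P a) A = ∑ r ∈ Finset.range (2 * n), contract (skewCov P a r) A := by
  rw [← contract_sum]
  congr 1
  funext p q u v
  exact entryCov_eq_sum p q u v

namespace IsSkewEnsemble

variable (h : IsSkewEnsemble P a)
include h

theorem integral_entry_sq (p q : Fin n) : ∫ ω, ensembleMatrix a ω p q ^ 2 ∂P = (n : ℝ)⁻¹ := by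
  rw [← h.integral_norm_entry_sq p q]
  simp [complexify_apply]

/-- On the diagonal q = u the condition p + q = q + v forces p = v, and the covariance becomes E
X(p,q)² = 1/n, summed over n values of q. Correlations between different entries thus drop out, and
scalar matrices are mapped to themselves. -/
theorem contract_entryCov_one : contract (entryCov P a) 1 = 1 := by
  ext p v
  rw [contract_apply]
  have h1 : ∀ q, ∑ u, (entryCov P a p q u v : ℂ) * (1 : Matrix (Fin n) (Fin n) ℂ) q u =
      entryCov P a p q q v := fun q => by
    simp [Matrix.one_apply]
  simp only [h1]
  have h2 : ∀ q, (entryCov P a p q q v : ℂ) = if p = v then (n : ℂ)⁻¹ else 0 := fun q => by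
    rw [entryCov]
    by_cases hpv : p = v
    · subst hpv
      have h3 : ∀ ω, ensembleMatrix a ω p q * ensembleMatrix a ω q p =
          ensembleMatrix a ω p q ^ 2 := fun ω => by
        rw [(isSymm_ensembleMatrix a ω).apply, sq]
      rw [if_pos (add_comm _ _), if_pos rfl]
      simp only [h3, h.integral_entry_sq]
      simp
    · rw [if_neg hpv, if_neg (fun h' => hpv (by ext; omega)), Complex.ofReal_zero]
  simp only [h2, Matrix.one_apply]
  have hn : (n : ℂ) ≠ 0 := by
    have := p.pos
    exact_mod_cast this.ne'
  by_cases hpv : p = v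
  · simp [hpv, mul_inv_cancel₀ hn]
  · simp [hpv]

variable [IsProbabilityMeasure P]

theorem integrable_entry_mul (p q u v : Fin n) :
    Integrable (fun ω => ensembleMatrix a ω p q * ensembleMatrix a ω u v) P := by
  refine h.integrable_of_norm_le ((h.measurable_ensembleMatrix p q).mul
    (h.measurable_ensembleMatrix u v)).aestronglyMeasurable 2 ((√(n : ℝ))⁻¹ ^ 2) fun ω => ?_
  have hb := fun p q => norm_complexify_ensembleMatrix_le a ω p q
  simp only [complexify_apply, Complex.norm_real] at hb
  rw [norm_mul]
  refine (mul_le_mul (hb p q) (hb u v) (norm_nonneg _) ((norm_nonneg _).trans (hb p q))).trans_eq ?_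
  ring

theorem abs_integral_entry_mul_le (p q u v : Fin n) :
    |∫ ω, ensembleMatrix a ω p q * ensembleMatrix a ω u v ∂P| ≤ (n : ℝ)⁻¹ := by
  have i : ∀ p q, Integrable (fun ω => ensembleMatrix a ω p q ^ 2 / 2) P := fun p q => by
    have := (h.integrable_entry_mul p q p q).div_const 2
    simpa only [← sq] using this
  have h1 : ∫ ω, |ensembleMatrix a ω p q * ensembleMatrix a ω u v| ∂P ≤
      ∫ ω, (ensembleMatrix a ω p q ^ 2 / 2 + ensembleMatrix a ω u v ^ 2 / 2) ∂P := by
    refine integral_mono (h.integrable_entry_mul p q u v).abs ((i p q).add (i u v)) fun ω => ?_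
    simp only
    rw [abs_mul]
    nlinarith [sq_nonneg (|ensembleMatrix a ω p q| - |ensembleMatrix a ω u v|),
      sq_abs (ensembleMatrix a ω p q), sq_abs (ensembleMatrix a ω u v)]
  rw [integral_add (i p q) (i u v), integral_div, integral_div, h.integral_entry_sq,
    h.integral_entry_sq, add_halves] at h1
  exact abs_integral_le_integral_abs.trans h1

theorem abs_skewCov_le (r : ℕ) (p q u v : Fin n) : |skewCov P a r p q u v| ≤
    if (p : ℕ) + q = r ∧ (u : ℕ) + v = r then (n : ℝ)⁻¹ else 0 := by
  rw [skewCov]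
  split_ifs
  · exact h.abs_integral_entry_mul_le p q u v
  · simp

theorem norm_contract_skewCov_le (r : ℕ) (A : Matrix (Fin n) (Fin n) ℂ) :
    ‖contract (skewCov P a r) A‖ ≤ (n : ℝ)⁻¹ * ‖A‖ :=
  norm_contract_le (by positivity) (h.abs_skewCov_le r) A

/-- There are 2n skew-diagonals, each contributing 1/n. The resulting factor 2 is why the stability
argument asks for |m| < 1/2. -/
theorem norm_contract_entryCov_le (A : Matrix (Fin n) (Fin n) ℂ) :
    ‖contract (entryCov P a) A‖ ≤ 2 * ‖A‖ := by
  rw [contract_entryCov]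
  refine (norm_sum_le _ _).trans ((Finset.sum_le_sum fun r _ =>
    h.norm_contract_skewCov_le r A).trans ?_)
  rw [Finset.sum_const, Finset.card_range, nsmul_eq_mul, ← mul_assoc]
  gcongr
  push_cast
  rw [mul_assoc]
  linarith [mul_inv_le_one (a := (n : ℝ))]

end IsSkewEnsemble

end SelfEnergy

/-! ### Integrating out one skew-diagonal -/

section SchwingerDyson

open scoped Matrix.Norms.Frobenius
open Matrix

variable {Ω : Type*} [MeasurableSpace Ω] {n : ℕ} {P : Measure Ω} {a : Fin n → Fin n → Ω → ℝ}

namespace IsSkewEnsemble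

variable (h : IsSkewEnsemble P a)
include h

theorem integral_entry (p q : Fin n) : ∫ ω, ensembleMatrix a ω p q ∂P = 0 := by
  simp only [ensembleMatrix_apply]
  rw [integral_const_mul, h.integral_symmEntry, mul_zero]

/-- The entries of the skew-diagonal are centred and independent of everything off it, so the
expectation factorises with a zero factor. -/
theorem integral_skewPart_entry_mul (r : Fin (2 * n)) (p q : Fin n)
    {ψ : Matrix (Fin n) (Fin n) ℝ → ℂ}
    (hψ : Measurable fun e : Fin n → Fin n → ℝ => ψ (Matrix.of e)) :
    ∫ ω, skewPart r (complexify (ensembleMatrix a ω)) p q *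
      ψ (removeSkew r (ensembleMatrix a ω)) ∂P = 0 := by
  have key := h.integral_mul_skewPart_removeSkew (𝕜 := ℂ) r (φ := fun e => ((e p q : ℝ) : ℂ))
    (ψ := fun e => ψ (Matrix.of e)) (by fun_prop) hψ
  have e1 : ∫ ω, ((skewPart r (ensembleMatrix a ω) p q : ℝ) : ℂ) ∂P = 0 := by
    rw [integral_complex_ofReal]
    simp only [skewPart_apply]
    split_ifs
    · rw [h.integral_entry]
      simp
    · simp
  rw [e1, zero_mul] at key
  refine Eq.trans (integral_congr_ae (Eventually.of_forall fun ω => ?_)) key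
  simp only [← complexify_skewPart, complexify_apply]
  rfl

theorem integral_skewPart_entry_mul_mul (r : Fin (2 * n)) (p q u v : Fin n)
    {ψ : Matrix (Fin n) (Fin n) ℝ → ℂ}
    (hψ : Measurable fun e : Fin n → Fin n → ℝ => ψ (Matrix.of e)) :
    ∫ ω, skewPart r (complexify (ensembleMatrix a ω)) p q *
      skewPart r (complexify (ensembleMatrix a ω)) u v *
      ψ (removeSkew r (ensembleMatrix a ω)) ∂P =
      ∫ ω, skewCov P a r p q u v * ψ (removeSkew r (ensembleMatrix a ω)) ∂P := by
  have key := h.integral_mul_skewPart_removeSkew (𝕜 := ℂ) r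
    (φ := fun e => ((e p q * e u v : ℝ) : ℂ))
    (ψ := fun e => ψ (Matrix.of e)) (by fun_prop) hψ
  have e1 : ∫ ω, ((skewPart r (ensembleMatrix a ω) p q * skewPart r (ensembleMatrix a ω) u v :
      ℝ) : ℂ) ∂P = skewCov P a r p q u v := by
    rw [integral_complex_ofReal]
    simp only [skewPart_apply, skewCov]
    by_cases h1 : (p : ℕ) + q = r <;> by_cases h2 : (u : ℕ) + v = r <;> simp [h1, h2]
  rw [e1, ← integral_const_mul] at key
  refine Eq.trans (integral_congr_ae (Eventually.of_forall fun ω => ?_)) key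
  simp only [← complexify_skewPart, complexify_apply, Complex.ofReal_mul]
  rfl

variable [IsProbabilityMeasure P] {y : ℝ} (hy : 1 ≤ y) (T : Matrix (Fin n) (Fin n) ℂ)
include hy

theorem integral_trace_skewPart_mul_green (r : Fin (2 * n)) :
    ∫ ω, (T * (skewPart r (complexify (ensembleMatrix a ω)) *
      green y (removeSkew r (ensembleMatrix a ω)))).trace ∂P = 0 := by
  have hDm := measurable_skewPart h.measurable_complexify (r : ℕ)
  have hWm : ∀ p q, Measurable fun ω => (green y (removeSkew r (ensembleMatrix a ω)) * T) p q :=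
    measurable_mul_entries (h.measurable_green_removeSkew y r) (B := fun _ => T)
      fun _ _ => measurable_const
  have e : ∀ ω, (T * (skewPart r (complexify (ensembleMatrix a ω)) *
      green y (removeSkew r (ensembleMatrix a ω)))).trace =
      ∑ p, ∑ q, skewPart r (complexify (ensembleMatrix a ω)) p q *
        (green y (removeSkew r (ensembleMatrix a ω)) * T) q p := fun ω => by
    rw [trace_mul_comm, Matrix.mul_assoc]
    rfl
  have hi : ∀ p q, Integrable (fun ω => skewPart r (complexify (ensembleMatrix a ω)) p q *
        (green y (removeSkew r (ensembleMatrix a ω)) * T) q p) P := fun p q => by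
    refine h.integrable_of_norm_le ((hDm p q).mul (hWm q p)).aestronglyMeasurable 1 ‖T‖
      fun ω => ?_
    rw [norm_mul, mul_comm, pow_one]
    exact mul_le_mul ((norm_entry_le_norm _ q p).trans (norm_green_mul_le_self
      (isSymm_removeSkew r (isSymm_ensembleMatrix a ω)) hy _))
      ((norm_entry_le_norm _ p q).trans (norm_skewPart_ensembleMatrix_le a ω r))
      (norm_nonneg _) (norm_nonneg _)
  simp only [e]
  rw [integral_finsetSum _ fun p _ => integrable_finsetSum _ fun q _ => hi p q]
  refine Finset.sum_eq_zero fun p _ => ?_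
  rw [integral_finsetSum _ fun q _ => hi p q]
  exact Finset.sum_eq_zero fun q _ => h.integral_skewPart_entry_mul r p q
    (ψ := fun X => (green y X * T) q p) (measurable_mul_entries (B := fun _ => T)
      (_root_.measurable_green (fun p q => by simp only [Matrix.of_apply]; fun_prop) y)
      (fun _ _ => measurable_const) q p)

/-- The trace is expanded into monomials that are quadratic in D, with coefficients depending only
on the remaining matrix. By independence each product of two entries of D may be replaced by its
covariance. -/
theorem integral_trace_skewPart_mul_green_mul_skewPart_mul_green (r : Fin (2 * n)) :
    ∫ ω, (T * (skewPart r (complexify (ensembleMatrix a ω)) *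
      green y (removeSkew r (ensembleMatrix a ω)) *
      skewPart r (complexify (ensembleMatrix a ω)) *
      green y (removeSkew r (ensembleMatrix a ω)))).trace ∂P =
    ∫ ω, (T * (contract (skewCov P a r) (green y (removeSkew r (ensembleMatrix a ω))) *
      green y (removeSkew r (ensembleMatrix a ω)))).trace ∂P := by
  have hDm := measurable_skewPart h.measurable_complexify (r : ℕ)
  have hGm := h.measurable_green_removeSkew y r
  have hWm : ∀ p q, Measurable fun ω => (green y (removeSkew r (ensembleMatrix a ω)) * T) p q :=
    measurable_mul_entries hGm (B := fun _ => T) fun _ _ => measurable_const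
  have e1 : ∀ ω, (T * (skewPart r (complexify (ensembleMatrix a ω)) *
      green y (removeSkew r (ensembleMatrix a ω)) *
      skewPart r (complexify (ensembleMatrix a ω)) *
      green y (removeSkew r (ensembleMatrix a ω)))).trace =
      ∑ p, ∑ v, ∑ u, ∑ q, skewPart r (complexify (ensembleMatrix a ω)) p q *
        skewPart r (complexify (ensembleMatrix a ω)) u v *
        (green y (removeSkew r (ensembleMatrix a ω)) q u *
          (green y (removeSkew r (ensembleMatrix a ω)) * T) v p) := fun ω => by
    rw [trace_mul_comm, Matrix.mul_assoc]
    simp only [Matrix.trace, Matrix.diag]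
    refine Finset.sum_congr rfl fun p _ => ?_
    rw [Matrix.mul_apply]
    refine Finset.sum_congr rfl fun v _ => ?_
    rw [Matrix.mul_apply, Finset.sum_mul]
    refine Finset.sum_congr rfl fun u _ => ?_
    rw [Matrix.mul_apply, Finset.sum_mul, Finset.sum_mul]
    exact Finset.sum_congr rfl fun q _ => by ring
  have e2 : ∀ ω, (T * (contract (skewCov P a r) (green y (removeSkew r (ensembleMatrix a ω))) *
      green y (removeSkew r (ensembleMatrix a ω)))).trace =
      ∑ p, ∑ v, ∑ u, ∑ q, (skewCov P a r p q u v : ℂ) *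
        (green y (removeSkew r (ensembleMatrix a ω)) q u *
          (green y (removeSkew r (ensembleMatrix a ω)) * T) v p) := fun ω => by
    rw [trace_mul_comm, Matrix.mul_assoc]
    simp only [Matrix.trace, Matrix.diag]
    refine Finset.sum_congr rfl fun p _ => ?_
    rw [Matrix.mul_apply]
    refine Finset.sum_congr rfl fun v _ => ?_
    rw [contract_apply, Finset.sum_comm, Finset.sum_mul]
    refine Finset.sum_congr rfl fun u _ => ?_
    rw [Finset.sum_mul]
    exact Finset.sum_congr rfl fun q _ => by ring
  have hD : ∀ p q ω, ‖skewPart r (complexify (ensembleMatrix a ω)) p q‖ ≤ entryBound a ω :=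
    fun p q ω => (norm_entry_le_norm _ p q).trans (norm_skewPart_ensembleMatrix_le a ω r)
  have hG : ∀ q u v p ω, ‖green y (removeSkew r (ensembleMatrix a ω)) q u *
      (green y (removeSkew r (ensembleMatrix a ω)) * T) v p‖ ≤ √(n : ℝ) * ‖T‖ :=
    fun q u v p ω => by
      have hs := isSymm_removeSkew r (isSymm_ensembleMatrix a ω)
      rw [norm_mul]
      exact mul_le_mul ((norm_entry_le_norm _ q u).trans (norm_green_le_sqrt hs hy))
        ((norm_entry_le_norm _ v p).trans (norm_green_mul_le_self hs hy _))
        (norm_nonneg _) (Real.sqrt_nonneg _)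
  have hK0 : ∀ ω, 0 ≤ entryBound a ω := fun ω => zero_le_one.trans (one_le_entryBound a ω)
  have hi1 : ∀ p v u q, Integrable (fun ω => skewPart r (complexify (ensembleMatrix a ω)) p q *
        skewPart r (complexify (ensembleMatrix a ω)) u v *
        (green y (removeSkew r (ensembleMatrix a ω)) q u *
          (green y (removeSkew r (ensembleMatrix a ω)) * T) v p)) P := fun p v u q => by
    refine h.integrable_of_norm_le (((hDm p q).mul (hDm u v)).mul
      ((hGm q u).mul (hWm v p))).aestronglyMeasurable 2 (√(n : ℝ) * ‖T‖) fun ω => ?_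
    rw [norm_mul, norm_mul, mul_comm, sq]
    exact mul_le_mul (hG q u v p ω) (mul_le_mul (hD p q ω) (hD u v ω) (norm_nonneg _) (hK0 ω))
      (by positivity) (by positivity)
  have hi2 : ∀ p v u q, Integrable (fun ω => (skewCov P a r p q u v : ℂ) *
        (green y (removeSkew r (ensembleMatrix a ω)) q u *
          (green y (removeSkew r (ensembleMatrix a ω)) * T) v p)) P := fun p v u q =>
    (Integrable.of_bound ((hGm q u).mul (hWm v p)).aestronglyMeasurable (√(n : ℝ) * ‖T‖)
      (Eventually.of_forall fun ω => hG q u v p ω)).const_mul _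
  have hψ : ∀ p v u q, Measurable fun e : Fin n → Fin n → ℝ =>
      green y (Matrix.of e) q u * (green y (Matrix.of e) * T) v p := fun p v u q => by
    have h1 : ∀ p q, Measurable fun e : Fin n → Fin n → ℝ => green y (Matrix.of e) p q :=
      _root_.measurable_green (fun p q => by simp only [Matrix.of_apply]; fun_prop) y
    exact (h1 q u).mul (measurable_mul_entries h1 (B := fun _ => T)
      (fun _ _ => measurable_const) v p)
  simp only [e1, e2]
  rw [integral_finsetSum _ fun p _ => integrable_finsetSum _ fun v _ => integrable_finsetSum _
    fun u _ => integrable_finsetSum _ fun q _ => hi1 p v u q,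
    integral_finsetSum _ fun p _ => integrable_finsetSum _ fun v _ => integrable_finsetSum _
    fun u _ => integrable_finsetSum _ fun q _ => hi2 p v u q]
  refine Finset.sum_congr rfl fun p _ => ?_
  rw [integral_finsetSum _ fun v _ => integrable_finsetSum _
    fun u _ => integrable_finsetSum _ fun q _ => hi1 p v u q,
    integral_finsetSum _ fun v _ => integrable_finsetSum _
    fun u _ => integrable_finsetSum _ fun q _ => hi2 p v u q]
  refine Finset.sum_congr rfl fun v _ => ?_
  rw [integral_finsetSum _ fun u _ => integrable_finsetSum _ fun q _ => hi1 p v u q,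
    integral_finsetSum _ fun u _ => integrable_finsetSum _ fun q _ => hi2 p v u q]
  refine Finset.sum_congr rfl fun u _ => ?_
  rw [integral_finsetSum _ fun q _ => hi1 p v u q, integral_finsetSum _ fun q _ => hi2 p v u q]
  exact Finset.sum_congr rfl fun q _ => h.integral_skewPart_entry_mul_mul r p q u v
    (ψ := fun X => green y X q u * (green y X * T) v p) (hψ p v u q)

end IsSkewEnsemble

end SchwingerDyson

/-! ### The approximate Schwinger–Dyson equation -/

section MeanEquation

open scoped Matrix.Norms.Frobenius
open Matrix

variable {Ω : Type*} [MeasurableSpace Ω] {n : ℕ} {P : Measure Ω} {a : Fin n → Fin n → Ω → ℝ}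

namespace IsSkewEnsemble

variable (h : IsSkewEnsemble P a) [IsProbabilityMeasure P]
include h

theorem integrable_trace_mul (T : Matrix (Fin n) (Fin n) ℂ) {A : Ω → Matrix (Fin n) (Fin n) ℂ}
    (hA : ∀ p q, Measurable fun ω => A ω p q) (k : ℕ) (C : ℝ)
    (hC : ∀ ω, ‖A ω‖ ≤ C * entryBound a ω ^ k) : Integrable (fun ω => (T * A ω).trace) P := by
  refine h.integrable_of_norm_le (measurable_trace_of_entries (measurable_mul_entries
    (A := fun _ => T) (fun _ _ => measurable_const) hA)).aestronglyMeasurable k (‖T‖ * C)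
    fun ω => (norm_trace_mul_le _ _).trans ?_
  rw [mul_assoc]
  exact mul_le_mul_of_nonneg_left (hC ω) (norm_nonneg _)

variable {y : ℝ} (hy : 1 ≤ y) (T : Matrix (Fin n) (Fin n) ℂ)
include hy

/-- In the expansion of D G the linear term has mean zero and the quadratic one has mean -Σ(Gr)Gr
for the covariances of this skew-diagonal. Three errors remain: the cubic term, of norm at most
K³/n, and the replacement of Gr by G in either factor, at most K/n each. All are bounded by K⁸/n
because K ≥ 1. -/
theorem norm_integral_trace_skewPart_mul_green_add_le (r : Fin (2 * n)) :
    ‖∫ ω, ((T * (skewPart r (complexify (ensembleMatrix a ω)) * green y (ensembleMatrix a ω))).trace +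
      (T * (contract (skewCov P a r) (green y (ensembleMatrix a ω)) *
        green y (ensembleMatrix a ω))).trace) ∂P‖ ≤
      3 * ‖T‖ * (n : ℝ)⁻¹ * ∫ ω, entryBound a ω ^ 8 ∂P := by
  have hn : (0 : ℝ) < n := by
    have := r.pos
    have : 0 < n := by omega
    exact_mod_cast this
  have hs : 0 < √(n : ℝ) := Real.sqrt_pos.2 hn
  have hss : √(n : ℝ) * √(n : ℝ) = n := Real.mul_self_sqrt hn.le
  have hX := fun ω => isSymm_ensembleMatrix a ω
  have hXr := fun ω => isSymm_removeSkew r (hX ω)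
  have hy0 : y ≠ 0 := by linarith
  have hK0 : ∀ ω, 0 ≤ entryBound a ω := fun ω => zero_le_one.trans (one_le_entryBound a ω)
  have hGm := h.measurable_green y
  have hGrm := h.measurable_green_removeSkew y r
  have hDm := measurable_skewPart h.measurable_complexify (r : ℕ)
  have hD1 := fun ω => norm_skewPart_ensembleMatrix_le a ω r
  have hDl := fun ω => norm_skewPart_ensembleMatrix_mul_le a ω r
  have hDr : ∀ ω (A : Matrix (Fin n) (Fin n) ℂ),
      ‖A * skewPart r (complexify (ensembleMatrix a ω))‖ ≤ entryBound a ω / √(n : ℝ) * ‖A‖ :=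
    fun ω A => norm_mul_skewPart_le r (div_nonneg (hK0 ω) hs.le)
      (norm_complexify_ensembleMatrix_le a ω) A
  have hz := h.integral_trace_skewPart_mul_green hy T r
  have hq := h.integral_trace_skewPart_mul_green_mul_skewPart_mul_green hy T r
  set G := fun ω => green y (ensembleMatrix a ω) with hG
  set Gr := fun ω => green y (removeSkew r (ensembleMatrix a ω)) with hGr
  set D := fun ω => skewPart r (complexify (ensembleMatrix a ω)) with hD
  change ∫ ω, (T * (D ω * Gr ω * D ω * Gr ω)).trace ∂P =
    ∫ ω, (T * (contract (skewCov P a r) (Gr ω) * Gr ω)).trace ∂P at hq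
  have hGR : ∀ ω A, ‖A * G ω‖ ≤ ‖A‖ := fun ω A => norm_mul_green_le_self (hX ω) hy A
  have hGrl : ∀ ω A, ‖Gr ω * A‖ ≤ ‖A‖ := fun ω A => norm_green_mul_le_self (hXr ω) hy A
  have hGrR : ∀ ω A, ‖A * Gr ω‖ ≤ ‖A‖ := fun ω A => norm_mul_green_le_self (hXr ω) hy A
  have hGn : ∀ ω, ‖G ω‖ ≤ √(n : ℝ) := fun ω => norm_green_le_sqrt (hX ω) hy
  have hGrn : ∀ ω, ‖Gr ω‖ ≤ √(n : ℝ) := fun ω => norm_green_le_sqrt (hXr ω) hy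
  have hC := fun A => h.norm_contract_skewCov_le r A
  have i1 : Integrable (fun ω => (T * (D ω * G ω)).trace) P :=
    h.integrable_trace_mul T (measurable_mul_entries hDm hGm) 1 1 fun ω => by
      rw [one_mul, pow_one]
      exact (hGR ω _).trans (hD1 ω)
  have i2 : Integrable (fun ω => (T * (contract (skewCov P a r) (G ω) * G ω)).trace) P :=
    h.integrable_trace_mul T (measurable_mul_entries (measurable_contract _ hGm) hGm) 0
      ((n : ℝ)⁻¹ * √(n : ℝ)) fun ω => by
      rw [pow_zero, mul_one]
      exact (hGR ω _).trans ((hC _).trans (mul_le_mul_of_nonneg_left (hGn ω) (by positivity)))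
  have i3 : Integrable (fun ω => (T * (contract (skewCov P a r) (Gr ω) * Gr ω)).trace) P :=
    h.integrable_trace_mul T (measurable_mul_entries (measurable_contract _ hGrm) hGrm) 0
      ((n : ℝ)⁻¹ * √(n : ℝ)) fun ω => by
      rw [pow_zero, mul_one]
      exact (hGrR ω _).trans ((hC _).trans (mul_le_mul_of_nonneg_left (hGrn ω) (by positivity)))
  have i4 : Integrable (fun ω => (T * (D ω * Gr ω)).trace) P :=
    h.integrable_trace_mul T (measurable_mul_entries hDm hGrm) 1 1 fun ω => by
      rw [one_mul, pow_one]
      exact (hGrR ω _).trans (hD1 ω)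
  have i5 : Integrable (fun ω => (T * (D ω * Gr ω * D ω * Gr ω)).trace) P :=
    h.integrable_trace_mul T (measurable_mul_entries (measurable_mul_entries
      (measurable_mul_entries hDm hGrm) hDm) hGrm) 2 1 fun ω => by
      rw [one_mul, sq]
      refine (hGrR ω _).trans ((norm_mul_le _ _).trans ?_)
      exact mul_le_mul ((hGrR ω _).trans (hD1 ω)) (hD1 ω) (norm_nonneg _) (hK0 ω)
  have hrem : ∀ ω, ‖((T * (D ω * G ω)).trace +
      (T * (contract (skewCov P a r) (G ω) * G ω)).trace) - ((T * (D ω * Gr ω)).trace -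
      (T * (D ω * Gr ω * D ω * Gr ω)).trace +
      (T * (contract (skewCov P a r) (Gr ω) * Gr ω)).trace)‖ ≤
      3 * ‖T‖ * (n : ℝ)⁻¹ * entryBound a ω ^ 8 := by
    intro ω
    have e1 : D ω * G ω = D ω * Gr ω - D ω * Gr ω * D ω * Gr ω +
        D ω * (Gr ω * (D ω * (Gr ω * (D ω * G ω)))) := by
      have e := green_eq_removeSkew_expansion (hX ω) hy0 r
      change G ω = Gr ω - Gr ω * D ω * Gr ω + Gr ω * D ω * Gr ω * D ω * G ω at e
      conv_lhs => rw [e]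
      simp only [mul_add, mul_sub, Matrix.mul_assoc]
    have e2 : contract (skewCov P a r) (G ω) * G ω - contract (skewCov P a r) (Gr ω) * Gr ω =
        contract (skewCov P a r) (G ω - Gr ω) * G ω +
        contract (skewCov P a r) (Gr ω) * (G ω - Gr ω) := by
      rw [contract_sub, sub_mul, mul_sub]
      abel
    have e3 : G ω - Gr ω = -(Gr ω * D ω * G ω) := green_sub_green_removeSkew' (hX ω) hy0 r
    have e4 : ((T * (D ω * G ω)).trace +
      (T * (contract (skewCov P a r) (G ω) * G ω)).trace) - ((T * (D ω * Gr ω)).trace -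
      (T * (D ω * Gr ω * D ω * Gr ω)).trace +
      (T * (contract (skewCov P a r) (Gr ω) * Gr ω)).trace) =
      (T * (D ω * (Gr ω * (D ω * (Gr ω * (D ω * G ω)))) +
        (contract (skewCov P a r) (G ω - Gr ω) * G ω +
        contract (skewCov P a r) (Gr ω) * (G ω - Gr ω)))).trace := by
      have e5 := congrArg (fun A => (T * A).trace) e1
      simp only [mul_add, mul_sub, trace_add, trace_sub] at e5
      rw [← e2]
      simp only [mul_add, mul_sub, trace_add, trace_sub]
      rw [e5]
      ring
    set K := entryBound a ω with hK
    have hκ : 0 ≤ K / √(n : ℝ) := div_nonneg (hK0 ω) hs.le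
    have hDG : ‖D ω * G ω‖ ≤ K := by
      refine (hDl ω _).trans ?_
      calc K / √(n : ℝ) * ‖G ω‖ ≤ K / √(n : ℝ) * √(n : ℝ) := by gcongr; exact hGn ω
        _ = K := by field_simp
    have b1 : ‖D ω * (Gr ω * (D ω * (Gr ω * (D ω * G ω))))‖ ≤ (n : ℝ)⁻¹ * K ^ 3 := by
      calc _ ≤ K / √(n : ℝ) * (K / √(n : ℝ) * K) := by
            refine (hDl ω _).trans (mul_le_mul_of_nonneg_left ((hGrl ω _).trans ?_) hκ)
            refine (hDl ω _).trans (mul_le_mul_of_nonneg_left ((hGrl ω _).trans hDG) hκ)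
        _ = (n : ℝ)⁻¹ * K ^ 3 := by
          have e6 : K / √(n : ℝ) * (K / √(n : ℝ) * K) = K ^ 3 / (√(n : ℝ) * √(n : ℝ)) := by
            field_simp
          rw [e6, hss, div_eq_inv_mul]
    have b2 : ‖contract (skewCov P a r) (G ω - Gr ω) * G ω‖ ≤ (n : ℝ)⁻¹ * K := by
      refine (hGR ω _).trans ((hC _).trans (mul_le_mul_of_nonneg_left ?_ (by positivity)))
      rw [e3, norm_neg, Matrix.mul_assoc]
      exact (hGrl ω _).trans hDG
    have b3 : ‖contract (skewCov P a r) (Gr ω) * (G ω - Gr ω)‖ ≤ (n : ℝ)⁻¹ * K := by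
      rw [e3, mul_neg, norm_neg, ← Matrix.mul_assoc, ← Matrix.mul_assoc]
      refine (hGR ω _).trans ((hDr ω _).trans ?_)
      calc K / √(n : ℝ) * ‖contract (skewCov P a r) (Gr ω) * Gr ω‖
          ≤ K / √(n : ℝ) * ((n : ℝ)⁻¹ * √(n : ℝ)) := by
            gcongr
            exact (hGrR ω _).trans ((hC _).trans
              (mul_le_mul_of_nonneg_left (hGrn ω) (by positivity)))
        _ = (n : ℝ)⁻¹ * K := by field_simp
    have hK1 : 1 ≤ K := one_le_entryBound a ω
    have hK3 : (n : ℝ)⁻¹ * K ^ 3 ≤ (n : ℝ)⁻¹ * K ^ 8 :=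
      mul_le_mul_of_nonneg_left (pow_le_pow_right₀ hK1 (by norm_num)) (by positivity)
    have hK8 : (n : ℝ)⁻¹ * K ≤ (n : ℝ)⁻¹ * K ^ 8 :=
      mul_le_mul_of_nonneg_left (le_self_pow₀ hK1 (by norm_num)) (by positivity)
    rw [e4]
    refine (norm_trace_mul_le _ _).trans ?_
    calc _ ≤ ‖T‖ * ((n : ℝ)⁻¹ * K ^ 8 + ((n : ℝ)⁻¹ * K ^ 8 + (n : ℝ)⁻¹ * K ^ 8)) := by
          gcongr
          exact (norm_add_le _ _).trans (add_le_add (b1.trans hK3)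
            ((norm_add_le _ _).trans (add_le_add (b2.trans hK8) (b3.trans hK8))))
      _ = _ := by ring
  -- The subtracted expression has mean zero by `hz` and `hq`, so only the pointwise remainder
  -- `hrem` has to be integrated.
  have hint : ∫ ω, ((T * (D ω * G ω)).trace +
      (T * (contract (skewCov P a r) (G ω) * G ω)).trace) ∂P =
      ∫ ω, (((T * (D ω * G ω)).trace +
      (T * (contract (skewCov P a r) (G ω) * G ω)).trace) - ((T * (D ω * Gr ω)).trace -
      (T * (D ω * Gr ω * D ω * Gr ω)).trace +
      (T * (contract (skewCov P a r) (Gr ω) * Gr ω)).trace)) ∂P := by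
    have i45 : Integrable (fun ω => (T * (D ω * Gr ω)).trace -
        (T * (D ω * Gr ω * D ω * Gr ω)).trace) P := i4.sub i5
    have i453 : Integrable (fun ω => (T * (D ω * Gr ω)).trace -
        (T * (D ω * Gr ω * D ω * Gr ω)).trace +
        (T * (contract (skewCov P a r) (Gr ω) * Gr ω)).trace) P := i45.add i3
    have i12 : Integrable (fun ω => (T * (D ω * G ω)).trace +
        (T * (contract (skewCov P a r) (G ω) * G ω)).trace) P := i1.add i2
    rw [integral_sub i12 i453, integral_add i45 i3, integral_sub i4 i5, hz, hq]
    simp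
  rw [hint]
  refine (norm_integral_le_integral_norm _).trans ?_
  rw [← integral_const_mul]
  exact integral_mono_of_nonneg (Eventually.of_forall fun ω => norm_nonneg _)
    ((h.integrable_entryBound_pow 8).const_mul _) (Eventually.of_forall hrem)

/-- The approximate Schwinger–Dyson equation. -/
theorem norm_integral_trace_mul_green_add_le :
    ‖∫ ω, (T * (complexify (ensembleMatrix a ω) * green y (ensembleMatrix a ω) +
      contract (entryCov P a) (green y (ensembleMatrix a ω)) *
        green y (ensembleMatrix a ω))).trace ∂P‖ ≤ 6 * ‖T‖ * ∫ ω, entryBound a ω ^ 8 ∂P := by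
  have hX := fun ω => isSymm_ensembleMatrix a ω
  have hGm := h.measurable_green y
  have e : ∀ ω, (T * (complexify (ensembleMatrix a ω) * green y (ensembleMatrix a ω) +
      contract (entryCov P a) (green y (ensembleMatrix a ω)) *
        green y (ensembleMatrix a ω))).trace =
      ∑ r : Fin (2 * n), ((T * (skewPart r (complexify (ensembleMatrix a ω)) *
        green y (ensembleMatrix a ω))).trace +
      (T * (contract (skewCov P a r) (green y (ensembleMatrix a ω)) *
        green y (ensembleMatrix a ω))).trace) := fun ω => by
    rw [Fin.sum_univ_eq_sum_range (fun r => (T * (skewPart r (complexify (ensembleMatrix a ω)) *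
        green y (ensembleMatrix a ω))).trace +
      (T * (contract (skewCov P a r) (green y (ensembleMatrix a ω)) *
        green y (ensembleMatrix a ω))).trace), Finset.sum_add_distrib, ← trace_sum, ← trace_sum,
      ← Finset.mul_sum, ← Finset.mul_sum, ← Finset.sum_mul, ← Finset.sum_mul, sum_skewPart,
      ← contract_entryCov, mul_add, trace_add]
  simp only [e]
  rw [integral_finsetSum]
  · refine (norm_sum_le _ _).trans ((Finset.sum_le_sum fun r _ =>
      h.norm_integral_trace_skewPart_mul_green_add_le hy T r).trans ?_)
    rw [Finset.sum_const, Finset.card_univ, Fintype.card_fin, nsmul_eq_mul]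
    have h1 : (n : ℝ) * (n : ℝ)⁻¹ ≤ 1 := mul_inv_le_one
    have h2 : 0 ≤ 6 * ‖T‖ * ∫ ω, entryBound a ω ^ 8 ∂P := mul_nonneg (by positivity)
      (integral_nonneg fun ω => by positivity)
    push_cast
    nlinarith
  · intro r _
    refine (h.integrable_trace_mul T (measurable_mul_entries (measurable_skewPart
      h.measurable_complexify r) hGm) 1 1 fun ω => ?_).add (h.integrable_trace_mul T
      (measurable_mul_entries (measurable_contract _ hGm) hGm) 0 ((n : ℝ)⁻¹ * √(n : ℝ))
      fun ω => ?_)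
    · rw [one_mul, pow_one]
      exact (norm_mul_green_le_self (hX ω) hy _).trans (norm_skewPart_ensembleMatrix_le a ω r)
    · rw [pow_zero, mul_one]
      exact (norm_mul_green_le_self (hX ω) hy _).trans ((h.norm_contract_skewCov_le r _).trans
        (mul_le_mul_of_nonneg_left (norm_green_le_sqrt (hX ω) hy) (by positivity)))

end IsSkewEnsemble

end MeanEquation

/-! ### The self-consistent equation for the mean resolvent and its stability -/

section MeanResolvent

open scoped Matrix.Norms.Frobenius
open Matrix

variable {Ω : Type*} [MeasurableSpace Ω] {n : ℕ} {P : Measure Ω} {a : Fin n → Fin n → Ω → ℝ}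

theorem contract_apply_eq_trace (κ : Fin n → Fin n → Fin n → Fin n → ℝ)
    (A : Matrix (Fin n) (Fin n) ℂ) (p v : Fin n) :
    contract κ A p v = ((Matrix.of fun u q => (κ p q u v : ℂ)) * A).trace := by
  rw [contract_apply, Finset.sum_comm]
  rfl

theorem sq_norm_integral_le [IsProbabilityMeasure P] {f : Ω → ℂ} (hf : Integrable f P)
    (hf2 : Integrable (fun ω => ‖f ω‖ ^ 2) P) : ‖∫ ω, f ω ∂P‖ ^ 2 ≤ ∫ ω, ‖f ω‖ ^ 2 ∂P :=
  (pow_le_pow_left₀ (norm_nonneg _) (norm_integral_le_integral_norm f) 2).trans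
    (sq_integral_le_integral_sq hf.norm hf2)

namespace IsSkewEnsemble

variable (h : IsSkewEnsemble P a) [IsProbabilityMeasure P] {y : ℝ} (hy : 1 ≤ y)
include h hy

theorem integrable_green (p q : Fin n) : Integrable (fun ω => green y (ensembleMatrix a ω) p q) P :=
  Integrable.of_bound (h.measurable_green y p q).aestronglyMeasurable (√(n : ℝ))
    (Eventually.of_forall fun ω => (norm_entry_le_norm _ p q).trans
      (norm_green_le_sqrt (isSymm_ensembleMatrix a ω) hy))

theorem mul_meanGreen_apply (A : Matrix (Fin n) (Fin n) ℂ) (p q : Fin n) :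
    (A * meanGreen P y a) p q = ∫ ω, (A * green y (ensembleMatrix a ω)) p q ∂P := by
  simp only [Matrix.mul_apply, meanGreen, Matrix.of_apply]
  rw [integral_finsetSum _ fun i _ => (h.integrable_green hy i q).const_mul _]
  simp only [integral_const_mul]

theorem integrable_mul_green (A : Matrix (Fin n) (Fin n) ℂ) (p q : Fin n) :
    Integrable (fun ω => (A * green y (ensembleMatrix a ω)) p q) P := by
  simp only [Matrix.mul_apply]
  exact integrable_finsetSum _ fun i _ => (h.integrable_green hy i q).const_mul _

theorem trace_mul_meanGreen (A : Matrix (Fin n) (Fin n) ℂ) :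
    (A * meanGreen P y a).trace = ∫ ω, (A * green y (ensembleMatrix a ω)).trace ∂P := by
  simp only [Matrix.trace, Matrix.diag, h.mul_meanGreen_apply hy]
  exact (integral_finsetSum _ fun i _ => h.integrable_mul_green hy A i i).symm

theorem integrable_trace_mul_green (A : Matrix (Fin n) (Fin n) ℂ) :
    Integrable (fun ω => (A * green y (ensembleMatrix a ω)).trace) P := by
  simp only [Matrix.trace, Matrix.diag]
  exact integrable_finsetSum _ fun i _ => h.integrable_mul_green hy A i i

/-- The resolvent bound survives taking expectations, by Jensen's inequality in each entry. -/
theorem norm_mul_meanGreen_le (A : Matrix (Fin n) (Fin n) ℂ) : ‖A * meanGreen P y a‖ ≤ ‖A‖ := by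
  refine abs_le_of_sq_le_sq' ?_ (norm_nonneg _) |>.2
  have hle : ∀ ω, ‖A * green y (ensembleMatrix a ω)‖ ≤ ‖A‖ := fun ω =>
    norm_mul_green_le_self (isSymm_ensembleMatrix a ω) hy A
  have hi2 : ∀ p q, Integrable (fun ω => ‖(A * green y (ensembleMatrix a ω)) p q‖ ^ 2) P :=
    fun p q => Integrable.of_bound ((h.integrable_mul_green hy A p q).aestronglyMeasurable.norm.pow 2)
      (‖A‖ ^ 2) (Eventually.of_forall fun ω => by
        rw [norm_pow, norm_norm]
        exact pow_le_pow_left₀ (norm_nonneg _) ((norm_entry_le_norm _ p q).trans (hle ω)) 2)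
  have h1 : ‖A * meanGreen P y a‖ ^ 2 ≤ ∫ ω, ‖A * green y (ensembleMatrix a ω)‖ ^ 2 ∂P := by
    simp only [frobenius_norm_sq]
    rw [integral_finsetSum _ fun p _ => integrable_finsetSum _ fun q _ => hi2 p q]
    refine Finset.sum_le_sum fun p _ => ?_
    rw [integral_finsetSum _ fun q _ => hi2 p q]
    refine Finset.sum_le_sum fun q _ => ?_
    rw [h.mul_meanGreen_apply hy]
    exact sq_norm_integral_le (h.integrable_mul_green hy A p q) (hi2 p q)
  refine h1.trans ((le_abs_self _).trans (abs_integral_le_of_abs_le P fun ω => ?_))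
  rw [abs_of_nonneg (by positivity)]
  exact pow_le_pow_left₀ (norm_nonneg _) (hle ω) 2

/-- Each entry of the contraction is a linear statistic tr(SG) with S formed from the coefficients
κ(p,·,·,v). The variance bound applies entry by entry and the squared norms of these S add up. -/
theorem integral_norm_contract_sub_sq_le {M : ℝ} (hM0 : 0 ≤ M)
    (hM : ∀ p q, p ≤ q → ∫ ω, |a p q ω| ^ 4 ∂P ≤ M) (κ : Fin n → Fin n → Fin n → Fin n → ℝ) :
    Integrable (fun ω => ‖contract κ (green y (ensembleMatrix a ω)) -
      contract κ (meanGreen P y a)‖ ^ 2) P ∧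
    ∫ ω, ‖contract κ (green y (ensembleMatrix a ω)) - contract κ (meanGreen P y a)‖ ^ 2 ∂P ≤
      (30 + 16 * M) * ∑ p, ∑ v, ∑ u, ∑ q, κ p q u v ^ 2 := by
  have hentry : ∀ p v ω, (contract κ (green y (ensembleMatrix a ω)) -
      contract κ (meanGreen P y a)) p v =
      ((Matrix.of fun u q => (κ p q u v : ℂ)) * green y (ensembleMatrix a ω)).trace -
      ∫ ω, ((Matrix.of fun u q => (κ p q u v : ℂ)) * green y (ensembleMatrix a ω)).trace ∂P :=
    fun p v ω => by
      rw [Matrix.sub_apply, contract_apply_eq_trace, contract_apply_eq_trace,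
        h.trace_mul_meanGreen hy]
  have hi : ∀ p v, Integrable (fun ω => ‖(contract κ (green y (ensembleMatrix a ω)) -
      contract κ (meanGreen P y a)) p v‖ ^ 2) P := fun p v => by
    simp only [hentry]
    set S : Matrix (Fin n) (Fin n) ℂ := Matrix.of fun u q => (κ p q u v : ℂ)
    set c := ∫ ω, (S * green y (ensembleMatrix a ω)).trace ∂P
    refine Integrable.of_bound (((h.integrable_trace_mul_green hy S).sub
      (integrable_const c)).aestronglyMeasurable.norm.pow 2) ((‖S‖ * √(n : ℝ) + ‖c‖) ^ 2)
      (Eventually.of_forall fun ω => ?_)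
    rw [norm_pow, norm_norm]
    exact pow_le_pow_left₀ (norm_nonneg _) ((norm_sub_le _ _).trans (add_le_add
      (norm_trace_mul_green_le S (isSymm_ensembleMatrix a ω) hy) le_rfl)) 2
  simp only [frobenius_norm_sq]
  refine ⟨integrable_finsetSum _ fun p _ => integrable_finsetSum _ fun v _ => hi p v, ?_⟩
  rw [integral_finsetSum _ fun p _ => integrable_finsetSum _ fun v _ => hi p v, Finset.mul_sum]
  refine Finset.sum_le_sum fun p _ => ?_
  rw [integral_finsetSum _ fun v _ => hi p v, Finset.mul_sum]
  refine Finset.sum_le_sum fun v _ => ?_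
  simp only [hentry]
  refine (h.integral_norm_trace_sub_sq_le hM0 hM hy _).trans_eq ?_
  rw [frobenius_norm_sq]
  simp

/-- The entrywise expectation of the resolvent approximately solves the self-consistent equation. -/
theorem norm_meanGreen_equation_le {M : ℝ} (hM0 : 0 ≤ M)
    (hM : ∀ p q, p ≤ q → ∫ ω, |a p q ω| ^ 4 ∂P ≤ M) :
    ‖1 + ((y : ℂ) * Complex.I) • meanGreen P y a +
      contract (entryCov P a) (meanGreen P y a) * meanGreen P y a‖ ≤
    6 * ∫ ω, entryBound a ω ^ 8 ∂P +
      √((30 + 16 * M) * ∑ p, ∑ v, ∑ u, ∑ q, entryCov P a p q u v ^ 2) := by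
  set R := 1 + ((y : ℂ) * Complex.I) • meanGreen P y a +
      contract (entryCov P a) (meanGreen P y a) * meanGreen P y a with hR
  set δ := √((30 + 16 * M) * ∑ p, ∑ v, ∑ u, ∑ q, entryCov P a p q u v ^ 2) with hδ
  have hX := fun ω => isSymm_ensembleMatrix a ω
  have hy0 : y ≠ 0 := by linarith
  obtain ⟨hVi, hV⟩ := h.integral_norm_contract_sub_sq_le hy hM0 hM (entryCov P a)
  have hGm := h.measurable_green y
  have hCm : ∀ p q, Measurable fun ω => contract (entryCov P a) (green y (ensembleMatrix a ω)) p q :=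
    measurable_contract _ hGm
  have hdm : ∀ p q, Measurable fun ω => (contract (entryCov P a) (green y (ensembleMatrix a ω)) -
      contract (entryCov P a) (meanGreen P y a)) p q := fun p q => (hCm p q).sub_const _
  have hNm := measurable_norm_of_entries hdm
  have hNi : Integrable (fun ω => ‖contract (entryCov P a) (green y (ensembleMatrix a ω)) -
      contract (entryCov P a) (meanGreen P y a)‖) P :=
    ((memLp_two_iff_integrable_sq hNm.aestronglyMeasurable).2 hVi).integrable one_le_two
  have hNδ : ∫ ω, ‖contract (entryCov P a) (green y (ensembleMatrix a ω)) -
      contract (entryCov P a) (meanGreen P y a)‖ ∂P ≤ δ :=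
    Real.le_sqrt_of_sq_le ((sq_integral_le_integral_sq hNi hVi).trans hV)
  -- Duality: the available estimates are for traces against a fixed matrix and are linear in its
  -- norm. Testing against the adjoint of the residual gives ‖R‖² ≤ ‖R‖ · (error).
  set T := Rᴴ with hT
  have hTR : ‖T‖ = ‖R‖ := frobenius_norm_conjTranspose R
  have i1 : Integrable (fun ω => (T * (complexify (ensembleMatrix a ω) *
      green y (ensembleMatrix a ω) + contract (entryCov P a) (green y (ensembleMatrix a ω)) *
        green y (ensembleMatrix a ω))).trace) P := by
    refine h.integrable_trace_mul T (fun p q => ?_) 0 (√(n : ℝ) + y * √(n : ℝ) + 2 * √(n : ℝ))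
      fun ω => ?_
    · exact (measurable_mul_entries h.measurable_complexify hGm p q).add
        (measurable_mul_entries hCm hGm p q)
    · rw [complexify_mul_green (hX ω) hy0, pow_zero, mul_one]
      have hG := norm_green_le_sqrt (hX ω) hy
      refine (norm_add_le _ _).trans (add_le_add ((norm_add_le _ _).trans (add_le_add
        norm_one_fin.le ((norm_smul_le _ _).trans ?_))) ?_)
      · have hz : ‖(y : ℂ) * Complex.I‖ = y := by
          rw [norm_mul, Complex.norm_I, mul_one, Complex.norm_real,
            Real.norm_of_nonneg (by linarith)]
        rw [hz]
        exact mul_le_mul_of_nonneg_left hG (by linarith)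
      · exact (norm_mul_green_le_self (hX ω) hy _).trans ((h.norm_contract_entryCov_le _).trans
          (mul_le_mul_of_nonneg_left hG zero_le_two))
  have i2 : Integrable (fun ω => (T * ((contract (entryCov P a) (green y (ensembleMatrix a ω)) -
      contract (entryCov P a) (meanGreen P y a)) * green y (ensembleMatrix a ω))).trace) P := by
    refine Integrable.mono' (hNi.const_mul ‖T‖) (measurable_trace_of_entries
      (measurable_mul_entries (A := fun _ => T) (fun _ _ => measurable_const)
      (measurable_mul_entries hdm hGm))).aestronglyMeasurable (Eventually.of_forall fun ω => ?_)
    exact (norm_trace_mul_le _ _).trans (mul_le_mul_of_nonneg_left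
      (norm_mul_green_le_self (hX ω) hy _) (norm_nonneg _))
  -- The first integrand has the random Σ(G) in front of G; subtracting the second puts the
  -- deterministic Σ(Q) there. What remains is affine in G, so its expectation is obtained by
  -- inserting Q.
  have key : (T * R).trace = ∫ ω, (T * (complexify (ensembleMatrix a ω) *
      green y (ensembleMatrix a ω) + contract (entryCov P a) (green y (ensembleMatrix a ω)) *
        green y (ensembleMatrix a ω))).trace ∂P -
      ∫ ω, (T * ((contract (entryCov P a) (green y (ensembleMatrix a ω)) -
      contract (entryCov P a) (meanGreen P y a)) * green y (ensembleMatrix a ω))).trace ∂P := by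
    rw [← integral_sub i1 i2]
    have e : ∀ ω, (T * (complexify (ensembleMatrix a ω) *
      green y (ensembleMatrix a ω) + contract (entryCov P a) (green y (ensembleMatrix a ω)) *
        green y (ensembleMatrix a ω))).trace -
      (T * ((contract (entryCov P a) (green y (ensembleMatrix a ω)) -
      contract (entryCov P a) (meanGreen P y a)) * green y (ensembleMatrix a ω))).trace =
      T.trace + ((((y : ℂ) * Complex.I) • T + T * contract (entryCov P a) (meanGreen P y a)) *
        green y (ensembleMatrix a ω)).trace := fun ω => by
      rw [complexify_mul_green (hX ω) hy0, ← trace_sub, ← trace_add]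
      congr 1
      simp only [mul_add, add_mul, sub_mul, mul_sub, smul_mul_assoc, mul_smul_comm, mul_one,
        Matrix.mul_assoc]
      abel
    simp only [e]
    rw [integral_add (integrable_const _) (h.integrable_trace_mul_green hy _),
      ← h.trace_mul_meanGreen hy, hR]
    simp only [mul_add, add_mul, smul_mul_assoc, mul_smul_comm, mul_one, Matrix.mul_assoc,
      trace_add, integral_const, probReal_univ, one_smul]
    ring
  have h1 := h.norm_integral_trace_mul_green_add_le hy T
  have h2 : ‖∫ ω, (T * ((contract (entryCov P a) (green y (ensembleMatrix a ω)) -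
      contract (entryCov P a) (meanGreen P y a)) * green y (ensembleMatrix a ω))).trace ∂P‖ ≤
      ‖T‖ * δ := by
    refine (norm_integral_le_integral_norm _).trans ?_
    refine le_trans ?_ (mul_le_mul_of_nonneg_left hNδ (norm_nonneg _))
    rw [← integral_const_mul]
    exact integral_mono_of_nonneg (Eventually.of_forall fun ω => norm_nonneg _)
      (hNi.const_mul _) (Eventually.of_forall fun ω => (norm_trace_mul_le _ _).trans
        (mul_le_mul_of_nonneg_left (norm_mul_green_le_self (hX ω) hy _) (norm_nonneg _)))
  have h3 : ‖R‖ ^ 2 ≤ ‖R‖ * (6 * ∫ ω, entryBound a ω ^ 8 ∂P + δ) := by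
    have h4 : ‖(T * R).trace‖ = ‖R‖ ^ 2 := by
      rw [hT, trace_conjTranspose_mul_self, Complex.norm_real, Real.norm_of_nonneg (by positivity)]
    rw [← h4, key]
    refine (norm_sub_le _ _).trans ((add_le_add h1 h2).trans_eq ?_)
    rw [hTR]
    ring
  have hE : 0 ≤ 6 * ∫ ω, entryBound a ω ^ 8 ∂P + δ :=
    add_nonneg (mul_nonneg (by norm_num) (integral_nonneg fun ω => by positivity))
      (Real.sqrt_nonneg _)
  rcases (norm_nonneg R).eq_or_lt with h0 | h0
  · rw [← h0]
    exact hE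
  · rw [sq] at h3
    exact le_of_mul_le_mul_left h3 h0

/-- Multiplying the residual by m and using 1 + iym + m² = 0 gives the exact identity Q - m = m Σ(Q
- m) Q - m R. The map A ↦ Σ(A)Q has norm at most 2, so its term is absorbed on the left. -/
theorem norm_meanGreen_sub_le {m : ℂ} (hm : 1 + ((y : ℂ) * Complex.I) * m + m ^ 2 = 0) :
    ‖meanGreen P y a - m • (1 : Matrix (Fin n) (Fin n) ℂ)‖ * (1 - 2 * ‖m‖) ≤
      ‖m‖ * ‖1 + ((y : ℂ) * Complex.I) • meanGreen P y a +
      contract (entryCov P a) (meanGreen P y a) * meanGreen P y a‖ := by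
  set Q := meanGreen P y a with hQ
  set R := 1 + ((y : ℂ) * Complex.I) • Q + contract (entryCov P a) Q * Q with hR
  have e1 : contract (entryCov P a) (Q - m • (1 : Matrix (Fin n) (Fin n) ℂ)) =
      contract (entryCov P a) Q - m • (1 : Matrix (Fin n) (Fin n) ℂ) := by
    rw [contract_sub, contract_smul, h.contract_entryCov_one]
  have e2 : Q - m • (1 : Matrix (Fin n) (Fin n) ℂ) =
      m • (contract (entryCov P a) (Q - m • (1 : Matrix (Fin n) (Fin n) ℂ)) * Q) - m • R := by
    rw [e1, hR]
    have e3 : (m * ((y : ℂ) * Complex.I)) • Q = -((1 + m ^ 2) • Q) := by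
      rw [← neg_smul]
      congr 1
      linear_combination hm
    simp only [sub_mul, smul_sub, smul_add, smul_mul_assoc, one_mul, smul_smul, e3, add_smul,
      one_smul, sq]
    abel
  have h1 : ‖Q - m • (1 : Matrix (Fin n) (Fin n) ℂ)‖ ≤
      ‖m‖ * (2 * ‖Q - m • (1 : Matrix (Fin n) (Fin n) ℂ)‖) + ‖m‖ * ‖R‖ := by
    conv_lhs => rw [e2]
    refine (norm_sub_le _ _).trans (add_le_add ?_ (norm_smul_le _ _))
    refine (norm_smul_le _ _).trans (mul_le_mul_of_nonneg_left ?_ (norm_nonneg _))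
    exact (h.norm_mul_meanGreen_le hy _).trans (h.norm_contract_entryCov_le _)
  linarith

theorem norm_integral_trace_green_sub_le (m : ℂ) :
    ‖∫ ω, (green y (ensembleMatrix a ω)).trace ∂P - n * m‖ ≤
      √(n : ℝ) * ‖meanGreen P y a - m • (1 : Matrix (Fin n) (Fin n) ℂ)‖ := by
  have e : ∫ ω, (green y (ensembleMatrix a ω)).trace ∂P - n * m =
      (1 * (meanGreen P y a - m • (1 : Matrix (Fin n) (Fin n) ℂ))).trace := by
    have h1 := h.trace_mul_meanGreen hy 1
    simp only [one_mul] at h1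
    rw [one_mul, trace_sub, h1, trace_smul, trace_one, Fintype.card_fin, smul_eq_mul, mul_comm m]
  rw [e]
  refine (norm_trace_mul_le _ _).trans_eq ?_
  rw [norm_one_fin]

end IsSkewEnsemble

end MeanResolvent

/-! ### The sum of the squared covariances -/

section CovarianceSum

variable {Ω : Type*} [MeasurableSpace Ω] {n : ℕ} {P : Measure Ω} {a : Fin n → Fin n → Ω → ℝ}

theorem sum_ite_le_of_unique {ι : Type*} [Fintype ι] (p : ι → Prop) [DecidablePred p]
    (hp : ∀ i j, p i → p j → i = j) {x : ℝ} (hx : 0 ≤ x) : ∑ i, (if p i then x else 0) ≤ x := by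
  by_cases h : ∃ i, p i
  · obtain ⟨i, hi⟩ := h
    rw [Finset.sum_eq_single_of_mem i (Finset.mem_univ _) fun j _ hj =>
      if_neg fun h' => hj (hp j i h' hi), if_pos hi]
  · push Not at h
    rw [Finset.sum_eq_zero fun i _ => if_neg (h i)]
    exact hx

/-- Each distance τ from `p` is attained at most twice, once on either side. -/
theorem sum_natAbs_sub_le {c : ℕ → ℝ} (hc : ∀ τ, 0 ≤ c τ) (p : Fin n) :
    ∑ u : Fin n, c ((p : ℤ) - u).natAbs ≤ 2 * ∑ τ ∈ Finset.range n, c τ := by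
  have h1 : ∀ u : Fin n, c ((p : ℤ) - u).natAbs ≤ ∑ τ ∈ Finset.range n,
      ((if (u : ℕ) = p + τ then c τ else 0) + if (p : ℕ) = u + τ then c τ else 0) := by
    intro u
    have hnn : ∀ τ ∈ Finset.range n,
        0 ≤ (if (u : ℕ) = p + τ then c τ else 0) + if (p : ℕ) = u + τ then c τ else 0 :=
      fun τ _ => add_nonneg (by split_ifs <;> simp [hc]) (by split_ifs <;> simp [hc])
    refine le_trans ?_ (Finset.single_le_sum hnn
      (Finset.mem_range.2 (by omega : ((p : ℤ) - u).natAbs < n)))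
    rcases le_total (p : ℕ) u with hpu | hpu
    · rw [if_pos (by omega : (u : ℕ) = p + ((p : ℤ) - u).natAbs)]
      refine le_add_of_nonneg_right ?_
      split_ifs <;> simp [hc]
    · rw [if_pos (by omega : (p : ℕ) = u + ((p : ℤ) - u).natAbs)]
      refine le_add_of_nonneg_left ?_
      split_ifs <;> simp [hc]
  refine (Finset.sum_le_sum fun u _ => h1 u).trans ?_
  rw [Finset.sum_comm, Finset.mul_sum]
  refine Finset.sum_le_sum fun τ _ => ?_
  rw [Finset.sum_add_distrib, two_mul]
  exact add_le_add (sum_ite_le_of_unique _ (fun i j hi hj => by ext; omega) (hc τ))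
    (sum_ite_le_of_unique _ (fun i j hi hj => by ext; omega) (hc τ))

namespace IsSkewEnsemble

variable (h : IsSkewEnsemble P a)
include h

theorem integral_entry_mul_eq_covariance (p q u v : Fin n) :
    ∫ ω, ensembleMatrix a ω p q * ensembleMatrix a ω u v ∂P =
      (n : ℝ)⁻¹ * covariance (symmEntry a p q) (symmEntry a u v) P := by
  have e : ∀ ω, ensembleMatrix a ω p q * ensembleMatrix a ω u v =
      (n : ℝ)⁻¹ * (symmEntry a p q ω * symmEntry a u v ω) := fun ω => by
    rw [ensembleMatrix_apply, ensembleMatrix_apply, mul_mul_mul_comm, ← sq, div_pow, one_pow,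
      Real.sq_sqrt (by positivity), one_div]
  simp only [e]
  rw [integral_const_mul, covariance, h.integral_symmEntry, h.integral_symmEntry]
  simp

/-- One factor of the square is bounded by 1/n through the variances and the other by c/n. Given p,
u, v, the index q is determined, so the total is at most n⁻² · n · 4n ∑ c(τ); the bound is linear in
c, as the o(n) condition requires. -/
theorem sum_entryCov_sq_le [IsProbabilityMeasure P] {c : ℕ → ℝ} (hc : ∀ τ, 0 ≤ c τ)
    (hcov : ∀ p q r s : Fin n, p ≤ q → r ≤ s → (p : ℕ) + q = r + s →
      |covariance (a p q) (a r s) P| = c ((p : ℤ) - r).natAbs) :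
    ∑ p, ∑ v, ∑ u, ∑ q, entryCov P a p q u v ^ 2 ≤ 4 * ∑ τ ∈ Finset.range n, c τ := by
  have h1 : ∀ p v u q : Fin n, entryCov P a p q u v ^ 2 ≤ if (p : ℕ) + q = u + v then
      (n : ℝ)⁻¹ ^ 2 * (c ((p : ℤ) - u).natAbs + c ((p : ℤ) - v).natAbs) else 0 := by
    intro p v u q
    rw [entryCov]
    split_ifs with hpq
    · have h2 := h.abs_integral_entry_mul_le p q u v
      have h3 : |covariance (symmEntry a p q) (symmEntry a u v) P| ≤
          c ((p : ℤ) - u).natAbs + c ((p : ℤ) - v).natAbs := by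
        rw [symmEntry, symmEntry, hcov _ _ _ _ min_le_max min_le_max
          (by rw [min_add_max_val, min_add_max_val, hpq])]
        -- Positions below the diagonal are reflected first. As p + q = u + v, the distance of the
        -- reflected rows is |p - u| or |p - v|, for instance |q - u| = |p - v|.
        have h4 : (((min p q : Fin n) : ℕ) - ((min u v : Fin n) : ℕ) : ℤ).natAbs =
            ((p : ℤ) - u).natAbs ∨ (((min p q : Fin n) : ℕ) - ((min u v : Fin n) : ℕ) : ℤ).natAbs =
            ((p : ℤ) - v).natAbs := by
          rcases le_total p q with h5 | h5 <;> rcases le_total u v with h6 | h6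
          · rw [min_eq_left h5, min_eq_left h6]
            exact Or.inl rfl
          · rw [min_eq_left h5, min_eq_right h6]
            exact Or.inr rfl
          · rw [min_eq_right h5, min_eq_left h6]
            right
            omega
          · rw [min_eq_right h5, min_eq_right h6]
            left
            omega
        rcases h4 with h4 | h4 <;> rw [h4]
        · exact le_add_of_nonneg_right (hc _)
        · exact le_add_of_nonneg_left (hc _)
      rw [← sq_abs, sq]
      have h5 : |∫ ω, ensembleMatrix a ω p q * ensembleMatrix a ω u v ∂P| ≤
          (n : ℝ)⁻¹ * (c ((p : ℤ) - u).natAbs + c ((p : ℤ) - v).natAbs) := by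
        rw [h.integral_entry_mul_eq_covariance, abs_mul, abs_of_nonneg (by positivity)]
        gcongr
      refine (mul_le_mul h2 h5 (abs_nonneg _) (by positivity)).trans_eq ?_
      ring
    · simp
  have h2 : ∀ p v u : Fin n, ∑ q, entryCov P a p q u v ^ 2 ≤
      (n : ℝ)⁻¹ ^ 2 * (c ((p : ℤ) - u).natAbs + c ((p : ℤ) - v).natAbs) := fun p v u =>
    (Finset.sum_le_sum fun q _ => h1 p v u q).trans (sum_ite_le_of_unique _
      (fun i j hi hj => by ext; omega) (mul_nonneg (by positivity) (add_nonneg (hc _) (hc _))))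
  set C := ∑ τ ∈ Finset.range n, c τ with hC
  have hC0 : 0 ≤ C := Finset.sum_nonneg fun τ _ => hc τ
  have h3 : ∀ p : Fin n, ∑ v, ∑ u, ∑ q, entryCov P a p q u v ^ 2 ≤ (n : ℝ)⁻¹ ^ 2 * (4 * n * C) := by
    intro p
    have h4 := sum_natAbs_sub_le hc p
    calc ∑ v, ∑ u, ∑ q, entryCov P a p q u v ^ 2
        ≤ ∑ v : Fin n, ∑ u : Fin n,
          (n : ℝ)⁻¹ ^ 2 * (c ((p : ℤ) - u).natAbs + c ((p : ℤ) - v).natAbs) :=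
          Finset.sum_le_sum fun v _ => Finset.sum_le_sum fun u _ => h2 p v u
      _ = (n : ℝ)⁻¹ ^ 2 * (2 * n * ∑ u : Fin n, c ((p : ℤ) - u).natAbs) := by
          simp only [← Finset.mul_sum, Finset.sum_add_distrib, Finset.sum_const, Finset.card_univ,
            Fintype.card_fin, nsmul_eq_mul]
          ring
      _ ≤ (n : ℝ)⁻¹ ^ 2 * (2 * n * (2 * C)) := by gcongr
      _ = _ := by ring
  refine (Finset.sum_le_sum fun p _ => h3 p).trans ?_
  rw [Finset.sum_const, Finset.card_univ, Fintype.card_fin, nsmul_eq_mul]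
  have h4 : (n : ℝ) * (n : ℝ)⁻¹ ≤ 1 := mul_inv_le_one
  have h5 : (n : ℝ) * (n : ℝ)⁻¹ * (n * (n : ℝ)⁻¹) ≤ 1 := mul_le_one₀ h4 (by positivity) h4
  calc (n : ℝ) * ((n : ℝ)⁻¹ ^ 2 * (4 * n * C)) = (n : ℝ) * (n : ℝ)⁻¹ * (n * (n : ℝ)⁻¹) * (4 * C) := by
        ring
    _ ≤ 1 * (4 * C) := by gcongr
    _ = 4 * C := one_mul _

end IsSkewEnsemble

end CovarianceSum

/-! ### Convergence of the normalised trace -/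

section Semicircle

open Matrix

variable {Ω : Type*} [MeasurableSpace Ω] {P : Measure Ω} {a : (n : ℕ) → Fin n → Fin n → Ω → ℝ}

theorem exists_integral_abs_pow_le
    (hmeas : ∀ (n : ℕ) (p q : Fin n), p ≤ q → Measurable (a n p q)) {k : ℕ}
    (hA2 : (⨆ (n : ℕ) (p : Fin n) (q : Fin n) (_ : p ≤ q), (∫⁻ ω, ‖a n p q ω‖ₑ ^ k ∂P)) < ⊤) :
    ∃ M : ℝ, 0 ≤ M ∧ ∀ (n : ℕ) (p q : Fin n), p ≤ q →
      Integrable (fun ω => |a n p q ω| ^ k) P ∧ ∫ ω, |a n p q ω| ^ k ∂P ≤ M := by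
  refine ⟨(⨆ (n : ℕ) (p : Fin n) (q : Fin n) (_ : p ≤ q), (∫⁻ ω, ‖a n p q ω‖ₑ ^ k ∂P)).toReal,
    ENNReal.toReal_nonneg, fun n p q hpq => ?_⟩
  have hle : ∫⁻ ω, ‖a n p q ω‖ₑ ^ k ∂P ≤
      ⨆ (n : ℕ) (p : Fin n) (q : Fin n) (_ : p ≤ q), (∫⁻ ω, ‖a n p q ω‖ₑ ^ k ∂P) :=
    le_iSup_of_le n (le_iSup_of_le p (le_iSup_of_le q (le_iSup_of_le hpq le_rfl)))
  have e : ∀ ω, ‖a n p q ω‖ₑ ^ k = ENNReal.ofReal (|a n p q ω| ^ k) := fun ω => by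
    rw [Real.enorm_eq_ofReal_abs, ENNReal.ofReal_pow (abs_nonneg _)]
  simp only [e] at hle
  have hm : AEStronglyMeasurable (fun ω => |a n p q ω| ^ k) P :=
    ((hmeas n p q hpq).norm.pow_const k).aestronglyMeasurable
  have h0 : 0 ≤ᵐ[P] fun ω => |a n p q ω| ^ k := Eventually.of_forall fun ω => by positivity
  refine ⟨⟨hm, ?_⟩, ?_⟩
  · rw [hasFiniteIntegral_iff_ofReal h0]
    refine hle.trans_lt ?_
    simpa only [e] using hA2
  · rw [integral_eq_lintegral_of_nonneg_ae h0 hm]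
    exact ENNReal.toReal_mono (by simpa only [e] using hA2.ne) (by simpa only [e] using hle)

variable [IsProbabilityMeasure P] (hE : ∀ n, IsSkewEnsemble P (a n))
include hE

/-- The fourth moment of the normalised fluctuation is at most a constant times n⁻⁴ · n² · n^(1/4) =
n^(-7/4), which is summable. -/
theorem ae_tendsto_trace_green_sub_integral {M : ℝ} (hM0 : 0 ≤ M)
    (hM : ∀ (n : ℕ) (p q : Fin n), p ≤ q → ∫ ω, |a n p q ω| ^ 72 ∂P ≤ M) {y : ℝ} (hy : 1 ≤ y) :
    ∀ᵐ ω ∂P, Tendsto (fun n : ℕ => ((n + 1 : ℕ) : ℂ)⁻¹ *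
      ((green y (ensembleMatrix (a (n + 1)) ω)).trace -
        ∫ ω, (green y (ensembleMatrix (a (n + 1)) ω)).trace ∂P)) atTop (𝓝 0) := by
  have hm : ∀ n : ℕ, Measurable fun ω => ((n + 1 : ℕ) : ℂ)⁻¹ *
      ((green y (ensembleMatrix (a (n + 1)) ω)).trace -
        ∫ ω, (green y (ensembleMatrix (a (n + 1)) ω)).trace ∂P) := fun n =>
    ((measurable_trace_of_entries ((hE (n + 1)).measurable_green y)).sub_const _).const_mul _
  have hbd : ∀ (n : ℕ) ω, ‖(green y (ensembleMatrix (a n) ω)).trace‖ ≤ n := fun n ω => by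
    have h1 := norm_trace_mul_green_le 1 (isSymm_ensembleMatrix (a n) ω) hy
    rwa [one_mul, norm_one_fin, Real.mul_self_sqrt (by positivity)] at h1
  refine ae_tendsto_zero_of_summable_integral_pow hm (fun n => ?_) ?_
  · set c := ∫ ω, (green y (ensembleMatrix (a (n + 1)) ω)).trace ∂P
    refine Integrable.of_bound ((hm n).norm.pow_const 4).aestronglyMeasurable
      ((‖((n + 1 : ℕ) : ℂ)⁻¹‖ * ((n + 1 : ℕ) + ‖c‖)) ^ 4) (Eventually.of_forall fun ω => ?_)
    rw [norm_pow, norm_norm, norm_mul]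
    gcongr
    exact (norm_sub_le _ _).trans (add_le_add (hbd _ ω) le_rfl)
  · set C : ℝ := 10080 * (1 + 2 ^ 72 * (1 + M)) with hC
    have hs : Summable fun n : ℕ => C * (1 / ((n + 1 : ℕ) : ℝ) ^ (7 / 4 : ℝ)) :=
      ((summable_nat_add_iff 1).2
        (Real.summable_one_div_nat_rpow.2 (by norm_num : (1 : ℝ) < 7 / 4))).mul_left C
    refine Summable.of_nonneg_of_le (fun n => integral_nonneg fun ω => by positivity)
      (fun n => ?_) hs
    have hN : (0 : ℝ) < (n + 1 : ℕ) := by positivity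
    have h1 := (hE (n + 1)).integral_norm_trace_sub_pow_four_le hy
    have h2 := (hE (n + 1)).integral_entryBound_pow_eight_le (Nat.succ_pos n) (hM (n + 1))
    simp only [norm_mul, mul_pow]
    rw [integral_const_mul, norm_inv, Complex.norm_natCast]
    set N : ℝ := ((n + 1 : ℕ) : ℝ) with hNdef
    calc _ ≤ N⁻¹ ^ 4 * (10080 * N ^ 2 * ((1 + 2 ^ 72 * (1 + M)) * N ^ (1 / 4 : ℝ))) := by
          gcongr
          exact h1.trans (mul_le_mul_of_nonneg_left h2 (by positivity))
      _ = C * (N ^ (1 / 4 : ℝ) / N ^ 2) := by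
          rw [hC]
          field_simp
      _ = C * (1 / N ^ (7 / 4 : ℝ)) := by
          congr 1
          rw [div_eq_div_iff (by positivity) (by positivity), one_mul, ← Real.rpow_add hN,
            ← Real.rpow_natCast]
          norm_num

/-- After division by √n the residual of the self-consistent equation contributes n^(-1/4) from the
moment of the largest entry and √(∑ c_n(τ)/n) from the covariances; both tend to zero. -/
theorem tendsto_integral_trace_green {M₄ M₇₂ : ℝ} (h4 : 0 ≤ M₄)
    (hM4 : ∀ (n : ℕ) (p q : Fin n), p ≤ q → ∫ ω, |a n p q ω| ^ 4 ∂P ≤ M₄)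
    (hM72 : ∀ (n : ℕ) (p q : Fin n), p ≤ q → ∫ ω, |a n p q ω| ^ 72 ∂P ≤ M₇₂)
    {c : ℕ → ℕ → ℝ} (hc : ∀ n τ, 0 ≤ c n τ)
    (hcov : ∀ (n : ℕ) (p q r s : Fin n), p ≤ q → r ≤ s → (p : ℕ) + q = r + s →
      |covariance (a n p q) (a n r s) P| = c n ((p : ℤ) - r).natAbs)
    (hco : (fun n : ℕ => ∑ τ ∈ Finset.range n, c n τ) =o[atTop] (fun n : ℕ => (n : ℝ)))
    {y : ℝ} (hy : 2 < y) :
    Tendsto (fun n : ℕ => (n : ℂ)⁻¹ * ∫ ω, (green y (ensembleMatrix (a n) ω)).trace ∂P) atTop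
      (𝓝 ((((√(y ^ 2 + 4) - y) / 2 : ℝ) : ℂ) * Complex.I)) := by
  have hy1 : 1 ≤ y := by linarith
  set v : ℝ := (√(y ^ 2 + 4) - y) / 2 with hv
  set m : ℂ := (v : ℂ) * Complex.I with hm
  have hsq : √(y ^ 2 + 4) ^ 2 = y ^ 2 + 4 := Real.sq_sqrt (by positivity)
  have hv0 : 0 ≤ v := by
    have : y ≤ √(y ^ 2 + 4) := Real.le_sqrt_of_sq_le (by linarith)
    rw [hv]
    linarith
  -- The stability condition |m| < 1/2. It is equivalent to √(y² + 4) < y + 1, that is to y > 3/2,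
  -- and so holds with room for y > 2.
  have hv1 : v < 1 / 2 := by
    have : √(y ^ 2 + 4) < y + 1 := by
      rw [Real.sqrt_lt' (by linarith)]
      nlinarith
    rw [hv]
    linarith
  have hveq : v ^ 2 + y * v = 1 := by
    rw [hv]
    linear_combination (1 / 4 : ℝ) * hsq
  have hmn : ‖m‖ = v := by
    rw [hm, norm_mul, Complex.norm_I, mul_one, Complex.norm_real, Real.norm_of_nonneg hv0]
  have hmeq : 1 + ((y : ℂ) * Complex.I) * m + m ^ 2 = 0 := by
    have h1 : ((v : ℂ) ^ 2 + y * v) = 1 := by exact_mod_cast hveq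
    rw [hm]
    linear_combination (y * (v : ℂ) + (v : ℂ) ^ 2) * Complex.I_sq - h1
  set C : ℝ := 6 * (1 + 2 ^ 72 * (1 + M₇₂)) with hC
  set D : ℝ := (30 + 16 * M₄) * 4 with hD
  set S : ℕ → ℝ := fun n => ∑ τ ∈ Finset.range n, c n τ with hS
  have hbound : ∀ n : ℕ, 0 < n →
      ‖(n : ℂ)⁻¹ * ∫ ω, (green y (ensembleMatrix (a n) ω)).trace ∂P - m‖ ≤
      v / (1 - 2 * v) * (C * (n : ℝ) ^ (-(1 / 4) : ℝ) + √(D * (S n / n))) := by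
    intro n hn
    have hN : (0 : ℝ) < n := by exact_mod_cast hn
    have hNC : (n : ℂ) ≠ 0 := by exact_mod_cast hn.ne'
    have hs : 0 < √(n : ℝ) := Real.sqrt_pos.2 hN
    have k1 := (hE n).norm_integral_trace_green_sub_le hy1 m
    have k2 := (hE n).norm_meanGreen_sub_le hy1 hmeq
    have k3 := (hE n).norm_meanGreen_equation_le hy1 h4 (hM4 n)
    have k4 := (hE n).integral_entryBound_pow_eight_le hn (hM72 n)
    have k5 := (hE n).sum_entryCov_sq_le (hc n) (hcov n)
    change _ ≤ 4 * S n at k5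
    rw [hmn] at k2
    have e1 : (n : ℂ)⁻¹ * ∫ ω, (green y (ensembleMatrix (a n) ω)).trace ∂P - m =
        (n : ℂ)⁻¹ * (∫ ω, (green y (ensembleMatrix (a n) ω)).trace ∂P - n * m) := by
      field_simp
    have k6 := k3.trans (add_le_add (mul_le_mul_of_nonneg_left k4 (by norm_num : (0 : ℝ) ≤ 6))
      (Real.sqrt_le_sqrt (mul_le_mul_of_nonneg_left k5 (by positivity : 0 ≤ 30 + 16 * M₄))))
    have k7 := k2.trans (mul_le_mul_of_nonneg_left k6 hv0)
    rw [← le_div_iff₀ (by linarith : 0 < 1 - 2 * v)] at k7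
    rw [e1, norm_mul, norm_inv, Complex.norm_natCast]
    refine (mul_le_mul_of_nonneg_left (k1.trans (mul_le_mul_of_nonneg_left k7 hs.le))
      (by positivity : 0 ≤ (n : ℝ)⁻¹)).trans_eq ?_
    have e2 : √(D * (S n / n)) = √((30 + 16 * M₄) * (4 * S n)) / √(n : ℝ) := by
      rw [← Real.sqrt_div' _ hN.le]
      congr 1
      rw [hD]
      ring
    have e3 : (n : ℝ) ^ (-(1 / 4) : ℝ) = (n : ℝ) ^ (1 / 4 : ℝ) / √(n : ℝ) := by
      rw [Real.sqrt_eq_rpow, ← Real.rpow_sub hN]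
      norm_num
    have e4 : (n : ℝ)⁻¹ * √(n : ℝ) = 1 / √(n : ℝ) := by
      rw [inv_mul_eq_div, Real.sqrt_div_self', one_div]
    rw [e2, e3, hC, ← mul_assoc, e4]
    field_simp
  rw [tendsto_iff_norm_sub_tendsto_zero]
  have hlim : Tendsto (fun n : ℕ => v / (1 - 2 * v) *
      (C * (n : ℝ) ^ (-(1 / 4) : ℝ) + √(D * (S n / n)))) atTop (𝓝 0) := by
    have l1 : Tendsto (fun n : ℕ => (n : ℝ) ^ (-(1 / 4) : ℝ)) atTop (𝓝 0) :=
      (tendsto_rpow_neg_atTop (by norm_num : (0 : ℝ) < 1 / 4)).comp tendsto_natCast_atTop_atTop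
    have l2 : Tendsto (fun n : ℕ => S n / n) atTop (𝓝 0) := hco.tendsto_div_nhds_zero
    have l3 := ((l1.const_mul C).add (l2.const_mul D).sqrt).const_mul (v / (1 - 2 * v))
    simpa using l3
  refine squeeze_zero' (Eventually.of_forall fun n => norm_nonneg _) ?_ hlim
  filter_upwards [eventually_gt_atTop 0] with n hn using hbound n hn

end Semicircle

/-! ### The semicircle law -/

theorem theorem2p2 {Ω : Type*} [MeasurableSpace Ω] (P : Measure Ω) [IsProbabilityMeasure P]
    (a : (n : ℕ) → Fin n → Fin n → Ω → ℝ)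
    (hmeas : ∀ (n : ℕ) (p q : Fin n), p ≤ q → Measurable (a n p q))
    -- centered entries with variance one
    (hA1 : ∀ (n : ℕ) (p q : Fin n), p ≤ q →
      ∫ ω, a n p q ω ∂P = 0 ∧ ∫ ω, a n p q ω ^ 2 ∂P = 1)
    -- uniformly bounded absolute moments
    (hA2 : ∀ k : ℕ,
      (⨆ (n : ℕ) (p : Fin n) (q : Fin n) (_ : p ≤ q), (∫⁻ ω, ‖a n p q ω‖ₑ ^ k ∂P)) < ⊤)
    -- independent skew-diagonals
    (hA3 : ∀ n : ℕ, iIndepFun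
      (fun (r : ℕ) (ω : Ω) (pq : SkewDiagonal n r) => a n pq.1.1 pq.1.2 ω) P)
    -- covariances along a skew-diagonal
    (hC1 : ∃ c : ℕ → ℕ → ℝ,
      (∀ n τ : ℕ, 0 ≤ c n τ) ∧
      (∀ (n : ℕ) (p q r s : Fin n), p ≤ q → r ≤ s → (p : ℕ) + q = r + s →
        |covariance (a n p q) (a n r s) P| = c n ((p : ℤ) - r).natAbs ∧
        |covariance (a n p q) (a n r s) P| = c n ((q : ℤ) - s).natAbs) ∧
      (fun n : ℕ => ∑ τ ∈ Finset.range n, c n τ) =o[atTop] (fun n : ℕ => (n : ℝ))) :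
    ∀ᵐ ω ∂P, Tendsto
      (fun n : ℕ => empiricalEigenvalueDistribution
        (isHermitian_rescaledSymmetricMatrix (fun p q : Fin (n + 1) => a (n + 1) p q ω)))
      atTop (𝓝 semicircleDistribution) := by
  choose M hM0 hM using fun k => exists_integral_abs_pow_le hmeas (hA2 k)
  obtain ⟨c, hc, hcov, hco⟩ := hC1
  have hE : ∀ n, IsSkewEnsemble P (a n) := fun n =>
    { measurable := hmeas n
      integral_eq_zero := fun p q hpq => (hA1 n p q hpq).1
      integral_sq_eq_one := fun p q hpq => (hA1 n p q hpq).2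
      integrable_pow := fun k p q hpq => (hM k n p q hpq).1
      indep := hA3 n }
  -- The exceptional null set must not depend on the spectral parameter, so the parameter is
  -- restricted to the countable set of rationals.
  have hfluct : ∀ᵐ ω ∂P, ∀ q : ℚ, 2 < (q : ℝ) → Tendsto (fun n : ℕ => ((n + 1 : ℕ) : ℂ)⁻¹ *
      ((green q (ensembleMatrix (a (n + 1)) ω)).trace -
        ∫ ω, (green q (ensembleMatrix (a (n + 1)) ω)).trace ∂P)) atTop (𝓝 0) := by
    rw [ae_all_iff]
    intro q
    by_cases hq : 2 < (q : ℝ)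
    · simp only [hq, true_imp_iff]
      exact ae_tendsto_trace_green_sub_integral hE (hM0 72)
        (fun n p q hpq => (hM 72 n p q hpq).2) (by linarith)
    · simp [hq]
  filter_upwards [hfluct] with ω hω
  refine tendsto_of_tendsto_cauchy fun q hq => ?_
  have hmean := (tendsto_integral_trace_green hE (hM0 4)
    (fun n p q hpq => (hM 4 n p q hpq).2) (fun n p q hpq => (hM 72 n p q hpq).2) hc
    (fun n p q r s hpq hrs hsum => (hcov n p q r s hpq hrs hsum).1) hco hq).comp
    (tendsto_add_atTop_nat 1)
  have hsum := (hω q hq).add hmean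
  rw [zero_add] at hsum
  rw [integral_cauchy_semicircleDistribution (by linarith)]
  refine hsum.congr fun n => ?_
  rw [integral_empiricalEigenvalueDistribution _ (by linarith : (q : ℝ) ≠ 0), Fintype.card_fin]
  simp only [Function.comp]
  rw [← mul_add, sub_add_cancel]
  rfl
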